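/- **Model.** Vertices of the square grid $\mathbb Z^2$ may carry tiles. Robots are finite deterministic automata standing on pairwise distinct vertices. In one step, all robots synchronously perform a Look-Compute-Move operation: a robot sees its own state, whether its vertex carries a tile, and the states of robots on the four adjacent vertices; from these its transition function determines its new state, whether its vertex carries a tile afterwards, and its movement (stay, or go to one of the four neighbours). A robot in a halting state does nothing any more. A configuration is *connected* if the grid graph induced by the union of all tiles and all robots is connected. A polyomino is a nonempty finite connected set of vertices (holes are allowed). The *bounding box* of a polyomino $P$ is the rectangular frame, one tile wide, that encloses $P$ with each of its four sides at distance exactly two from $P$. The *scaled copy* of $P$ by the factor $c$ is obtained by replacing every vertex of $P$ by a $c\times c$ square; it is placed directly to the left of the bounding box, i.e. the easternmost column of its enclosing $cw\times ch$ rectangle is adjacent to the west side of the bounding box, and the lowest rows of both coincide. **Theorem.** There is an absolute constant $C$ such that for every integer $c\ge 2$ the following hold. 1. There is a program for a single robot (depending only on $c$) with the following property. Let $P$ be any polyomino of width $w$ and height $h$, already surrounded by its bounding box, where one additional tile, lying between a tile of the lowest row of $P$ and the south side of the bounding box, joins the two, and let the robot start on the bounding box right beneath this tile. Then the robot halts after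 at most $C\cdot wh\,(c^2+cw+ch)$ steps, all configurations up to that time are connected, and the tiles that are left are exactly the scaled copy of $P$ by the factor $c$ next to the position of the bounding box. 2. There is a program for two robots (depending only on $c$) with the following property. Let $P$ be any polyomino of width $w$ and height $h$, already surrounded by its bounding box, and suppose that (as at the end of the construction of the bounding box by two robots) the second robot holds $P$ and the bounding box together, i.e. stands on the vertex between a tile of the lowest row of $P$ and the south side of the bounding box (this vertex may or may not carry a tile), and the first robot stands on the bounding box right beneath it. Then both robots halt after at most $C\cdot wh\,(c^2+cw+ch)$ steps, all configurations up to that time are connected, the robots are never on the same vertex and never exchange places in one step, and the tiles that are left are exactly the scaled copy of $P$ by the factor $c$ next to the position of the bounding box. -/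

import Mathlib

namespace RobotsOnTiles

/-- Vertices of the infinite square grid: `(x, y)` with `x` growing to the east and `y` to the
north. -/
abbrev Cell : Type := ℤ × ℤ

/-- The square grid graph: two vertices are adjacent iff they have distance one. -/
def gridGraph : SimpleGraph Cell where
  Adj u v := |u.1 - v.1| + |u.2 - v.2| = 1
  symm := ⟨fun u v h => by rwa [abs_sub_comm v.1 u.1, abs_sub_comm v.2 u.2]⟩
  loopless := ⟨fun u h => by simp at h⟩

/-- The subgraph of the grid induced by `S` is connected (in particular `S` is nonempty). -/
def GridConnected (S : Finset Cell) : Prop :=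
  (gridGraph.induce (S : Set Cell)).Connected

/-- A polyomino: a (nonempty) finite connected set of occupied vertices; holes are allowed. -/
def IsPolyomino (P : Finset Cell) : Prop := GridConnected P

/-- `P` has width `w` and height `h`, and its smallest enclosing rectangle has lower left
vertex `(a, b)`. -/
structure HasExtent (P : Finset Cell) (a b : ℤ) (w h : ℕ) : Prop where
  inside : ∀ p ∈ P, (a ≤ p.1 ∧ p.1 ≤ a + w - 1) ∧ (b ≤ p.2 ∧ p.2 ≤ b + h - 1)
  west : ∃ p ∈ P, p.1 = a
  east : ∃ p ∈ P, p.1 = a + w - 1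
  south : ∃ p ∈ P, p.2 = b
  north : ∃ p ∈ P, p.2 = b + h - 1

/-- The bounding box of a polyomino of extent `a b w h`: the rectangular frame, one tile wide,
each of whose four sides has distance exactly two from the polyomino. -/
noncomputable def boundingBox (a b : ℤ) (w h : ℕ) : Finset Cell :=
  (Finset.Icc (a - 2) (a + w + 1) ×ˢ Finset.Icc (b - 2) (b + h + 1)).filter fun q =>
    q.1 = a - 2 ∨ q.1 = a + w + 1 ∨ q.2 = b - 2 ∨ q.2 = b + h + 1

/-- `P` scaled by the factor `c`: every vertex is replaced by a `c × c` square. -/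
noncomputable def scale (c : ℕ) (P : Finset Cell) : Finset Cell :=
  P.biUnion fun p =>
    Finset.Ico ((c : ℤ) * p.1) (c * p.1 + c) ×ˢ Finset.Ico ((c : ℤ) * p.2) (c * p.2 + c)

/-- The translate of `S` by `v`. -/
noncomputable def translate (v : ℤ × ℤ) (S : Finset Cell) : Finset Cell :=
  S.image fun q => q + v

/-- The copy of `P` (of extent `a b w h`), scaled by `c`, directly to the left of the bounding box:
its enclosing `cw × ch` rectangle ends at the column west of the bounding box and has the
same lowest row as the bounding box. -/
noncomputable def scaledCopy (c : ℕ) (P : Finset Cell) (a b : ℤ) (w : ℕ) : Finset Cell :=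
  translate ((a - 2 - c * w) - c * a, (b - 2) - c * b) (scale c P)

/-- The four compass directions. -/
inductive Dir : Type
  | north | east | south | west
  deriving DecidableEq

/-- The unit vector of a direction. -/
def Dir.vec : Dir → ℤ × ℤ
  | .north => (0, 1)
  | .east => (1, 0)
  | .south => (0, -1)
  | .west => (-1, 0)

/-- The vertex reached from `u` by a movement (`none`: the robot does not move). -/
def move (u : Cell) : Option Dir → Cell
  | none => u
  | some d => u + d.vec

/-- A program for `k` robots that are finite deterministic automata. In one
Look-Compute-Move operation a robot sees its own state, whether its vertex carries a tile, and the
states of the robots on the four adjacent vertices; it determines its new state, whether its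
vertex carries a tile afterwards, and its movement. The robots share the set of states
and the transition function but may have different start states, so they can act as different
automata. -/
structure Program (k : ℕ) where
  State : Type
  finiteState : Finite State
  start : Fin k → State
  halting : State → Bool
  trans : State → Bool → (Dir → Option State) → State × Bool × Option Dir

/-- A configuration: the placed tiles, and the positions and states of the robots. -/
structure Config (State : Type) (k : ℕ) where
  tiles : Finset Cell
  pos : Fin k → Cell
  state : Fin k → State

/-- The vertices that carry a robot. -/
def Config.robots {State : Type} {k : ℕ} (X : Config State k) : Finset Cell :=
  Finset.univ.image X.pos

/-- The state of the robot on vertex `u`, if there is one. -/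
def Config.robotAt {State : Type} {k : ℕ} (X : Config State k) (u : Cell) : Option State :=
  ((List.finRange k).find? fun j => decide (X.pos j = u)).map X.state

/-- Connectivity: the grid graph induced by the union of all tiles and all robots is connected. -/
def Config.Connected {State : Type} {k : ℕ} (X : Config State k) : Prop :=
  GridConnected (X.tiles ∪ X.robots)

namespace Program

variable {k : ℕ}

/-- The result of the Look-Compute phase of robot `i`: new state, new status of its vertex, and
movement. A robot in a halting state does nothing any more. -/
def action (A : Program k) (X : Config A.State k) (i : Fin k) :
    A.State × Bool × Option Dir :=
  if A.halting (X.state i) then (X.state i, decide (X.pos i ∈ X.tiles), none)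
  else A.trans (X.state i) (decide (X.pos i ∈ X.tiles))
    fun d => X.robotAt (X.pos i + d.vec)

/-- One step: all robots perform one Look-Compute-Move operation synchronously. -/
def step (A : Program k) (X : Config A.State k) : Config A.State k where
  tiles := (X.tiles \ X.robots) ∪
    (Finset.univ.filter fun i => (A.action X i).2.1 = true).image X.pos
  pos i := move (X.pos i) (A.action X i).2.2
  state i := (A.action X i).1

/-- The configuration after `t` steps. -/
def run (A : Program k) (X : Config A.State k) (t : ℕ) : Config A.State k :=
  A.step^[t] X

/-- The initial configuration with the given tiles and robot positions; every robot is in its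
start state. -/
def initial (A : Program k) (tiles : Finset Cell) (pos : Fin k → Cell) : Config A.State k where
  tiles := tiles
  pos := pos
  state := A.start

/-- Started on `tiles` with the robots at `pos`, all robots halt within `T` steps, the tiles
then form exactly `goal`, connectivity is never lost, no two robots are ever on the same
vertex, and no two robots ever exchange their places in one step. -/
def Performs (A : Program k) (tiles : Finset Cell) (pos : Fin k → Cell)
    (goal : Finset Cell) (T : ℕ) : Prop :=
  ∃ t ≤ T,
    (∀ i, A.halting ((A.run (A.initial tiles pos) t).state i) = true) ∧
    (A.run (A.initial tiles pos) t).tiles = goal ∧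
    (∀ s ≤ t, (A.run (A.initial tiles pos) s).Connected) ∧
    (∀ s ≤ t, Function.Injective (A.run (A.initial tiles pos) s).pos) ∧
    (∀ s < t, ∀ i j, i ≠ j →
      ¬((A.run (A.initial tiles pos) (s + 1)).pos i = (A.run (A.initial tiles pos) s).pos j ∧
        (A.run (A.initial tiles pos) (s + 1)).pos j = (A.run (A.initial tiles pos) s).pos i))

end Program

end RobotsOnTiles

open RobotsOnTiles

/-! The robot has bounded memory, so both its progress and its way back must be legible from the
tiles. It reads the vertices of `P` row by row from the south, each row from east to west, carries
the one bit just read in its control state to the other side of the frame, and appends one block to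
the copy there.

Reading side (`field`). A horizontal bar of tiles spans the frame just below the current row `Y`.
After a vertex has been read it is filled, and the bar tile beneath it is removed, so the bar climbs
by one row and has a step exactly at the next vertex to read. This erases `P`, yet connectivity
never depends on its shape: when the tile below the step goes, its remaining neighbours lie on the
western or the eastern piece of the bar, and these are joined around the frame (`Conn.erase`,
`Exec.mark`). For the lowest row, `prep` first moves the south side of the frame down by one, which
makes room for the bar and for a corridor beneath it.

Copying side (`dest`). The west side of the frame serves as a spine, extended to the north when
necessary. A vertex of `P` becomes a full `c × c` square, and any other vertex of the enclosing
rectangle still becomes the highest row of its square. These highest rows, the teeth, do not depend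
on `P` (`mem_dest_tooth`), so they show in unary how many rows have been begun and how far the
current one has come; this is how `Exec.findBlock` finds the place of the next block. When all rows
are done the frame is removed except for the spine. Since `2 ≤ c`, a tooth tile belongs to a full
square iff there is a tile just below it (`mem_copySet_below`), which allows `Exec.carveRow` to
remove the superfluous tiles. Finally the spine is removed from both ends towards a vertex where it
touches the copy.

A round trip costs `O(c²)` for the block, `O(cw)` along bar and tooth and `O(ch)` along the spine,
and there are `wh` of them.

The algorithm is written in a small while language. `Exec` is a Hoare triple with a time bound in
which every single step is safe; connectivity is its premise and is handed on by `Steps.safe`. Two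
robots simulate one: the active robot computes and the other follows on a neighbouring vertex. If
the active robot has to move onto its follower, they exchange roles and not places (`twin_oneStep`).
Every simulated step costs at most two steps. -/

namespace RobotsOnTiles

/-! ### Connectivity of sets of vertices -/

/-- `u` and `v` are joined by a walk inside `S`. -/
def Link (S : Set Cell) (u v : Cell) : Prop :=
  Relation.ReflTransGen (fun p q => gridGraph.Adj p q ∧ p ∈ S ∧ q ∈ S) u v

/-- `S` is nonempty and any two of its vertices are joined inside `S`. -/
def Conn (S : Set Cell) : Prop :=
  S.Nonempty ∧ ∀ u ∈ S, ∀ v ∈ S, Link S u v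

/-- `u` belongs to `S` or is adjacent to a vertex of `S`. -/
def Att (S : Set Cell) (u : Cell) : Prop :=
  u ∈ S ∨ ∃ v ∈ S, gridGraph.Adj u v

theorem adj_iff {u v : Cell} : gridGraph.Adj u v ↔ |u.1 - v.1| + |u.2 - v.2| = 1 := Iff.rfl

theorem adj_dir (u : Cell) (d : Dir) : gridGraph.Adj u (u + d.vec) := by
  rw [adj_iff]; cases d <;> simp [Dir.vec]

theorem exists_dir_of_adj {u v : Cell} (h : gridGraph.Adj u v) : ∃ d : Dir, v = u + d.vec := by
  obtain ⟨x, y⟩ := u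
  obtain ⟨x', y'⟩ := v
  rw [adj_iff] at h
  simp only at h
  have : (x' = x ∧ y' = y + 1) ∨ (x' = x + 1 ∧ y' = y) ∨ (x' = x ∧ y' = y - 1) ∨
      (x' = x - 1 ∧ y' = y) := by grind
  rcases this with ⟨rfl, rfl⟩ | ⟨rfl, rfl⟩ | ⟨rfl, rfl⟩ | ⟨rfl, rfl⟩
  · exact ⟨.north, by simp [Dir.vec]⟩
  · exact ⟨.east, by simp [Dir.vec]⟩
  · exact ⟨.south, by simp [Dir.vec, sub_eq_add_neg]⟩
  · exact ⟨.west, by simp [Dir.vec, sub_eq_add_neg]⟩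

theorem Link.refl {S : Set Cell} (u : Cell) : Link S u u := Relation.ReflTransGen.refl

theorem Link.symm {S : Set Cell} {u v : Cell} (h : Link S u v) : Link S v u := by
  induction h with
  | refl => exact Relation.ReflTransGen.refl
  | tail _ hpq ih => exact Relation.ReflTransGen.head ⟨hpq.1.symm, hpq.2.2, hpq.2.1⟩ ih

theorem Link.trans {S : Set Cell} {u v z : Cell} (h : Link S u v) (h' : Link S v z) :
    Link S u z := Relation.ReflTransGen.trans h h'

theorem Link.mono {S T : Set Cell} (hST : S ⊆ T) {u v : Cell} (h : Link S u v) : Link T u v := by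
  induction h with
  | refl => exact Relation.ReflTransGen.refl
  | tail _ hpq ih => exact ih.tail ⟨hpq.1, hST hpq.2.1, hST hpq.2.2⟩

theorem Link.single {S : Set Cell} {u v : Cell} (h : gridGraph.Adj u v) (hu : u ∈ S)
    (hv : v ∈ S) : Link S u v := Relation.ReflTransGen.single ⟨h, hu, hv⟩

theorem Conn.of_hub {S : Set Cell} {z : Cell} (hz : z ∈ S) (h : ∀ u ∈ S, Link S u z) : Conn S :=
  ⟨⟨z, hz⟩, fun u hu v hv => (h u hu).trans (h v hv).symm⟩

theorem Conn.insert {S : Set Cell} {u : Cell} (hS : Conn S) (hu : Att S u) :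
    Conn (insert u S) := by
  rcases hu with hu | ⟨v, hv, huv⟩
  · rwa [Set.insert_eq_of_mem hu]
  · refine Conn.of_hub (z := v) (Set.mem_insert_of_mem _ hv) ?_
    rintro z (rfl | hz)
    · exact Link.single huv (Set.mem_insert _ _) (Set.mem_insert_of_mem _ hv)
    · exact (hS.2 z hz v hv).mono (Set.subset_insert _ _)

/-- A vertex may be deleted if its remaining neighbours stay joined to one vertex. -/
theorem Conn.erase {S : Set Cell} {u z : Cell} (hS : Conn S) (hz : z ∈ S \ {u})
    (h : ∀ d : Dir, u + d.vec ∈ S → Link (S \ {u}) (u + d.vec) z) : Conn (S \ {u}) := by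
  refine Conn.of_hub hz fun v hv => ?_
  -- Induction along a walk to `z`. If the walk is about to enter `u`, it stands on a neighbour of
  -- `u`, and `h` replaces the rest of the walk.
  have key : ∀ p, Link S p z → p ≠ u → Link (S \ {u}) p z := by
    intro p hp
    induction hp using Relation.ReflTransGen.head_induction_on with
    | refl => exact fun _ => Link.refl z
    | @head p q hpq _ ih =>
      intro hpu
      by_cases hq : q = u
      · subst hq
        obtain ⟨d, rfl⟩ := exists_dir_of_adj hpq.1.symm
        exact h d hpq.2.1
      · have hl : Link (S \ {u}) p q := Link.single hpq.1 ⟨hpq.2.1, hpu⟩ ⟨hpq.2.2, hq⟩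
        exact hl.trans (ih hq)
  exact key v (hS.2 v hv.1 z hz.1) hv.2

theorem Link.of_reachable {S : Set Cell} {u v : S} (h : (gridGraph.induce S).Reachable u v) :
    Link S u v := by
  obtain ⟨p⟩ := h
  induction p with
  | nil => exact Link.refl _
  | @cons u v z huv _ ih => exact (Link.single huv u.2 v.2).trans ih

theorem Link.reachable {S : Set Cell} {u v : Cell} (h : Link S u v) (hu : u ∈ S) (hv : v ∈ S) :
    (gridGraph.induce S).Reachable ⟨u, hu⟩ ⟨v, hv⟩ := by
  induction h with
  | refl => exact SimpleGraph.Reachable.refl _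
  | @tail p q _ hpq ih =>
    refine (ih hpq.2.1).trans (SimpleGraph.Adj.reachable ?_)
    exact hpq.1

/-- All tile sets of the algorithm are given by inequalities and treated as `Set`s; this is the
bridge to the connectivity of the model. -/
theorem conn_coe_iff {T : Finset Cell} : Conn (T : Set Cell) ↔ GridConnected T := by
  constructor
  · rintro ⟨⟨z, hz⟩, h⟩
    have : Nonempty (T : Set Cell) := ⟨⟨z, hz⟩⟩
    exact ⟨fun u v => (h u u.2 v v.2).reachable u.2 v.2⟩
  · intro h
    obtain ⟨z⟩ := h.nonempty
    exact ⟨⟨z, z.2⟩, fun u hu v hv => Link.of_reachable (h.preconnected ⟨u, hu⟩ ⟨v, hv⟩)⟩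

/-! ### Structured programs for one robot -/

/-- A while language: a step, sequential composition, branching on the tile of the
vertex of the robot, and a loop that runs while the presence of a tile equals `b`. -/
inductive Prog : Type
  | act (wr : Option Bool) (d : Option Dir)
  | seq (p q : Prog)
  | ite (p q : Prog)
  | whl (b : Bool) (p : Prog)

namespace Prog

/-- The states of the automaton that runs a program. -/
def State : Prog → Type
  | act _ _ => Unit
  | seq p q => p.State ⊕ q.State
  | ite p q => Option (p.State ⊕ q.State)
  | whl _ p => Option p.State

theorem finite_state : (p : Prog) → Finite p.State
  | act _ _ => inferInstanceAs (Finite Unit)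
  | seq p q =>
    haveI := p.finite_state
    haveI := q.finite_state
    inferInstanceAs (Finite (p.State ⊕ q.State))
  | ite p q =>
    haveI := p.finite_state
    haveI := q.finite_state
    inferInstanceAs (Finite (Option (p.State ⊕ q.State)))
  | whl _ p =>
    haveI := p.finite_state
    inferInstanceAs (Finite (Option p.State))

/-- The initial state. -/
def start : (p : Prog) → p.State
  | act _ _ => ()
  | seq p _ => Sum.inl p.start
  | ite _ _ => (none : Option (_ ⊕ _))
  | whl _ _ => (none : Option _)

/-- The transition function; the new state `none` is the exit. -/
def trans : (p : Prog) → p.State → Bool → Option p.State × Bool × Option Dir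
  | act wr d, _, t => (none, wr.getD t, d)
  -- The exit of `p` is the start of `q` in the same step, so sequencing costs no time.
  | seq p q, Sum.inl s, t =>
    (some (((p.trans s t).1.map Sum.inl).getD (Sum.inr q.start)), (p.trans s t).2)
  | seq _ q, Sum.inr s, t => ((q.trans s t).1.map Sum.inr, (q.trans s t).2)
  | ite p q, none, t =>
    (some (some (if t then Sum.inl p.start else Sum.inr q.start)), t, none)
  | ite p _, some (Sum.inl s), t => ((p.trans s t).1.map (some ∘ Sum.inl), (p.trans s t).2)
  | ite _ q, some (Sum.inr s), t => ((q.trans s t).1.map (some ∘ Sum.inr), (q.trans s t).2)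
  | whl b p, none, t => (if t = b then some (some p.start) else none, t, none)
  -- The exit `none` of the body, read as a state of the loop, is the test, so the body leads back
  -- to it.
  | whl _ p, some s, t => (some (p.trans s t).1, (p.trans s t).2)

end Prog

/-! ### Runs of structured programs, their duration and their safety -/

/-- The tiles after writing `b` on `u`. -/
def upd (S : Set Cell) (u : Cell) (b : Bool) : Set Cell := if b then insert u S else S \ {u}

/-- One step of the automaton with transition function `tr` leads from state `s`,
tiles `S`, vertex `u` to state `o`, tiles `S'`, vertex `u'`;
the tiles stay connected and the robot stays attached to them,
also if it writes before it moves. -/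
def OneStep {σ : Type} (tr : σ → Bool → Option σ × Bool × Option Dir)
    (s : σ) (S : Set Cell) (u : Cell) (o : Option σ) (S' : Set Cell) (u' : Cell) : Prop :=
  ∃ t : Bool, (t = true ↔ u ∈ S) ∧ o = (tr s t).1 ∧ S' = upd S u (tr s t).2.1 ∧
    u' = move u (tr s t).2.2 ∧ Conn S' ∧ Att S' u ∧ Att S' u'

/-- `Steps tr m s S u o S' u'`: the automaton gets in `m` steps
from state `s`, tiles `S`, vertex `u` to state `o`, tiles `S'`, vertex `u'`. -/
inductive Steps {σ : Type} (tr : σ → Bool → Option σ × Bool × Option Dir) :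
    ℕ → σ → Set Cell → Cell → Option σ → Set Cell → Cell → Prop
  | one {s : σ} {S S' : Set Cell} {u u' : Cell} {o : Option σ}
      (h : OneStep tr s S u o S' u') : Steps tr 1 s S u o S' u'
  | cons {s s₁ : σ} {S S₁ S₂ : Set Cell} {u u₁ u₂ : Cell} {o : Option σ} {m : ℕ}
      (h : OneStep tr s S u (some s₁) S₁ u₁) (h' : Steps tr m s₁ S₁ u₁ o S₂ u₂) :
      Steps tr (m + 1) s S u o S₂ u₂

theorem Steps.trans {σ : Type} {tr : σ → Bool → Option σ × Bool × Option Dir} {m n : ℕ}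
    {s s₁ : σ} {S S₁ S₂ : Set Cell} {u u₁ u₂ : Cell} {o : Option σ}
    (h : Steps tr m s S u (some s₁) S₁ u₁) (h' : Steps tr n s₁ S₁ u₁ o S₂ u₂) :
    Steps tr (m + n) s S u o S₂ u₂ := by
  generalize ho : some s₁ = o₁ at h
  induction h with
  | one h =>
    subst ho
    rw [Nat.add_comm]
    exact .cons h h'
  | @cons s s₁ S S₁ S₂ u u₁ u₂ o m h _ ih =>
    rw [show m + 1 + n = m + n + 1 by omega]
    exact .cons h (ih h' ho)

theorem OneStep.embed {σ σ' : Type} {tr : σ → Bool → Option σ × Bool × Option Dir}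
    {tr' : σ' → Bool → Option σ' × Bool × Option Dir} {f : σ → σ'} {g : Option σ → Option σ'}
    (hf : ∀ s t, tr' (f s) t = (g (tr s t).1, (tr s t).2))
    {s : σ} {S S₁ : Set Cell} {u u₁ : Cell} {o : Option σ}
    (h : OneStep tr s S u o S₁ u₁) : OneStep tr' (f s) S u (g o) S₁ u₁ := by
  obtain ⟨t, ht, rfl, hS, hu, h⟩ := h
  exact ⟨t, ht, by rw [hf], by rw [hf]; exact hS, by rw [hf]; exact hu, h⟩

/-- A composite automaton contains copies of its parts: `f` embeds the states, and `g` tells what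
becomes of an exit. One induction thus serves sequences, branches and loops. -/
theorem Steps.embed {σ σ' : Type} {tr : σ → Bool → Option σ × Bool × Option Dir}
    {tr' : σ' → Bool → Option σ' × Bool × Option Dir} {f : σ → σ'} {g : Option σ → Option σ'}
    (hg : ∀ s, g (some s) = some (f s)) (hf : ∀ s t, tr' (f s) t = (g (tr s t).1, (tr s t).2))
    {m : ℕ} {s : σ} {S S₁ : Set Cell} {u u₁ : Cell} {o : Option σ}
    (h : Steps tr m s S u o S₁ u₁) : Steps tr' m (f s) S u (g o) S₁ u₁ := by
  induction h with
  | one h => exact .one (h.embed hf)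
  | cons h _ ih => exact .cons (hg _ ▸ h.embed hf) ih

theorem Steps.safe {σ : Type} {tr : σ → Bool → Option σ × Bool × Option Dir} {m : ℕ}
    {s : σ} {S S' : Set Cell} {u u' : Cell} {o : Option σ}
    (h : Steps tr m s S u o S' u') : Conn S' ∧ Att S' u' := by
  induction h with
  | one h =>
    obtain ⟨t, _, _, _, _, hc, _, ha⟩ := h
    exact ⟨hc, ha⟩
  | cons _ _ ih => exact ih

/-- The program `p`, started on tiles `S` with the robot on `u`, terminates within `n` steps
with tiles `S'` and the robot on `u'`, without losing connectivity. -/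
def Exec (p : Prog) (S : Set Cell) (u : Cell) (S' : Set Cell) (u' : Cell) (n : ℤ) : Prop :=
  Conn S → Att S u → ∃ m : ℕ, (m : ℤ) ≤ n ∧ Steps p.trans m p.start S u none S' u'

namespace Exec

variable {p q : Prog} {S S₁ S₂ : Set Cell} {u u₁ u₂ : Cell} {m n : ℤ}

theorem mono (h : Exec p S u S₁ u₁ m) (hmn : m ≤ n) : Exec p S u S₁ u₁ n := fun hc ha =>
  let ⟨k, hk, hs⟩ := h hc ha
  ⟨k, hk.trans hmn, hs⟩

theorem act {wr : Option Bool} {d : Option Dir} (t : Bool) (ht : t = true ↔ u ∈ S)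
    (h : Conn S → Att S u → Conn (upd S u (wr.getD t)) ∧ Att (upd S u (wr.getD t)) u ∧
      Att (upd S u (wr.getD t)) (RobotsOnTiles.move u d)) :
    Exec (.act wr d) S u (upd S u (wr.getD t)) (RobotsOnTiles.move u d) 1 := fun hc ha =>
  let ⟨h₁, h₂, h₃⟩ := h hc ha
  ⟨1, le_rfl, .one ⟨t, ht, rfl, rfl, rfl, h₁, h₂, h₃⟩⟩

theorem seq (h : Exec p S u S₁ u₁ m) (h' : Exec q S₁ u₁ S₂ u₂ n) :
    Exec (.seq p q) S u S₂ u₂ (m + n) := by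
  intro hc ha
  obtain ⟨k, hk, hs⟩ := h hc ha
  obtain ⟨l, hl, hs'⟩ := h' hs.safe.1 hs.safe.2
  refine ⟨k + l, by push_cast; omega, ?_⟩
  refine Steps.trans (s₁ := (Sum.inr q.start : p.State ⊕ q.State)) (S₁ := S₁) (u₁ := u₁) ?_ ?_
  · exact hs.embed (tr' := (Prog.seq p q).trans) (f := Sum.inl)
      (g := fun o => some ((o.map Sum.inl).getD (Sum.inr q.start))) (fun _ => rfl) (fun _ _ => rfl)
  · exact hs'.embed (tr' := (Prog.seq p q).trans) (f := Sum.inr) (g := Option.map Sum.inr)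
      (fun _ => rfl) (fun _ _ => rfl)

theorem upd_self {b : Bool} (hb : b = true ↔ u ∈ S) : upd S u b = S := by
  cases b
  · simp only [upd, Bool.false_eq_true, if_false]
    exact Set.sdiff_singleton_eq_self (fun h => by simp [h] at hb)
  · simp only [upd, if_true]
    exact Set.insert_eq_of_mem (hb.1 rfl)

theorem oneStep_test {σ : Type} {tr : σ → Bool → Option σ × Bool × Option Dir} {s : σ} {t : Bool}
    {o : Option σ} (ht : t = true ↔ u ∈ S) (h : tr s t = (o, t, none)) (hc : Conn S)
    (ha : Att S u) : OneStep tr s S u o S u :=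
  ⟨t, ht, by rw [h], by rw [h]; exact (upd_self ht).symm, by rw [h]; rfl, hc, ha, ha⟩

theorem ite_true (hu : u ∈ S) (h : Exec p S u S₁ u₁ m) : Exec (.ite p q) S u S₁ u₁ (m + 1) := by
  intro hc ha
  obtain ⟨k, hk, hs⟩ := h hc ha
  refine ⟨k + 1, by push_cast; omega, ?_⟩
  refine Steps.cons (s₁ := (some (Sum.inl p.start) : Option (p.State ⊕ q.State)))
    (oneStep_test (t := true) (by simp [hu]) rfl hc ha) ?_
  exact hs.embed (tr' := (Prog.ite p q).trans) (f := some ∘ Sum.inl)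
    (g := Option.map (some ∘ Sum.inl)) (fun _ => rfl) (fun _ _ => rfl)

theorem ite_false (hu : u ∉ S) (h : Exec q S u S₁ u₁ m) : Exec (.ite p q) S u S₁ u₁ (m + 1) := by
  intro hc ha
  obtain ⟨k, hk, hs⟩ := h hc ha
  refine ⟨k + 1, by push_cast; omega, ?_⟩
  refine Steps.cons (s₁ := (some (Sum.inr q.start) : Option (p.State ⊕ q.State)))
    (oneStep_test (t := false) (by simp [hu]) rfl hc ha) ?_
  exact hs.embed (tr' := (Prog.ite p q).trans) (f := some ∘ Sum.inr)
    (g := Option.map (some ∘ Sum.inr)) (fun _ => rfl) (fun _ _ => rfl)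

theorem whl_done {b : Bool} (hb : ¬(b = true ↔ u ∈ S)) : Exec (.whl b p) S u S u 1 := by
  intro hc ha
  refine ⟨1, le_rfl, .one (oneStep_test (t := !b) (by cases b <;> simp_all) ?_ hc ha)⟩
  cases b <;> rfl

theorem whl_step {b : Bool} (hb : b = true ↔ u ∈ S) (h : Exec p S u S₁ u₁ m)
    (h' : Exec (.whl b p) S₁ u₁ S₂ u₂ n) : Exec (.whl b p) S u S₂ u₂ (m + n + 1) := by
  intro hc ha
  obtain ⟨k, hk, hs⟩ := h hc ha
  obtain ⟨l, hl, hs'⟩ := h' hs.safe.1 hs.safe.2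
  refine ⟨k + l + 1, by push_cast; omega, ?_⟩
  refine Steps.cons (s₁ := (some p.start : Option p.State))
    (oneStep_test (t := b) hb (by cases b <;> rfl) hc ha) ?_
  refine Steps.trans (s₁ := (none : Option p.State)) ?_ hs'
  exact hs.embed (tr' := (Prog.whl b p).trans) (f := some) (g := some)
      (fun _ => rfl) (fun _ _ => rfl)

end Exec

/-! ### From structured programs to programs for one and for two robots -/

/-- From the configuration `X`, the program reaches `goal` and halts after `n` steps, with the side
conditions of `Program.Performs`. -/
inductive Reaches {k : ℕ} (A : Program k) (goal : Finset Cell) : ℕ → Config A.State k → Prop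
  | halt {X : Config A.State k} (hh : ∀ i, A.halting (X.state i) = true) (hg : X.tiles = goal)
      (hc : X.Connected) (hi : Function.Injective X.pos) : Reaches A goal 0 X
  | step {X : Config A.State k} {n : ℕ} (hc : X.Connected) (hi : Function.Injective X.pos)
      (hs : ∀ i j, i ≠ j → ¬((A.step X).pos i = X.pos j ∧ (A.step X).pos j = X.pos i))
      (h : Reaches A goal n (A.step X)) : Reaches A goal (n + 1) X

theorem Reaches.run {k : ℕ} {A : Program k} {goal : Finset Cell} {n : ℕ} {X : Config A.State k}
    (h : Reaches A goal n X) :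
    (∀ i, A.halting ((A.run X n).state i) = true) ∧ (A.run X n).tiles = goal ∧
    (∀ s ≤ n, (A.run X s).Connected) ∧ (∀ s ≤ n, Function.Injective (A.run X s).pos) ∧
    (∀ s < n, ∀ i j, i ≠ j → ¬((A.run X (s + 1)).pos i = (A.run X s).pos j ∧
        (A.run X (s + 1)).pos j = (A.run X s).pos i)) := by
  induction h with
  | halt hh hg hc hi =>
    refine ⟨hh, hg, fun s hs => ?_, fun s hs => ?_, fun s hs => absurd hs (Nat.not_lt_zero s)⟩ <;>
    · obtain rfl : s = 0 := by omega
      assumption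
  | @step X n hc hi hs _ ih =>
    have hr : ∀ s, A.run X (s + 1) = A.run (A.step X) s :=
      fun s => Function.iterate_succ_apply _ _ _
    obtain ⟨h₁, h₂, h₃, h₄, h₅⟩ := ih
    refine ⟨by rwa [hr], by rwa [hr], fun s hs' => ?_, fun s hs' => ?_, fun s hs' => ?_⟩
    · cases s with
      | zero => exact hc
      | succ s => rw [hr]; exact h₃ s (by omega)
    · cases s with
      | zero => exact hi
      | succ s => rw [hr]; exact h₄ s (by omega)
    · cases s with
      | zero => exact hs
      | succ s => rw [hr, hr]; exact h₅ s (by omega)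

theorem Reaches.performs {k : ℕ} {A : Program k} {goal tiles : Finset Cell}
    {pos : Fin k → Cell} {n T : ℕ} (h : Reaches A goal n (A.initial tiles pos)) (hT : n ≤ T) :
    A.Performs tiles pos goal T := ⟨n, hT, h.run⟩

/-! ### Running a structured program on a single robot -/

/-- The tiles after writing `b` on `u`. -/
def fupd (T : Finset Cell) (u : Cell) (b : Bool) : Finset Cell :=
  if b then insert u T else T.erase u

theorem coe_fupd (T : Finset Cell) (u : Cell) (b : Bool) :
    (fupd T u b : Set Cell) = upd (T : Set Cell) u b := by
  cases b <;> simp [fupd, upd]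

/-- The program that runs a structured program on a single robot. -/
abbrev single (p : Prog) : Program 1 where
  State := Option p.State
  finiteState := haveI := p.finite_state; inferInstance
  start _ := some p.start
  halting := Option.isNone
  trans s t _ := match s with
    | none => (none, t, none)
    | some s => p.trans s t

theorem connected_single {σ : Type} {T : Finset Cell} {u : Cell} {s : Fin 1 → σ}
    (hc : Conn (T : Set Cell)) (ha : Att (T : Set Cell) u) :
    Config.Connected (⟨T, fun _ => u, s⟩ : Config σ 1) := by
  rw [Config.Connected, ← conn_coe_iff]
  have : (T ∪ Config.robots (⟨T, fun _ => u, s⟩ : Config σ 1) : Finset Cell) = insert u T := by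
    ext q; simp [Config.robots, eq_comm]
  rw [this, Finset.coe_insert]
  exact hc.insert ha

theorem single_step (p : Prog) (T : Finset Cell) (u : Cell) (s : p.State) :
    (single p).step ⟨T, fun _ => u, fun _ => some s⟩ =
      ⟨fupd T u (p.trans s (decide (u ∈ T))).2.1, fun _ => move u (p.trans s (decide (u ∈ T))).2.2,
        fun _ => (p.trans s (decide (u ∈ T))).1⟩ := by
  have ha : ∀ i, (single p).action ⟨T, fun _ => u, fun _ => some s⟩ i =
      p.trans s (decide (u ∈ T)) := fun i => rfl
  simp only [Program.step, ha, Config.robots]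
  congr 1
  ext q
  cases h : (p.trans s (decide (u ∈ T))).2.1 <;> simp [fupd, and_comm]

theorem single_reaches {p : Prog} {m : ℕ} {s : p.State} {T goal : Finset Cell}
    {S' : Set Cell} {u u' : Cell} (hc : Conn (T : Set Cell)) (ha : Att (T : Set Cell) u)
    (h : Steps p.trans m s (T : Set Cell) u none S' u') (hS : S' = goal) :
    Reaches (single p) goal m ⟨T, fun _ => u, fun _ => some s⟩ := by
  generalize hST : (T : Set Cell) = S at h hc ha
  generalize ho : (none : Option p.State) = o at h
  have hi : ∀ u : Cell, Function.Injective (fun _ : Fin 1 => u) := fun u i j _ =>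
    Subsingleton.elim i j
  have hs : ∀ {X Y : Config (single p).State 1} (i j : Fin 1), i ≠ j →
      ¬(X.pos i = Y.pos j ∧ X.pos j = Y.pos i) := fun i j hij => absurd (Subsingleton.elim i j) hij
  induction h generalizing T with
  | @one s S S' u u' o h =>
    subst ho hST
    obtain ⟨t, ht, ho, rfl, rfl, hc', ha', ha''⟩ := h
    obtain rfl : t = decide (u ∈ T) := by
      rw [Bool.eq_iff_iff, ht]; simp
    refine .step (connected_single hc ha) (hi _) hs ?_
    rw [single_step]
    rw [← coe_fupd] at *
    refine .halt (fun _ => ?_) ?_ (connected_single hc' ha'') (hi _)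
    · simp [← ho]
    · exact Finset.coe_injective hS
  | @cons s s₁ S S₁ S₂ u u₁ u₂ o m h _ ih =>
    subst ho hST
    obtain ⟨t, ht, ho, rfl, rfl, hc', ha', ha''⟩ := h
    obtain rfl : t = decide (u ∈ T) := by
      rw [Bool.eq_iff_iff, ht]; simp
    refine .step (connected_single hc ha) (hi _) hs ?_
    rw [single_step, ← ho]
    exact ih hS (coe_fupd _ _ _) hc' ha'' rfl

/-! ### Simulating a single robot by two -/

/-- The states of two robots that together simulate one robot: the active robot computes, then
is ready to move; the other robot follows it. -/
inductive TwinState (σ : Type) : Type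
  | wait
  | place
  | active (s : Option σ)
  | ready (s : Option σ) (d : Dir)
  | follow
  | stopped

instance : Finite Dir :=
  Finite.of_injective (fun d : Dir => ((match d with
    | .north => 0 | .east => 1 | .south => 2 | .west => 3) : Fin 4))
    (by intro d e; cases d <;> cases e <;> simp)

instance {σ : Type} [Finite σ] : Finite (TwinState σ) := by
  let f : TwinState σ → Fin 6 × Option (Option σ) × Option Dir := fun
    | .wait => (0, none, none)
    | .place => (1, none, none)
    | .active s => (2, some s, none)
    | .ready s d => (3, some s, some d)
    | .follow => (4, none, none)
    | .stopped => (5, none, none)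
  refine Finite.of_injective f ?_
  intro x y h
  cases x <;> cases y <;> simp [f] at h ⊢ <;> exact h

/-- The opposite direction. -/
def Dir.opp : Dir → Dir
  | .north => .south
  | .east => .west
  | .south => .north
  | .west => .east

theorem Dir.vec_opp (d : Dir) : d.opp.vec = -d.vec := by cases d <;> rfl

namespace TwinState

variable {σ : Type}

/-- The halting states. -/
def halting : TwinState σ → Bool
  | active none => true
  | stopped => true
  | _ => false

/-- A neighbouring robot, if there is one. -/
def seen (nb : Dir → Option (TwinState σ)) : Option (Dir × TwinState σ) :=
  [Dir.north, Dir.east, Dir.south, Dir.west].findSome? fun d => (nb d).map fun x => (d, x)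

/-- The transition function. -/
def trans (tr : σ → Bool → Option σ × Bool × Option Dir) (s₀ : σ) (x : TwinState σ) (t : Bool)
    (nb : Dir → Option (TwinState σ)) : TwinState σ × Bool × Option Dir :=
  match x with
  | wait => (active (some s₀), t, none)
  | place => (follow, true, none)
  | active none => (active none, t, none)
  | active (some s) =>
    match (tr s t).2.2 with
    | none => (active (tr s t).1, (tr s t).2.1, none)
    | some d => (ready (tr s t).1 d, (tr s t).2.1, none)
  -- A robot at the target can only be the partner. Then the computation is handed over, and nobody
  -- moves.
  | ready s d => if (nb d).isSome then (follow, t, none) else (active s, t, some d)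
  | follow =>
    match seen nb with
    | some (_, active none) => (stopped, t, none)
    -- The partner is seen in direction `e` and aims at this very vertex iff `e` is opposite to `d`;
    -- both robots therefore take the same decision in the same step.
    | some (e, ready s d) => if e = d.opp then (active s, t, none) else (follow, t, some e)
    | _ => (follow, t, none)
  | stopped => (stopped, t, none)

end TwinState

/-- Two robots that simulate the single robot that runs `p`; the second one first places a tile. -/
abbrev twin (p : Prog) : Program 2 where
  State := TwinState p.State
  finiteState := haveI := p.finite_state; inferInstance
  start i := if i = 0 then .wait else .place
  halting := TwinState.halting
  trans := TwinState.trans p.trans p.start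

/-- The configuration with the robot `l` on `u` and the other one on `q`. -/
def twinConfig {σ : Type} (l : Fin 2) (T : Finset Cell) (u q : Cell) (x y : σ) : Config σ 2 :=
  ⟨T, fun i => if i = l then u else q, fun i => if i = l then x else y⟩

theorem twinConfig_swap {σ : Type} (l : Fin 2) (T : Finset Cell) (u q : Cell) (x y : σ) :
    twinConfig l T u q x y = twinConfig (1 - l) T q u y x := by
  fin_cases l <;> simp [twinConfig] <;> constructor <;> ext i <;> fin_cases i <;> rfl

/-- `TwinState.trans` changes nothing in halting states, so it also covers the first case of
`Program.action`. -/
theorem twin_action (p : Prog) (X : Config (TwinState p.State) 2) (i : Fin 2) :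
    (twin p).action X i = TwinState.trans p.trans p.start (X.state i) (decide (X.pos i ∈ X.tiles))
      fun d => X.robotAt (X.pos i + d.vec) := by
  unfold Program.action
  split_ifs with h
  · match hx : X.state i, h with
    | .active none, _ => rfl
    | .stopped, _ => rfl
    | .active (some s), h => simp [TwinState.halting] at h
    | .wait, h => simp [TwinState.halting] at h
    | .place, h => simp [TwinState.halting] at h
    | .ready _ _, h => simp [TwinState.halting] at h
    | .follow, h => simp [TwinState.halting] at h
  · rfl

theorem twin_robotAt {σ : Type} (l : Fin 2) (T : Finset Cell) (u q v : Cell) (huq : u ≠ q)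
    (x y : σ) : (twinConfig l T u q x y).robotAt v =
      if v = u then some x else if v = q then some y else none := by
  have hf : List.finRange 2 = [0, 1] := rfl
  fin_cases l <;> simp [Config.robotAt, twinConfig, hf, List.find?] <;> grind

theorem vec_ne_zero (d : Dir) : d.vec ≠ 0 := by cases d <;> simp [Dir.vec]

theorem twin_step (p : Prog) (l : Fin 2) (T : Finset Cell) {u q : Cell} (huq : u ≠ q)
    {x y x' y' : TwinState p.State} {b b' : Bool} {d e : Option Dir}
    (hx : (TwinState.trans p.trans p.start x (decide (u ∈ T))
      fun d => if u + d.vec = q then some y else none) = (x', b, d))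
    (hy : (TwinState.trans p.trans p.start y (decide (q ∈ T))
      fun d => if q + d.vec = u then some x else none) = (y', b', e)) :
    (twin p).step (twinConfig l T u q x y) =
      twinConfig l (fupd (fupd T u b) q b') (move u d) (move q e) x' y' := by
  have hl : (twin p).action (twinConfig l T u q x y) l = (x', b, d) := by
    rw [twin_action, ← hx]
    simp only [twin_robotAt _ _ _ _ _ huq]
    simp [twinConfig, vec_ne_zero]
  have hf : (twin p).action (twinConfig l T u q x y) (1 - l) = (y', b', e) := by
    have : 1 - l ≠ l := by fin_cases l <;> decide
    rw [twin_action, ← hy]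
    simp only [twin_robotAt _ _ _ _ _ huq]
    simp [twinConfig, vec_ne_zero, this]
  fin_cases l
  · simp only [Fin.zero_eta, sub_zero] at hl hf
    simp only [Program.step, twinConfig, Config.robots] at hl hf ⊢
    congr 1
    · ext v
      cases b <;> cases b' <;> simp [fupd, Fin.exists_fin_two] <;> grind
    · ext i : 1
      fin_cases i <;> simp [hl, hf]
    · ext i : 1
      fin_cases i <;> simp [hl, hf]
  · simp only [Fin.mk_one, sub_self] at hl hf
    simp only [Program.step, twinConfig, Config.robots] at hl hf ⊢
    congr 1
    · ext v
      cases b <;> cases b' <;> simp [fupd, Fin.exists_fin_two] <;> grind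
    · ext i : 1
      fin_cases i <;> simp [hl, hf]
    · ext i : 1
      fin_cases i <;> simp [hl, hf]

theorem twin_seen {σ : Type} (u q : Cell) (x : TwinState σ) (e : Dir) (h : q + e.vec = u) :
    TwinState.seen (fun d => if q + d.vec = u then some x else none) = some (e, x) := by
  subst h
  cases e <;> simp [TwinState.seen, Dir.vec, List.findSome?]

theorem connected_twin {σ : Type} {l : Fin 2} {T : Finset Cell} {u q : Cell} {x y : σ}
    (hc : Conn (T : Set Cell)) (ha : Att (T : Set Cell) u) (hq : gridGraph.Adj q u) :
    (twinConfig l T u q x y).Connected := by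
  rw [Config.Connected, ← conn_coe_iff]
  have : (T ∪ Config.robots (twinConfig l T u q x y) : Finset Cell) = insert q (insert u T) := by
    ext v; fin_cases l <;> simp [Config.robots, twinConfig, Fin.exists_fin_two] <;> grind
  rw [show (twinConfig l T u q x y).tiles = T from rfl, this, Finset.coe_insert, Finset.coe_insert]
  exact (hc.insert ha).insert (.inr ⟨u, Set.mem_insert _ _, hq⟩)

theorem twin_injective {σ : Type} {l : Fin 2} {T : Finset Cell} {u q : Cell} {x y : σ}
    (hq : u ≠ q) : Function.Injective (twinConfig l T u q x y).pos := by
  intro i j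
  fin_cases l <;> fin_cases i <;> fin_cases j <;> simp [twinConfig, hq, hq.symm]

theorem twin_no_swap {σ : Type} {l : Fin 2} {T T' : Finset Cell} {u q u' q' : Cell}
    {x y x' y' : σ} (h : ¬(u' = q ∧ q' = u)) (i j : Fin 2) (hij : i ≠ j) :
    ¬((twinConfig l T' u' q' x' y').pos i = (twinConfig l T u q x y).pos j ∧
      (twinConfig l T' u' q' x' y').pos j = (twinConfig l T u q x y).pos i) := by
  fin_cases l <;> fin_cases i <;> fin_cases j <;> simp [twinConfig] at hij h ⊢ <;> grind

theorem fupd_self {T : Finset Cell} {u : Cell} : fupd T u (decide (u ∈ T)) = T := by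
  by_cases h : u ∈ T <;> simp [fupd, h]

theorem mem_fupd_of_ne {T : Finset Cell} {u q : Cell} (h : u ≠ q) (b : Bool) :
    q ∈ fupd T u b ↔ q ∈ T := by
  cases b <;> simp [fupd, h.symm]

-- The write takes one step and the announced move another; between them the robot still stands on
-- `u`, which is why `OneStep` also demands that `u` is attached after the write. If the target is
-- free, the follower steps onto the vertex that is being left, so there is neither a collision nor
-- an exchange. If the target is the follower's vertex, only the roles change, and `l'` names the
-- other robot. The statement is a continuation because `Reaches` is built up from the halting end.
open TwinState in
theorem twin_oneStep (p : Prog) {goal T : Finset Cell} {u q u' : Cell} {s : p.State}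
    {o : Option p.State} {S' : Set Cell} (l : Fin 2) (hc : Conn (T : Set Cell))
    (ha : Att (T : Set Cell) u) (hq : gridGraph.Adj q u)
    (h : OneStep p.trans s (T : Set Cell) u o S' u') :
    ∃ (T' : Finset Cell) (l' : Fin 2) (q' : Cell), (T' : Set Cell) = S' ∧ gridGraph.Adj q' u' ∧
      ∀ n, Reaches (twin p) goal n (twinConfig l' T' u' q' (active o) follow) →
        ∃ m ≤ n + 2, Reaches (twin p) goal m (twinConfig l T u q (active (some s)) follow) := by
  obtain ⟨t, ht, rfl, rfl, rfl, hc', ha', ha''⟩ := h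
  obtain rfl : t = decide (u ∈ T) := by
    rw [Bool.eq_iff_iff, ht]; simp
  generalize hr : p.trans s (decide (u ∈ T)) = r at hc' ha' ha'' ⊢
  obtain ⟨o, b, dir⟩ := r
  have huq : u ≠ q := hq.ne'
  obtain ⟨e, he⟩ := exists_dir_of_adj hq
  refine ⟨fupd T u b, ?_⟩
  have hq' : decide (q ∈ fupd T u b) = decide (q ∈ T) := by
    rw [decide_eq_decide]; exact mem_fupd_of_ne huq b
  simp only [← coe_fupd] at hc' ha' ha'' ⊢
  cases dir with
  | none =>
    refine ⟨l, q, trivial, hq, fun n hn => ⟨n + 1, by omega, ?_⟩⟩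
    have hstep : (twin p).step (twinConfig l T u q (active (some s)) follow) =
        twinConfig l (fupd T u b) u q (active o) follow := by
      have := twin_step p l T huq (x := active (some s)) (y := follow) (x' := active o)
        (y' := follow) (b := b) (b' := decide (q ∈ T)) (d := none) (e := none)
        (by simp [TwinState.trans, hr]) (by rw [TwinState.trans, twin_seen u q _ e he.symm])
      rw [this, ← hq', fupd_self]; rfl
    refine .step (connected_twin hc ha hq) (twin_injective huq) ?_ (hstep ▸ hn)
    rw [hstep]
    exact twin_no_swap (fun h => huq h.1)
  | some d =>
    have hstep : (twin p).step (twinConfig l T u q (active (some s)) follow) =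
        twinConfig l (fupd T u b) u q (ready o d) follow := by
      have := twin_step p l T huq (x := active (some s)) (y := follow) (x' := ready o d)
        (y' := follow) (b := b) (b' := decide (q ∈ T)) (d := none) (e := none)
        (by simp [TwinState.trans, hr]) (by rw [TwinState.trans, twin_seen u q _ e he.symm])
      rw [this, ← hq', fupd_self]; rfl
    by_cases hqd : u + d.vec = q
    · have hed : e = d.opp := by
        have : e.vec = d.opp.vec := by
          rw [Dir.vec_opp, eq_neg_iff_add_eq_zero]
          have h2 : q = q + e.vec + d.vec := by rw [← he, hqd]
          rw [add_assoc] at h2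
          exact (left_eq_add.1 h2)
        cases e <;> cases d <;> simp_all [Dir.vec, Dir.opp]
      have hstep' : (twin p).step (twinConfig l (fupd T u b) u q (ready o d) follow) =
          twinConfig l (fupd T u b) u q follow (active o) := by
        have := twin_step p l (fupd T u b) huq (x := ready o d) (y := follow) (x' := follow)
          (y' := active o) (b := decide (u ∈ fupd T u b)) (b' := decide (q ∈ fupd T u b))
          (d := none) (e := none)
          (by simp [TwinState.trans, hqd])
          (by rw [TwinState.trans, twin_seen u q _ e he.symm]; simp [hed])
        rw [this, fupd_self, fupd_self]; rfl
      refine ⟨1 - l, u, trivial, adj_dir u d, fun n hn => ⟨n + 1 + 1, by omega, ?_⟩⟩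
      rw [show move u (some d) = q from hqd, ← twinConfig_swap] at hn
      refine .step (connected_twin hc ha hq) (twin_injective huq) ?_ (hstep ▸ .step
        (connected_twin hc' ha' hq) (twin_injective huq) ?_ (hstep' ▸ hn))
      · rw [hstep]
        exact twin_no_swap (fun h => huq h.1)
      · rw [hstep']
        exact twin_no_swap (fun h => huq h.1)
    · have hed : e ≠ d.opp := by
        rintro rfl
        apply hqd
        rw [he, Dir.vec_opp]; abel
      have hstep' : (twin p).step (twinConfig l (fupd T u b) u q (ready o d) follow) =
          twinConfig l (fupd T u b) (u + d.vec) u (active o) follow := by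
        have := twin_step p l (fupd T u b) huq (x := ready o d) (y := follow) (x' := active o)
          (y' := follow) (b := decide (u ∈ fupd T u b)) (b' := decide (q ∈ fupd T u b))
          (d := some d) (e := some e)
          (by simp [TwinState.trans, hqd])
          (by rw [TwinState.trans, twin_seen u q _ e he.symm]; simp [hed])
        rw [this, fupd_self, fupd_self]
        simp only [move, ← he]
      refine ⟨l, u, trivial, adj_dir u d, fun n hn => ⟨n + 1 + 1, by omega, ?_⟩⟩
      refine .step (connected_twin hc ha hq) (twin_injective huq) ?_ (hstep ▸ .step
        (connected_twin hc' ha' hq) (twin_injective huq) ?_ (hstep' ▸ hn))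
      · rw [hstep]
        exact twin_no_swap (fun h => huq h.1)
      · rw [hstep']
        exact twin_no_swap (fun h => hqd h.1)

-- The follower sees only afterwards that the active robot has stopped; this is the extra step in
-- `twin_reaches`.
open TwinState in
theorem twin_halt (p : Prog) {T : Finset Cell} {u q : Cell} (l : Fin 2)
    (hc : Conn (T : Set Cell)) (ha : Att (T : Set Cell) u) (hq : gridGraph.Adj q u) :
    Reaches (twin p) T 1 (twinConfig l T u q (active none) follow) := by
  have huq : u ≠ q := hq.ne'
  obtain ⟨e, he⟩ := exists_dir_of_adj hq
  have hstep : (twin p).step (twinConfig l T u q (active none) follow) =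
      twinConfig l T u q (active none) stopped := by
    have := twin_step p l T huq (x := active none) (y := follow) (x' := active none)
      (y' := stopped) (b := decide (u ∈ T)) (b' := decide (q ∈ T)) (d := none) (e := none)
      (by simp [TwinState.trans]) (by rw [TwinState.trans, twin_seen u q _ e he.symm])
    rw [this, fupd_self, fupd_self]; rfl
  refine .step (connected_twin hc ha hq) (twin_injective huq) ?_ ?_
  · rw [hstep]
    exact twin_no_swap (fun h => huq h.1)
  · rw [hstep]
    refine .halt (fun i => ?_) rfl (connected_twin hc ha hq) (twin_injective huq)
    fin_cases l <;> fin_cases i <;> rfl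

open TwinState in
theorem twin_reaches {p : Prog} {m : ℕ} {s : p.State} {T goal : Finset Cell} {l : Fin 2}
    {S' : Set Cell} {u u' q : Cell} (hc : Conn (T : Set Cell)) (ha : Att (T : Set Cell) u)
    (hq : gridGraph.Adj q u) (h : Steps p.trans m s (T : Set Cell) u none S' u') (hS : S' = goal) :
    ∃ n ≤ 2 * m + 1, Reaches (twin p) goal n (twinConfig l T u q (active (some s)) follow) := by
  generalize hST : (T : Set Cell) = S at h hc ha
  generalize ho : (none : Option p.State) = o at h
  induction h generalizing T l q with
  | one h =>
    subst ho hST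
    obtain ⟨T', l', q', rfl, hq', hn⟩ := twin_oneStep p (goal := goal) l hc ha hq h
    obtain ⟨_, _, _, _, _, hc', _, ha'⟩ := h
    obtain rfl := Finset.coe_injective hS
    obtain ⟨m, hm, hr⟩ := hn 1 (twin_halt p l' hc' ha' hq')
    exact ⟨m, by omega, hr⟩
  | cons h _ ih =>
    subst ho hST
    obtain ⟨T', l', q', rfl, hq', hn⟩ := twin_oneStep p (goal := goal) l hc ha hq h
    obtain ⟨_, _, _, _, _, hc', _, ha'⟩ := h
    obtain ⟨n, hn', hr⟩ := ih (l := l') hq' hS rfl hc' ha' rfl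
    obtain ⟨m, hm, hr⟩ := hn n hr
    exact ⟨m, by omega, hr⟩

/-- A terminating run of a structured program is performed by a single robot. -/
theorem Exec.single_performs {p : Prog} {T goal : Finset Cell} {u u' : Cell} {n : ℕ}
    (h : Exec p T u goal u' n) (hc : Conn (T : Set Cell)) (ha : Att (T : Set Cell) u) :
    (single p).Performs T ![u] goal n := by
  obtain ⟨m, hm, hs⟩ := h hc ha
  have hr := single_reaches hc ha hs rfl
  have : (single p).initial T ![u] = ⟨T, fun _ => u, fun _ => some p.start⟩ := by
    rw [Program.initial]
    congr 1
    ext i : 1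
    fin_cases i; rfl
  exact (this ▸ hr).performs (by exact_mod_cast hm)

open TwinState in
/-- A terminating run of a structured program is performed by two robots, where the second robot
may stand in for a tile. -/
theorem Exec.twin_performs {p : Prog} {T S goal : Finset Cell} {u q u' : Cell} {n : ℕ}
    (h : Exec p T u goal u' n) (hc : Conn (T : Set Cell)) (ha : Att (T : Set Cell) u)
    (hq : gridGraph.Adj q u) (hS : insert q S = T) :
    (twin p).Performs S ![u, q] goal (2 * n + 2) := by
  obtain ⟨m, hm, hs⟩ := h hc ha
  have huq : u ≠ q := hq.ne'
  obtain ⟨k, hk, hr⟩ := twin_reaches (l := 0) hc ha hq hs rfl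
  have h0 : (twin p).initial S ![u, q] = twinConfig 0 S u q wait place := by
    rw [Program.initial, twinConfig]
    congr 1
    ext i : 1
    fin_cases i <;> rfl
  -- The second robot spends the first step on placing the joining tile, and the first one waits.
  -- From here on the tiles are those of the one-robot case.
  have hstep : (twin p).step (twinConfig 0 S u q wait place) =
      twinConfig 0 T u q (active (some p.start)) follow := by
    have := twin_step p 0 S huq (x := wait) (y := place) (x' := active (some p.start))
      (y' := follow) (b := decide (u ∈ S)) (b' := true) (d := none) (e := none) rfl rfl
    rw [this, fupd_self, ← hS]; rfl
  -- Before that, the robot on `q` stands in for the tile, as connectivity counts robots and tiles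
  -- alike.
  have hcon : (twinConfig 0 S u q (wait : TwinState p.State) place).Connected := by
    have := connected_twin (l := 0) (x := (wait : TwinState p.State)) (y := place) hc ha hq
    rw [Config.Connected] at this ⊢
    have he : S ∪ (twinConfig 0 S u q (wait : TwinState p.State) place).robots =
        T ∪ (twinConfig 0 T u q (wait : TwinState p.State) place).robots := by
      subst hS
      ext v
      simp [Config.robots, twinConfig, Fin.exists_fin_two]
    exact he ▸ this
  have : Reaches (twin p) goal (k + 1) ((twin p).initial S ![u, q]) := by
    rw [h0]
    refine .step hcon (twin_injective huq) ?_ (hstep ▸ hr)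
    rw [hstep]
    exact twin_no_swap (fun h => huq h.1)
  exact this.performs (by omega)

/-! ### Elementary programs -/

/-- Move without changing the tiles. -/
abbrev go (d : Dir) : Prog := .act none (some d)

/-- Place a tile (unless there is one) and move. -/
abbrev put (d : Dir) : Prog := .act (some true) (some d)

/-- Remove the tile and move. -/
abbrev del (d : Dir) : Prog := .act (some false) (some d)

/-- Sequential composition. -/
infixr:65 " ;; " => Prog.seq

/-- `n`-fold repetition. -/
def rep : ℕ → Prog → Prog
  | 0, _ => .act none none
  | n + 1, p => p ;; rep n p

theorem adj_pair {x y x' y' : ℤ} : gridGraph.Adj (x, y) (x', y') ↔ |x - x'| + |y - y'| = 1 :=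
  Iff.rfl

theorem Link.hor {S : Set Cell} {x x' y : ℤ} (hx : x ≤ x')
    (h : ∀ z, x ≤ z → z ≤ x' → (z, y) ∈ S) : Link S (x, y) (x', y) := by
  obtain ⟨n, rfl⟩ : ∃ n : ℕ, x' = x + n := ⟨(x' - x).toNat, by omega⟩
  induction n with
  | zero => simpa using Link.refl _
  | succ n ih =>
    refine (ih (by omega) fun z h₁ h₂ => h z h₁ (by omega)).trans (Link.single ?_ ?_ ?_)
    · rw [adj_pair]; push_cast; simp
    · exact h _ (by omega) (by omega)
    · exact h _ (by omega) (by omega)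

theorem Link.ver {S : Set Cell} {x y y' : ℤ} (hy : y ≤ y')
    (h : ∀ z, y ≤ z → z ≤ y' → (x, z) ∈ S) : Link S (x, y) (x, y') := by
  obtain ⟨n, rfl⟩ : ∃ n : ℕ, y' = y + n := ⟨(y' - y).toNat, by omega⟩
  induction n with
  | zero => simpa using Link.refl _
  | succ n ih =>
    refine (ih (by omega) fun z h₁ h₂ => h z h₁ (by omega)).trans (Link.single ?_ ?_ ?_)
    · rw [adj_pair]; push_cast; simp
    · exact h _ (by omega) (by omega)
    · exact h _ (by omega) (by omega)

theorem Att.north {S : Set Cell} {x y : ℤ} (h : (x, y + 1) ∈ S) : Att S (x, y) :=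
  .inr ⟨_, h, by rw [adj_pair]; simp⟩

theorem Att.south {S : Set Cell} {x y : ℤ} (h : (x, y - 1) ∈ S) : Att S (x, y) :=
  .inr ⟨_, h, by rw [adj_pair]; simp⟩

theorem Att.west {S : Set Cell} {x y : ℤ} (h : (x - 1, y) ∈ S) : Att S (x, y) :=
  .inr ⟨_, h, by rw [adj_pair]; simp⟩

theorem att_move {S : Set Cell} {u : Cell} (hu : u ∈ S) (d : Dir) : Att S (u + d.vec) :=
  .inr ⟨u, hu, (adj_dir u d).symm⟩

theorem pair_add_vec {x y x' y' : ℤ} {d : Dir} (hx : x' = x + d.vec.1) (hy : y' = y + d.vec.2) :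
    ((x', y') : Cell) = (x, y) + d.vec := by
  subst hx hy; rfl

/-! ### Rules for moves, placements, removals and straight walks -/

namespace Exec

variable {p q : Prog} {S S' : Set Cell} {u u' : Cell} {x y x' y' : ℤ} {n : ℤ}

theorem skip : Exec (.act none none) S u S u 1 := by
  classical
  have := Exec.act (wr := none) (d := none) (S := S) (u := u) (decide (u ∈ S)) (by simp) (by
    intro hc ha
    rw [Option.getD_none, upd_self (by simp)]
    exact ⟨hc, ha, ha⟩)
  rwa [Option.getD_none, upd_self (by simp)] at this

/-- Moving is safe if the new vertex is attached to the tiles. -/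
theorem go_att (d : Dir) (hx : x' = x + d.vec.1) (hy : y' = y + d.vec.2) (h : Att S (x', y')) :
    Exec (go d) S (x, y) S (x', y') 1 := by
  classical
  have := Exec.act (wr := none) (d := some d) (S := S) (u := (x, y)) (decide ((x, y) ∈ S))
    (by simp) (by
    intro hc ha
    rw [Option.getD_none, upd_self (by simp), move, ← pair_add_vec hx hy]
    exact ⟨hc, ha, h⟩)
  rwa [Option.getD_none, upd_self (by simp), move, ← pair_add_vec hx hy] at this

/-- Moving from a tile. -/
theorem go_tile (d : Dir) (hx : x' = x + d.vec.1) (hy : y' = y + d.vec.2) (h : (x, y) ∈ S) :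
    Exec (go d) S (x, y) S (x', y') 1 :=
  go_att d hx hy (pair_add_vec hx hy ▸ att_move h d)

theorem put_insert (d : Dir) (hx : x' = x + d.vec.1) (hy : y' = y + d.vec.2) :
    Exec (put d) S (x, y) (insert (x, y) S) (x', y') 1 := by
  classical
  rw [pair_add_vec hx hy]
  refine Exec.act (wr := some true) (d := some d) (decide ((x, y) ∈ S)) (by simp) ?_
  intro hc ha
  exact ⟨hc.insert ha, .inl (Set.mem_insert _ _), att_move (Set.mem_insert _ _) d⟩

theorem put_eq (d : Dir) (hx : x' = x + d.vec.1) (hy : y' = y + d.vec.2)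
    (h : insert (x, y) S = S') : Exec (put d) S (x, y) S' (x', y') 1 :=
  h ▸ put_insert d hx hy

theorem del_tile (d : Dir) (hx : x' = x + d.vec.1) (hy : y' = y + d.vec.2)
    (hc : Conn S → Conn (S \ {(x, y)})) (h : (x', y') ∈ S) :
    Exec (del d) S (x, y) (S \ {(x, y)}) (x', y') 1 := by
  classical
  have hne : (x', y') ≠ (x, y) := by
    rw [pair_add_vec hx hy]; intro h
    exact vec_ne_zero d (by simpa using h)
  have hm : (x', y') ∈ S \ {(x, y)} := ⟨h, hne⟩
  rw [pair_add_vec hx hy] at hm ⊢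
  refine Exec.act (wr := some false) (d := some d) (decide ((x, y) ∈ S)) (by simp) ?_
  intro hc' ha
  exact ⟨hc hc', .inr ⟨_, hm, adj_dir _ d⟩, .inl hm⟩

theorem del_eq (d : Dir) (hx : x' = x + d.vec.1) (hy : y' = y + d.vec.2)
    (hc : Conn S → Conn (S \ {(x, y)})) (h : (x', y') ∈ S) (hS : S \ {(x, y)} = S') :
    Exec (del d) S (x, y) S' (x', y') 1 := hS ▸ del_tile d hx hy hc h

theorem del_stay (hc : Conn S → Conn (S \ {u})) (h : Att (S \ {u}) u) :
    Exec (.act (some false) none) S u (S \ {u}) u 1 := by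
  classical
  exact Exec.act (wr := some false) (d := none) (decide (u ∈ S)) (by simp)
    fun hc' _ => ⟨hc hc', h, h⟩

theorem walk_tiles (d : Dir) (n : ℕ) (h : ∀ k : ℕ, k < n → (x + k * d.vec.1, y + k * d.vec.2) ∈ S)
    (h' : (x + n * d.vec.1, y + n * d.vec.2) ∉ S) :
    Exec (.whl true (go d)) S (x, y) S (x + n * d.vec.1, y + n * d.vec.2) (2 * n + 1) := by
  induction n generalizing x y with
  | zero =>
    simp only [Nat.cast_zero, zero_mul, add_zero] at h' ⊢
    exact (whl_done (by simp [h'])).mono (by simp)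
  | succ n ih =>
    have h0 : (x, y) ∈ S := by simpa using h 0 (by omega)
    have e : ∀ (k : ℕ) (z v : ℤ), z + ((k + 1 : ℕ) : ℤ) * v = z + v + k * v := by
      intros; push_cast; ring
    rw [e, e] at h' ⊢
    refine (whl_step (by simp [h0]) (go_tile d rfl rfl h0) (ih (fun k hk => ?_) h')).mono ?_
    · have := h (k + 1) (by omega)
      rwa [e, e] at this
    · push_cast; linarith

/-- On empty vertices the robot must stay in touch with tiles beside its path. This is asked for
inner vertices only: the first one is covered by the premise of `Exec`, and the last one is a tile.
-/
theorem walk_empty (d : Dir) (n : ℕ) (h : ∀ k : ℕ, k < n → (x + k * d.vec.1, y + k * d.vec.2) ∉ S)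
    (ha : ∀ k : ℕ, k < n → 0 < k → Att S (x + k * d.vec.1, y + k * d.vec.2))
    (h' : (x + n * d.vec.1, y + n * d.vec.2) ∈ S) :
    Exec (.whl false (go d)) S (x, y) S (x + n * d.vec.1, y + n * d.vec.2) (2 * n + 1) := by
  induction n generalizing x y with
  | zero =>
    simp only [Nat.cast_zero, zero_mul, add_zero] at h' ⊢
    exact (whl_done (by simp [h'])).mono (by simp)
  | succ n ih =>
    have h0 : (x, y) ∉ S := by simpa using h 0 (by omega)
    have e : ∀ (k : ℕ) (z v : ℤ), z + ((k + 1 : ℕ) : ℤ) * v = z + v + k * v := by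
      intros; push_cast; ring
    rw [e, e] at h' ⊢
    refine (whl_step (by simp [h0]) (go_att d rfl rfl ?_) (ih (fun k hk => ?_)
      (fun k hk _ => ?_) h')).mono ?_
    · rcases Nat.eq_zero_or_pos n with rfl | hn
      · left; simpa using h'
      · simpa using ha 1 (by omega) (by omega)
    · have := h (k + 1) (by omega)
      rwa [e, e] at this
    · have := ha (k + 1) (by omega) (by omega)
      rwa [e, e] at this
    · push_cast; linarith

theorem tiles_east (hx : x ≤ x') (h : ∀ z, x ≤ z → z < x' → (z, y) ∈ S) (h' : (x', y) ∉ S) :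
    Exec (.whl true (go .east)) S (x, y) S (x', y) (2 * (x' - x) + 1) := by
  obtain ⟨n, rfl⟩ : ∃ n : ℕ, x' = x + n := ⟨(x' - x).toNat, by omega⟩
  have := walk_tiles (S := S) (x := x) (y := y) .east n
    (fun k hk => by simpa [Dir.vec] using h (x + k) (by omega) (by omega))
    (by simpa [Dir.vec] using h')
  simpa [Dir.vec] using this

theorem tiles_west (hx : x' ≤ x) (h : ∀ z, x' < z → z ≤ x → (z, y) ∈ S) (h' : (x', y) ∉ S) :
    Exec (.whl true (go .west)) S (x, y) S (x', y) (2 * (x - x') + 1) := by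
  obtain ⟨n, rfl⟩ : ∃ n : ℕ, x = x' + n := ⟨(x - x').toNat, by omega⟩
  have := walk_tiles (S := S) (x := x' + n) (y := y) .west n
    (fun k hk => by simpa [Dir.vec, sub_eq_add_neg] using h (x' + n - k) (by omega) (by omega))
    (by simpa [Dir.vec] using h')
  simpa [Dir.vec] using this

theorem tiles_north (hy : y ≤ y') (h : ∀ z, y ≤ z → z < y' → (x, z) ∈ S) (h' : (x, y') ∉ S) :
    Exec (.whl true (go .north)) S (x, y) S (x, y') (2 * (y' - y) + 1) := by
  obtain ⟨n, rfl⟩ : ∃ n : ℕ, y' = y + n := ⟨(y' - y).toNat, by omega⟩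
  have := walk_tiles (S := S) (x := x) (y := y) .north n
    (fun k hk => by simpa [Dir.vec] using h (y + k) (by omega) (by omega))
    (by simpa [Dir.vec] using h')
  simpa [Dir.vec] using this

theorem tiles_south (hy : y' ≤ y) (h : ∀ z, y' < z → z ≤ y → (x, z) ∈ S) (h' : (x, y') ∉ S) :
    Exec (.whl true (go .south)) S (x, y) S (x, y') (2 * (y - y') + 1) := by
  obtain ⟨n, rfl⟩ : ∃ n : ℕ, y = y' + n := ⟨(y - y').toNat, by omega⟩
  have := walk_tiles (S := S) (x := x) (y := y' + n) .south n
    (fun k hk => by simpa [Dir.vec, sub_eq_add_neg] using h (y' + n - k) (by omega) (by omega))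
    (by simpa [Dir.vec] using h')
  simpa [Dir.vec] using this

theorem empty_east (hx : x ≤ x') (h : ∀ z, x ≤ z → z < x' → (z, y) ∉ S)
    (ha : ∀ z, x < z → z < x' → Att S (z, y)) (h' : (x', y) ∈ S) :
    Exec (.whl false (go .east)) S (x, y) S (x', y) (2 * (x' - x) + 1) := by
  obtain ⟨n, rfl⟩ : ∃ n : ℕ, x' = x + n := ⟨(x' - x).toNat, by omega⟩
  have := walk_empty (S := S) (x := x) (y := y) .east n
    (fun k hk => by simpa [Dir.vec] using h (x + k) (by omega) (by omega))
    (fun k hk hk' => by simpa [Dir.vec] using ha (x + k) (by omega) (by omega))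
    (by simpa [Dir.vec] using h')
  simpa [Dir.vec] using this

theorem empty_west (hx : x' ≤ x) (h : ∀ z, x' < z → z ≤ x → (z, y) ∉ S)
    (ha : ∀ z, x' < z → z < x → Att S (z, y)) (h' : (x', y) ∈ S) :
    Exec (.whl false (go .west)) S (x, y) S (x', y) (2 * (x - x') + 1) := by
  obtain ⟨n, rfl⟩ : ∃ n : ℕ, x = x' + n := ⟨(x - x').toNat, by omega⟩
  have := walk_empty (S := S) (x := x' + n) (y := y) .west n
    (fun k hk => by simpa [Dir.vec, sub_eq_add_neg] using h (x' + n - k) (by omega) (by omega))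
    (fun k hk hk' => by simpa [Dir.vec, sub_eq_add_neg] using ha (x' + n - k) (by omega) (by omega))
    (by simpa [Dir.vec] using h')
  simpa [Dir.vec] using this

theorem empty_north (hy : y ≤ y') (h : ∀ z, y ≤ z → z < y' → (x, z) ∉ S)
    (ha : ∀ z, y < z → z < y' → Att S (x, z)) (h' : (x, y') ∈ S) :
    Exec (.whl false (go .north)) S (x, y) S (x, y') (2 * (y' - y) + 1) := by
  obtain ⟨n, rfl⟩ : ∃ n : ℕ, y' = y + n := ⟨(y' - y).toNat, by omega⟩
  have := walk_empty (S := S) (x := x) (y := y) .north n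
    (fun k hk => by simpa [Dir.vec] using h (y + k) (by omega) (by omega))
    (fun k hk hk' => by simpa [Dir.vec] using ha (y + k) (by omega) (by omega))
    (by simpa [Dir.vec] using h')
  simpa [Dir.vec] using this

theorem congr {S₁ S₂ : Set Cell} {u₁ u₂ : Cell} {m : ℤ} (h : Exec p S u S₁ u₁ m)
    (hS : S₁ = S₂) (hu : u₁ = u₂) (hm : m ≤ n) : Exec p S u S₂ u₂ n := by
  subst hS hu
  exact h.mono hm

theorem rep_put (d : Dir) (n : ℕ) : Exec (rep n (put d)) S (x, y)
    (S ∪ {q | ∃ k : ℕ, k < n ∧ q = (x + k * d.vec.1, y + k * d.vec.2)})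
    (x + n * d.vec.1, y + n * d.vec.2) (n + 1) := by
  induction n generalizing S x y with
  | zero => exact skip.congr (by simp) (by simp) (by simp)
  | succ n ih =>
    have e : ∀ (k : ℕ) (z v : ℤ), z + ((k + 1 : ℕ) : ℤ) * v = z + v + k * v := by
      intros; push_cast; ring
    refine ((put_insert d rfl rfl).seq ih).congr ?_ (by rw [e, e]) (by push_cast; omega)
    ext q
    simp only [Set.mem_union, Set.mem_insert_iff, Set.mem_ofPred_eq]
    constructor
    · rintro ((rfl | h) | ⟨k, hk, rfl⟩)
      · exact .inr ⟨0, by omega, by simp⟩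
      · exact .inl h
      · exact .inr ⟨k + 1, by omega, by rw [e, e]⟩
    · rintro (h | ⟨_ | k, hk, rfl⟩)
      · exact .inl (.inr h)
      · exact .inl (.inl (by simp))
      · exact .inr ⟨k, by omega, by rw [e, e]⟩

theorem rep_put_north (n : ℕ) (hS : S ∪ {q | q.1 = x ∧ y ≤ q.2 ∧ q.2 < y + n} = S')
    (hy : y' = y + n) : Exec (rep n (put .north)) S (x, y) S' (x, y') (n + 1) := by
  subst hS hy
  refine (rep_put .north n).congr ?_ (by simp [Dir.vec]) le_rfl
  congr 1
  ext ⟨z, v⟩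
  simp only [Dir.vec, Set.mem_ofPred_eq, Prod.mk.injEq]
  exact ⟨fun ⟨k, h⟩ => by omega, fun h => ⟨(v - y).toNat, by omega⟩⟩

theorem rep_put_south (n : ℕ) (hS : S ∪ {q | q.1 = x ∧ y - n < q.2 ∧ q.2 ≤ y} = S')
    (hy : y' = y - n) : Exec (rep n (put .south)) S (x, y) S' (x, y') (n + 1) := by
  subst hS hy
  refine (rep_put .south n).congr ?_ (by simp [Dir.vec]; ring) le_rfl
  congr 1
  ext ⟨z, v⟩
  simp only [Dir.vec, Set.mem_ofPred_eq, Prod.mk.injEq]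
  exact ⟨fun ⟨k, h⟩ => by omega, fun h => ⟨(y - v).toNat, by omega⟩⟩

theorem rep_put_west (n : ℕ) (hS : S ∪ {q | q.2 = y ∧ x - n < q.1 ∧ q.1 ≤ x} = S')
    (hx : x' = x - n) : Exec (rep n (put .west)) S (x, y) S' (x', y) (n + 1) := by
  subst hS hx
  refine (rep_put .west n).congr ?_ (by simp [Dir.vec]; ring) le_rfl
  congr 1
  ext ⟨z, v⟩
  simp only [Dir.vec, Set.mem_ofPred_eq, Prod.mk.injEq]
  exact ⟨fun ⟨k, h⟩ => by omega, fun h => ⟨(x - z).toNat, by omega⟩⟩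

end Exec

/-- Remove all but the last one of a row of tiles in direction `d`. -/
def eat (d : Dir) : Prog := go d ;; .whl true (go d.opp ;; del d ;; go d)

/-- Induction rule for `eat`; `S k` are the tiles after `k` removals. -/
theorem Exec.eat {x y x' y' : ℤ} (d : Dir) (n : ℕ) (S : ℕ → Set Cell)
    (hS : ∀ k < n, S (k + 1) = S k \ {(x + k * d.vec.1, y + k * d.vec.2)})
    (h0 : (x + n * d.vec.1, y + n * d.vec.2) ∈ S n)
    (h1 : (x + (n + 1) * d.vec.1, y + (n + 1) * d.vec.2) ∉ S n)
    (h : ∀ k < n, (x + k * d.vec.1, y + k * d.vec.2) ∈ S k ∧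
      (x + (k + 1) * d.vec.1, y + (k + 1) * d.vec.2) ∈ S k ∧ (Conn (S k) → Conn (S (k + 1))))
    (hx : x' = x + (n + 1) * d.vec.1) (hy : y' = y + (n + 1) * d.vec.2) :
    Exec (eat d) (S 0) (x, y) (S n) (x', y') (4 * n + 2) := by
  have hopp : ∀ z v : ℤ, (z, v) = ((z + d.vec.1, v + d.vec.2) : Cell) + d.opp.vec := by
    intro z v; rw [Dir.vec_opp]; ext <;> simp
  -- After `k` removals the robot stands one vertex ahead of the foremost tile of the row. It goes
  -- back to delete that tile only if it sees a tile where it stands, so the last tile survives.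
  have key : ∀ m k : ℕ, k + m = n →
      Exec (.whl true (go d.opp ;; del d ;; go d)) (S k)
        (x + (k + 1) * d.vec.1, y + (k + 1) * d.vec.2) (S n) (x', y') (4 * m + 1) := by
    intro m
    induction m with
    | zero =>
      intro k hk
      obtain rfl : k = n := by omega
      subst hx hy
      exact (whl_done (by simp [h1])).mono (by simp)
    | succ m ih =>
      intro k hk
      obtain ⟨h₁, h₂, h₃⟩ := h k (by omega)
      have e : ∀ (z v : ℤ), z + ((k : ℤ) + 1) * v = z + k * v + v := by
        intros; ring
      have e' : ∀ (z v : ℤ), z + (((k + 1 : ℕ) : ℤ) + 1) * v = z + k * v + v + v := by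
        intros; push_cast; ring
      have hne : ((x + k * d.vec.1 + d.vec.1, y + k * d.vec.2 + d.vec.2) : Cell) ≠
          (x + k * d.vec.1, y + k * d.vec.2) := by
        rw [pair_add_vec (d := d) rfl rfl]
        intro h; exact vec_ne_zero d (by simpa using h)
      have ih' := ih (k + 1) (by omega)
      rw [hS k (by omega)] at ih' h₃
      rw [e, e] at h₂ ⊢
      rw [e', e'] at ih'
      refine (whl_step (by simp [h₂]) ((go_tile d.opp ?_ ?_ h₂).seq ((del_tile d rfl rfl h₃ h₂).seq
        (go_tile d rfl rfl ⟨h₂, hne⟩))) ih').mono (by push_cast; linarith)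
      · rw [Dir.vec_opp]; simp
      · rw [Dir.vec_opp]; simp
  have k0 := key n 0 (by omega)
  simp only [Nat.cast_zero, zero_add, one_mul] at k0
  refine ((go_tile d rfl rfl ?_).seq k0).mono (by linarith)
  rcases Nat.eq_zero_or_pos n with rfl | hn
  · simpa using h0
  · simpa using (h 0 hn).1

/-! ### The copy under construction -/

/-- The column where the blocks for the column `x` of the polyomino begin. -/
def colX (a w c x : ℤ) : ℤ := a - 2 - c * (a + w - x)

/-- The row where the blocks for the row `y` of the polyomino begin. -/
def rowY (b c y : ℤ) : ℤ := b - 2 + c * (y - b)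

theorem colX_add_one (a w c x : ℤ) : colX a w c (x + 1) = colX a w c x + c := by
  unfold colX; ring

theorem rowY_add_one (b c y : ℤ) : rowY b c (y + 1) = rowY b c y + c := by
  unfold rowY; ring

theorem colX_end (a w c : ℤ) : colX a w c (a + w) = a - 2 := by unfold colX; ring

theorem rowY_start (b c : ℤ) : rowY b c b = b - 2 := by unfold rowY; ring

theorem colX_mono {a w c x x' : ℤ} (hc : 0 ≤ c) (h : x ≤ x') : colX a w c x ≤ colX a w c x' := by
  unfold colX; nlinarith

theorem rowY_mono {b c y y' : ℤ} (hc : 0 ≤ c) (h : y ≤ y') : rowY b c y ≤ rowY b c y' := by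
  unfold rowY; nlinarith

theorem colX_add_le {a w c x x' : ℤ} (hc : 0 ≤ c) (h : x < x') :
    colX a w c x + c ≤ colX a w c x' := by
  rw [← colX_add_one]; exact colX_mono hc (by omega)

theorem rowY_add_le {b c y y' : ℤ} (hc : 0 ≤ c) (h : y < y') : rowY b c y + c ≤ rowY b c y' := by
  rw [← rowY_add_one]; exact rowY_mono hc (by omega)

theorem exists_colX {a w c p : ℤ} (hc : 0 < c) :
    ∃ x, colX a w c x ≤ p ∧ p < colX a w c x + c := by
  -- Blocks are counted from the column `a - 2`, with negative numbers to the west.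
  refine ⟨a + w + (p - (a - 2)) / c, ?_⟩
  have h1 := Int.mul_ediv_add_emod (p - (a - 2)) c
  have h2 := Int.emod_nonneg (p - (a - 2)) hc.ne'
  have h3 := Int.emod_lt_of_pos (p - (a - 2)) hc
  unfold colX
  constructor <;> nlinarith

/-- The part of the copy that belongs to the vertex `s`: a `c × c` square, or only the highest row
of this square if `s` is not in `P`. -/
def block (P : Set Cell) (a b w c : ℤ) (s : Cell) : Set Cell :=
  {q | colX a w c s.1 ≤ q.1 ∧ q.1 < colX a w c s.1 + c ∧ rowY b c s.2 ≤ q.2 ∧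
    q.2 < rowY b c s.2 + c ∧ (s ∈ P ∨ q.2 = rowY b c s.2 + c - 1)}

/-- The copy when the rows below `Y`, and the vertices from column `X` on in row `Y`, are done. -/
def dest (P : Set Cell) (a b w c X Y : ℤ) : Set Cell :=
  {q | ∃ s : Cell, a ≤ s.1 ∧ s.1 < a + w ∧ b ≤ s.2 ∧ (s.2 < Y ∨ s.2 = Y ∧ X ≤ s.1) ∧
    q ∈ block P a b w c s}

/-! ### The partial copy and its teeth -/

section dest

variable {P : Set Cell} {a b w c X Y : ℤ}

theorem dest_left (hc : 0 ≤ c) {q : Cell} (hq : q ∈ dest P a b w c X Y) :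
    q.1 < a - 2 ∧ b - 2 ≤ q.2 := by
  obtain ⟨s, _, h2, h3, _, h5, h6, h7, h8, _⟩ := hq
  have := colX_add_le (a := a) (w := w) hc h2
  rw [colX_end] at this
  have := rowY_mono (b := b) hc h3
  rw [rowY_start] at this
  omega

theorem dest_le (hc : 0 ≤ c) {q : Cell} (hq : q ∈ dest P a b w c X Y) :
    q.2 < rowY b c Y + c := by
  obtain ⟨s, _, h2, h3, h4, h5, h6, h7, h8, _⟩ := hq
  have := rowY_mono (b := b) hc (show s.2 ≤ Y by omega)
  omega

/-- `P` does not occur on the right: every treated vertex contributes the highest row of its square.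
In row `Y` the tooth ends at `colX a w c X`, which is where the next block has to go. All navigation
on the copying side rests on this. -/
theorem mem_dest_tooth (hc : 0 < c) (hX : a ≤ X) (y p : ℤ) :
    (p, rowY b c y + c - 1) ∈ dest P a b w c X Y ↔ b ≤ y ∧ p < a - 2 ∧
      (y < Y ∧ colX a w c a ≤ p ∨ y = Y ∧ colX a w c X ≤ p) := by
  constructor
  · intro hq
    have h0 := (dest_left hc.le hq).1
    obtain ⟨⟨s1, s2⟩, h1, h2, h3, h4, h5, h6, h7, h8, _⟩ := hq
    simp only at h0 h1 h2 h3 h4 h5 h6 h7 h8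
    obtain rfl : s2 = y := by
      rcases lt_trichotomy s2 y with h | h | h
      · have := rowY_add_le (b := b) hc.le h; omega
      · exact h
      · have := rowY_add_le (b := b) hc.le h; omega
    refine ⟨h3, h0, ?_⟩
    rcases h4 with h4 | ⟨h4, h4'⟩
    · exact .inl ⟨h4, (colX_mono hc.le h1).trans h5⟩
    · exact .inr ⟨h4, (colX_mono hc.le h4').trans h5⟩
  · rintro ⟨h1, h2, h3⟩
    obtain ⟨x, hx, hx'⟩ := exists_colX (a := a) (w := w) (p := p) hc
    have hlt : x < a + w := by
      by_contra hcon
      have := colX_mono (a := a) (w := w) hc.le (not_lt.1 hcon)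
      rw [colX_end] at this; omega
    have hge : ∀ z, colX a w c z ≤ p → z ≤ x := by
      intro z hz
      by_contra hcon
      have := colX_add_le (a := a) (w := w) hc.le (not_le.1 hcon)
      omega
    refine ⟨(x, y), ?_, hlt, h1, ?_, hx, hx', ?_, ?_, .inr rfl⟩
    · rcases h3 with ⟨_, h3⟩ | ⟨_, h3⟩
      · exact hge _ h3
      · exact hX.trans (hge _ h3)
    · rcases h3 with ⟨h3, _⟩ | ⟨h3, h4⟩
      · exact .inl h3
      · exact .inr ⟨h3, hge _ h4⟩
    · simp only; omega
    · simp only; omega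

theorem dest_succ (hX : a < X) (hX' : X ≤ a + w) (hY : b ≤ Y) :
    dest P a b w c (X - 1) Y = dest P a b w c X Y ∪ block P a b w c (X - 1, Y) := by
  ext q
  constructor
  · rintro ⟨⟨s1, s2⟩, h1, h2, h3, h4, h5⟩
    simp only at h1 h2 h3 h4
    by_cases h : s2 = Y ∧ s1 = X - 1
    · obtain ⟨rfl, rfl⟩ := h
      exact .inr h5
    · exact .inl ⟨(s1, s2), h1, h2, h3, by simp only; omega, h5⟩
  · rintro (⟨⟨s1, s2⟩, h1, h2, h3, h4, h5⟩ | h)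
    · simp only at h1 h2 h3 h4
      exact ⟨(s1, s2), h1, h2, h3, by simp only; omega, h5⟩
    · exact ⟨(X - 1, Y), by simp only; omega, by simp only; omega, hY,
        .inr ⟨rfl, le_rfl⟩, h⟩

theorem dest_next_row :
    dest P a b w c (a + w + 1) (Y + 1) = dest P a b w c a Y := by
  ext q
  constructor
  all_goals
    rintro ⟨⟨s1, s2⟩, h1, h2, h3, h4, h5⟩
    simp only at h1 h2 h3 h4
    exact ⟨(s1, s2), h1, h2, h3, by simp only; omega, h5⟩

/-- The margin column `a + w` of the bar has no block, so lifting the bar there leaves the copy as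
it is. -/
theorem dest_row_start : dest P a b w c (a + w + 1) Y = dest P a b w c (a + w) Y := by
  ext q
  constructor
  all_goals
    rintro ⟨⟨s1, s2⟩, h1, h2, h3, h4, h5⟩
    simp only at h1 h2 h3 h4
    exact ⟨(s1, s2), h1, h2, h3, by simp only; omega, h5⟩

end dest

/-- The tiles: a part `A` to the right of the west side of the frame, this side (up to `H`),
and a part `D` to the left of it. -/
def world (a b H : ℤ) (A D : Set Cell) : Set Cell :=
  A ∪ {q | q.1 = a - 2 ∧ b - 3 ≤ q.2 ∧ q.2 ≤ H} ∪ D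

theorem mem_world {a b H x y : ℤ} {A D : Set Cell} :
    (x, y) ∈ world a b H A D ↔
      (x, y) ∈ A ∨ (x = a - 2 ∧ b - 3 ≤ y ∧ y ≤ H) ∨ (x, y) ∈ D := by
  simp only [world, Set.mem_union, or_assoc]; rfl

theorem world_union_spine {a b H H' : ℤ} {A D : Set Cell} {Q : ℤ → Prop}
    (h : ∀ y, b - 3 ≤ y ∧ y ≤ H' ↔ (b - 3 ≤ y ∧ y ≤ H) ∨ Q y) :
    world a b H A D ∪ {q | q.1 = a - 2 ∧ Q q.2} = world a b H' A D := by
  ext ⟨x, y⟩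
  have := h y
  simp only [Set.mem_union, mem_world, Set.mem_ofPred_eq, this]
  tauto

/-- Fill a `c × c` square, or only its highest row. -/
def drawBlock (full : Bool) (c : ℕ) : Prog :=
  if full then rep c (rep (c - 1) (put .south) ;; rep (c - 1) (put .north) ;; go .west)
  else rep c (put .west)

/-- Walk along the west side of the frame to the first row of blocks that has not been begun. -/
def climb (c : ℕ) : Prog :=
  rep (c - 1) (put .north) ;; put .west ;;
    .whl true (go .east ;; rep c (put .north) ;; put .west)

/-- Walk to the place of the next block. -/
def findBlock (first : Bool) (c : ℕ) : Prog :=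
  climb c ;; go .east ;; (if first then rep c (put .north) else .act none none) ;;
    rep c (put .south) ;; go .west ;; .whl true (go .west)

/-- Add the next block, which is a full square or only its highest row. -/
def deliver (first full : Bool) (c : ℕ) : Prog :=
  findBlock first c ;; drawBlock full c ;; go .east ;; go .north ;; .whl false (go .east)

/-! ### Delivering one block -/

namespace Exec

variable {S A D : Set Cell} {a b H x y : ℤ}

theorem drawBlock_false (c : ℕ) : Exec (drawBlock false c) S (x, y)
    (S ∪ {q | x - c < q.1 ∧ q.1 ≤ x ∧ q.2 = y}) (x - c, y) (c + 1) := by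
  refine rep_put_west c ?_ rfl
  congr 1
  ext q
  simp only [Set.mem_ofPred_eq]; tauto

/-- Each column is drawn downwards, its lowest tile being left to the way back up. The robot thus
ends in the highest row just west of the square, exactly as after drawing a single row. -/
theorem drawBlock_true {c : ℕ} (hc : 2 ≤ c) : Exec (drawBlock true c) S (x, y)
    (S ∪ {q | x - c < q.1 ∧ q.1 ≤ x ∧ y - c < q.2 ∧ q.2 ≤ y}) (x - c, y) (c * (2 * c + 1) + 1) := by
  have key : ∀ (n : ℕ) (x : ℤ) (S : Set Cell), Exec (rep n
      (rep (c - 1) (put .south) ;; rep (c - 1) (put .north) ;; go .west)) S (x, y)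
      (S ∪ {q | x - n < q.1 ∧ q.1 ≤ x ∧ y - c < q.2 ∧ q.2 ≤ y}) (x - n, y)
      (n * (2 * c + 1) + 1) := by
    intro n
    induction n with
    | zero =>
      intro x S
      have e : {q : Cell | x - (0 : ℕ) < q.1 ∧ q.1 ≤ x ∧ y - c < q.2 ∧ q.2 ≤ y} = ∅ := by
        refine Set.eq_empty_of_forall_notMem fun q hq => ?_
        simp only [Set.mem_ofPred_eq] at hq; omega
      rw [e, Set.union_empty]
      exact skip.congr rfl (by simp) (by simp)
    | succ n ih =>
      intro x S
      refine (((rep_put_south (S' := S ∪ {q | q.1 = x ∧ y - c + 1 < q.2 ∧ q.2 ≤ y})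
          (y' := y - c + 1) (c - 1) ?_ ?_).seq ((rep_put_north (y' := y)
          (S' := S ∪ {q | q.1 = x ∧ y - c < q.2 ∧ q.2 ≤ y}) (c - 1) ?_ ?_).seq
          (go_tile (x' := x - 1) (y' := y) .west rfl (by simp [Dir.vec]) ?_))).seq (ih _ _)).congr
          ?_ ?_ ?_
      · congr 1
        ext q; simp only [Set.mem_ofPred_eq]; omega
      · omega
      · rw [Set.union_assoc]
        congr 1
        ext q; simp only [Set.mem_ofPred_eq, Set.mem_union]; omega
      · omega
      · right; simp only [Set.mem_ofPred_eq, true_and]; omega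
      · rw [Set.union_assoc]
        congr 1
        ext q; simp only [Set.mem_ofPred_eq, Set.mem_union]; omega
      · push_cast; ext <;> simp; ring
      · have : ((c - 1 : ℕ) : ℤ) = c - 1 := by omega
        rw [this]; push_cast; nlinarith
  exact key c x S

theorem drawBlock_block {P : Set Cell} {w X Y : ℤ} {c : ℕ} (hc : 2 ≤ c) (full : Bool)
    (hf : full = true ↔ (X - 1, Y) ∈ P) :
    Exec (drawBlock full c) S (colX a w c X - 1, rowY b c Y + c - 1)
      (S ∪ block P a b w c (X - 1, Y)) (colX a w c (X - 1) - 1, rowY b c Y + c - 1)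
      (c * (2 * c + 1) + 1) := by
  have e := colX_add_one a w c (X - 1)
  rw [sub_add_cancel] at e
  cases full
  · have hf' : (X - 1, Y) ∉ P := by simpa using hf
    refine (drawBlock_false c).congr ?_ (by rw [e]; ext <;> simp; ring) (by nlinarith)
    congr 1
    ext q
    simp only [block, Set.mem_ofPred_eq, hf', false_or]
    omega
  · have hf' : (X - 1, Y) ∈ P := by simpa using hf
    refine (drawBlock_true hc).congr ?_ (by rw [e]; ext <;> simp; ring) le_rfl
    congr 1
    ext q
    simp only [block, Set.mem_ofPred_eq, hf', true_or, and_true]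
    omega

/-- Placing a tile on a tile has no effect, so the same program walks along the spine and extends it
if it is too short. -/
theorem spine_north {H' y' : ℤ} (n : ℕ) (hx : x = a - 2) (hy : b - 3 ≤ y) (hyH : y ≤ H + 1)
    (hy' : y' = y + n) (hH' : H' = max H (y' - 1)) :
    Exec (rep n (put .north)) (world a b H A D) (x, y) (world a b H' A D) (x, y') (n + 1) := by
  subst hx hy' hH'
  refine rep_put_north n ?_ rfl
  exact world_union_spine (Q := fun q => y ≤ q ∧ q < y + n) fun q => by omega

theorem spine_put_west {H' x' : ℤ} (hx : x = a - 2) (hx' : x' = a - 3) (hy : b - 3 ≤ y)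
    (hyH : y ≤ H + 1) (hH' : H' = max H y) :
    Exec (put .west) (world a b H A D) (x, y) (world a b H' A D) (x', y) 1 := by
  subst hx hx' hH'
  refine put_eq .west (by simp [Dir.vec]; ring) (by simp [Dir.vec]) ?_
  ext ⟨p, q⟩
  simp only [Set.mem_insert_iff, mem_world, Prod.mk.injEq]
  have : (p = a - 2 ∧ b - 3 ≤ q ∧ q ≤ max H y) ↔
      (p = a - 2 ∧ b - 3 ≤ q ∧ q ≤ H) ∨ (p = a - 2 ∧ q = y) := by omega
  rw [this]; tauto

theorem go_east (hx : x' = x + 1) (h : (x, y) ∈ S) : Exec (go .east) S (x, y) S (x', y) 1 :=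
  go_tile .east hx (by simp [Dir.vec]) h

theorem go_west (hx : x' = x - 1) (h : (x, y) ∈ S) : Exec (go .west) S (x, y) S (x', y) 1 :=
  go_tile .west hx (by simp [Dir.vec]) h

theorem go_north (hy : y' = y + 1) (h : (x, y) ∈ S) : Exec (go .north) S (x, y) S (x, y') 1 :=
  go_tile .north (by simp [Dir.vec]) hy h

theorem go_south (hy : y' = y - 1) (h : (x, y) ∈ S) : Exec (go .south) S (x, y) S (x, y') 1 :=
  go_tile .south (by simp [Dir.vec]) hy h

theorem east_att (hx : x' = x + 1) (h : Att S (x', y)) : Exec (go .east) S (x, y) S (x', y) 1 :=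
  go_att .east hx (by simp [Dir.vec]) h

theorem west_att (hx : x' = x - 1) (h : Att S (x', y)) : Exec (go .west) S (x, y) S (x', y) 1 :=
  go_att .west hx (by simp [Dir.vec]) h

theorem north_att (hy : y' = y + 1) (h : Att S (x, y')) : Exec (go .north) S (x, y) S (x, y') 1 :=
  go_att .north (by simp [Dir.vec]) hy h

theorem south_att (hy : y' = y - 1) (h : Att S (x, y')) : Exec (go .south) S (x, y) S (x, y') 1 :=
  go_att .south (by simp [Dir.vec]) hy h

/-- The column `a - 3` is probed at the heights of the teeth, `c` rows apart. A row of blocks that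
has been begun has a tile there, so with `m` such rows the first failing probe is at `τ`. Each round
costs `c + 1` for the climb, two further moves and the test. -/
theorem climb {c : ℕ} {m : ℕ} {τ H' : ℤ} (hc : 0 < c) (hH : b - 3 ≤ H) (hA : ∀ q ∈ A, a - 2 < q.1)
    (hD : ∀ y, b ≤ y → y < b + m → (a - 3, rowY b c y + c - 1) ∈ D)
    (hD' : (a - 3, τ) ∉ D) (hτ : τ = rowY b c (b + m) + c - 1) (hH' : H' = max H τ) :
    Exec (climb c) (world a b H A D) (a - 2, b - 2) (world a b H' A D) (a - 3, τ)
      (m * (c + 4) + c + 3) := by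
  have hr : ∀ y, b ≤ y → b - 2 ≤ rowY b c y := fun y hy => by
    have := rowY_mono (b := b) (c := c) (by omega) hy
    rwa [rowY_start] at this
  have key : ∀ (k : ℕ) (y : ℤ) (H : ℤ), b ≤ y → y + k = b + m → rowY b c y + c - 1 ≤ H →
      H' = max H τ →
      Exec (.whl true (go .east ;; rep c (put .north) ;; put .west)) (world a b H A D)
      (a - 3, rowY b c y + c - 1) (world a b H' A D) (a - 3, τ) (k * (c + 4) + 1) := by
    intro k
    induction k with
    | zero =>
      intro y H hy hk hH hH'
      simp only [Nat.cast_zero, add_zero] at hk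
      subst hk hτ
      rw [max_eq_left hH] at hH'
      subst hH'
      refine (whl_done ?_).mono (by simp)
      have : (a - 3, rowY b c (b + m) + c - 1) ∉ A := fun h => by have := hA _ h; simp at this
      simp [mem_world, hD', this]
    | succ k ih =>
      intro y H hy hk hH hH'
      have hmem := hD y hy (by push_cast at hk; omega)
      have hr' := hr y hy
      have hr1 := rowY_add_one b c y
      have hr2 := rowY_mono (b := b) (c := c) (by omega) (show y + 1 ≤ b + m by omega)
      have h1 : Exec (go .east) (world a b H A D) (a - 3, rowY b c y + c - 1) (world a b H A D)
          (a - 2, rowY b c y + c - 1) 1 := go_east (by ring) (by simp [mem_world, hmem])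
      have h2 := spine_north (a := a) (b := b) (H := H) (A := A) (D := D) (x := a - 2)
        (y := rowY b c y + c - 1) (y' := rowY b c (y + 1) + c - 1) c rfl (by omega) (by omega)
        (by omega) rfl
      refine (whl_step (by simp [mem_world, hmem]) (h1.seq (h2.seq (spine_put_west rfl rfl
        (by omega) (by omega) rfl))) (ih (y + 1) _ (by omega) (by push_cast at hk; omega)
        (by omega) (by omega))).mono ?_
      push_cast; linarith
  have h2 := spine_north (a := a) (b := b) (H := H) (A := A) (D := D) (x := a - 2)
    (y := b - 2) (y' := rowY b c b + c - 1) (c - 1) rfl (by omega) (by omega)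
    (by rw [rowY_start]; omega) rfl
  have hr1 := rowY_start b c
  have hr2 := rowY_mono (b := b) (c := c) (by omega) (show b ≤ b + m by omega)
  refine (h2.seq ((spine_put_west rfl rfl (by omega) (by omega) rfl).seq
    (key m b _ le_rfl rfl (by omega) (by omega)))).mono ?_
  have : ((c - 1 : ℕ) : ℤ) = c - 1 := by omega
  rw [this]; linarith

/-- `climb` ends at row `Y` if its first block is due, and one row of blocks too high otherwise. In
the former case the robot climbs `c` more, so that the same descent fits both cases; this also
raises the spine to the height `rowY b c Y + 2 * c - 1`, which the later deliveries in this row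
assume. The walk west along the tooth then stops at the place of the next block. -/
theorem findBlock {P : Set Cell} {w X Y : ℤ} {c : ℕ} {H' : ℤ} (first : Bool) (hc : 2 ≤ c)
    (hH : b - 3 ≤ H) (hA : ∀ q ∈ A, a - 2 < q.1) (hX : a < X) (hX' : X ≤ a + w) (hY : b ≤ Y)
    (hf : first = true ↔ X = a + w) (hf' : first = false → rowY b c Y + 2 * c - 1 ≤ H)
    (hH' : H' = max H (rowY b c Y + 2 * c - 1)) :
    Exec (findBlock first c) (world a b H A (dest P a b w c X Y)) (a - 2, b - 2)
      (world a b H' A (dest P a b w c X Y)) (colX a w c X - 1, rowY b c Y + c - 1)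
      ((Y - b + 1) * (c + 4) + 3 * c + 10 + 2 * (c * w)) := by
  have hc0 : (0 : ℤ) < c := by omega
  have hmem := mem_dest_tooth (P := P) (b := b) (w := w) (Y := Y) hc0 hX.le
  have hcw : colX a w c a < a - 2 := by
    have := colX_add_le (a := a) (w := w) hc0.le (show a < a + w by omega)
    rw [colX_end] at this; omega
  have hcX := colX_mono (a := a) (w := w) hc0.le hX'
  have hcX0 := colX_mono (a := a) (w := w) hc0.le hX.le
  have hcX1 : a - 2 - colX a w c X ≤ c * w := by
    unfold colX; nlinarith
  rw [colX_end] at hcX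
  have hnA : ∀ x y, x ≤ a - 2 → (x, y) ∉ A := fun x y hx h => by have := hA _ h; simp only at this; omega
  have hr0 : b - 2 ≤ rowY b c Y := by
    have := rowY_mono (b := b) (c := c) (by omega) hY
    rwa [rowY_start] at this
  have hr1 := rowY_add_one b c Y
  have hD : ∀ y, b ≤ y → y < Y → (a - 3, rowY b c y + c - 1) ∈ dest P a b w c X Y := fun y h1 h2 =>
    (hmem y _).2 ⟨h1, by omega, .inl ⟨h2, by omega⟩⟩
  have hfin : Exec (go .west ;; .whl true (go .west)) (world a b H' A (dest P a b w c X Y))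
      (a - 2, rowY b c Y + c - 1) (world a b H' A (dest P a b w c X Y))
      (colX a w c X - 1, rowY b c Y + c - 1) (1 + (2 * (c * w) + 1)) := by
    refine ((go_west (x' := a - 3) (by ring) ?_).seq (tiles_west (by omega) (fun z h1 h2 => ?_)
      ?_)).mono ?_
    · rw [mem_world]; omega
    · rw [mem_world, hmem]; omega
    · rw [mem_world, hmem]; simp only [hnA _ _ (show colX a w c X - 1 ≤ a - 2 by omega), false_or]; omega
    · linarith
  cases first
  · have hX'' : X < a + w := by
      rcases hX'.lt_or_eq with h | h
      · exact h
      · simp [h] at hf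
    have hH := hf' rfl
    obtain ⟨m, hm⟩ : ∃ m : ℕ, Y + 1 = b + m := ⟨(Y + 1 - b).toNat, by omega⟩
    have hcX2 := colX_add_le (a := a) (w := w) hc0.le hX''
    rw [colX_end] at hcX2
    obtain rfl : H' = H := by omega
    have h1 : Exec (RobotsOnTiles.climb c) (world a b H' A (dest P a b w c X Y)) (a - 2, b - 2)
        (world a b H' A (dest P a b w c X Y)) (a - 3, rowY b c (Y + 1) + c - 1)
        (m * (c + 4) + c + 3) := by
      refine climb (by omega) (by omega) hA (fun y h1 h2 => (hmem _ _).2 ?_) ?_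
        (by rw [hm]) (by omega)
      · omega
      · rw [hmem]; omega
    have h2 : Exec (rep c (put .south)) (world a b H' A (dest P a b w c X Y))
        (a - 2, rowY b c (Y + 1) + c - 1)
        (world a b H' A (dest P a b w c X Y)) (a - 2, rowY b c Y + c - 1) (c + 1) := by
      refine rep_put_south c ?_ (by omega)
      refine Set.union_eq_self_of_subset_right ?_
      rintro ⟨p, q⟩ hq
      simp only [Set.mem_ofPred_eq] at hq
      rw [mem_world]; omega
    refine (h1.seq ((east_att (x' := a - 2) (by ring) (.inl ?_)).seq
      (skip.seq (h2.seq hfin)))).mono ?_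
    · rw [mem_world]; omega
    · have : (m : ℤ) = Y - b + 1 := by omega
      rw [this]; linarith
  · have hX'' := hf.1 rfl
    obtain ⟨m, hm⟩ : ∃ m : ℕ, Y = b + m := ⟨(Y - b).toNat, by omega⟩
    have hcX2 : colX a w c X = a - 2 := by rw [hX'', colX_end]
    have h1 : Exec (RobotsOnTiles.climb c) (world a b H A (dest P a b w c X Y)) (a - 2, b - 2)
        (world a b (max H (rowY b c Y + c - 1)) A (dest P a b w c X Y)) (a - 3, rowY b c Y + c - 1)
        (m * (c + 4) + c + 3) := by
      refine climb (by omega) (by omega) hA (fun y h1 h2 => (hmem _ _).2 ?_) ?_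
        (by rw [hm]) (by omega)
      · omega
      · rw [hmem]; omega
    have h3 := spine_north (a := a) (b := b) (H := max H (rowY b c Y + c - 1)) (A := A)
      (D := dest P a b w c X Y) (x := a - 2) (y := rowY b c Y + c - 1)
      (y' := rowY b c (Y + 1) + c - 1) c rfl (by omega) (by omega) (by omega) rfl
    have h2 : Exec (rep c (put .south)) (world a b (max (max H (rowY b c Y + c - 1))
          (rowY b c (Y + 1) + c - 1 - 1)) A (dest P a b w c X Y))
        (a - 2, rowY b c (Y + 1) + c - 1)
        (world a b H' A (dest P a b w c X Y)) (a - 2, rowY b c Y + c - 1) (c + 1) := by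
      refine rep_put_south c ?_ (by omega)
      exact world_union_spine (Q := fun q => rowY b c (Y + 1) + c - 1 - c < q ∧
        q ≤ rowY b c (Y + 1) + c - 1) fun q => by omega
    refine (h1.seq ((east_att (x' := a - 2) (by ring) (.inl ?_)).seq
      (h3.seq (h2.seq hfin)))).mono ?_
    · rw [mem_world]; omega
    · have : (m : ℤ) = Y - b := by omega
      rw [this]; linarith

/-- For the way back, the row just above the tooth is empty as far as the spine (`dest_le`), and the
tooth below keeps the robot attached. The spine is high enough to stop it. -/
theorem deliver {P : Set Cell} {w X Y : ℤ} {c : ℕ} {H' : ℤ} (first full : Bool) (hc : 2 ≤ c)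
    (hH : b - 3 ≤ H) (hA : ∀ q ∈ A, a - 2 < q.1) (hX : a < X) (hX' : X ≤ a + w) (hY : b ≤ Y)
    (hf : first = true ↔ X = a + w) (hf' : first = false → rowY b c Y + 2 * c - 1 ≤ H)
    (hfull : full = true ↔ (X - 1, Y) ∈ P)
    (hH' : H' = max H (rowY b c Y + 2 * c - 1)) :
    Exec (deliver first full c) (world a b H A (dest P a b w c X Y)) (a - 2, b - 2)
      (world a b H' A (dest P a b w c (X - 1) Y)) (a - 2, rowY b c Y + c)
      ((Y - b + 1) * (c + 4) + 4 * c + 14 + 4 * (c * w) + 2 * (c * c)) := by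
  have hc0 : (0 : ℤ) < c := by omega
  have hmem := mem_dest_tooth (P := P) (b := b) (w := w) (Y := Y) hc0 (show a ≤ X - 1 by omega)
  have hle := @dest_le P a b w c (X - 1) Y hc0.le
  have hnA : ∀ x y, x ≤ a - 2 → (x, y) ∉ A := fun x y hx h => by have := hA _ h; simp only at this; omega
  have hcX := colX_add_le (a := a) (w := w) hc0.le (show X - 1 < a + w by omega)
  have hcX0 := colX_mono (a := a) (w := w) hc0.le (show a ≤ X - 1 by omega)
  have hcX1 : a - 2 - colX a w c (X - 1) ≤ c * w := by
    unfold colX; nlinarith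
  rw [colX_end] at hcX
  have hr0 : b - 2 ≤ rowY b c Y := by
    have := rowY_mono (b := b) (c := c) (by omega) hY
    rwa [rowY_start] at this
  have h1 := findBlock (P := P) (w := w) (X := X) (Y := Y) (A := A) first hc hH hA hX hX' hY hf hf' hH'
  have h2 := drawBlock_block (S := world a b H' A (dest P a b w c X Y)) (a := a) (b := b) (w := w)
    hc full hfull
  have e : world a b H' A (dest P a b w c X Y) ∪ block P a b w c (X - 1, Y) =
      world a b H' A (dest P a b w c (X - 1) Y) := by
    rw [dest_succ hX hX' hY]; simp only [world, Set.union_assoc]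
  rw [e] at h2
  have hmem1 : (colX a w c (X - 1), rowY b c Y + c - 1) ∈
      world a b H' A (dest P a b w c (X - 1) Y) := by
    rw [mem_world, hmem]; omega
  refine (h1.seq (h2.seq ((east_att (x' := colX a w c (X - 1)) (by ring) (.inl hmem1)).seq
    ((go_north (y' := rowY b c Y + c) (by ring) hmem1).seq (empty_east (by omega)
    (fun z h1 h2 => ?_) (fun z h1 h2 => .south ?_) ?_))))).mono ?_
  · rw [mem_world]
    have : (z, rowY b c Y + c) ∉ dest P a b w c (X - 1) Y := fun h => by
      have := hle h; simp at this
    simp only [hnA _ _ (show z ≤ a - 2 by omega), this, false_or, or_false]; omega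
  · rw [mem_world, hmem]; omega
  · rw [mem_world]; omega
  · linarith

end Exec

/-! ### Reading the polyomino -/

/-- The tiles to the right of the west side of the frame when the rows of the
polyomino below `Y` and the vertices from column `X` on in row `Y` have been read:
the remaining frame, the rest of the row below `Y`, the part of row `Y` that has been read,
and the part of the polyomino that has not been read. -/
def field (P : Set Cell) (a b w h X Y : ℤ) : Set Cell :=
  {q | (q.1 = a + w + 1 ∧ b - 3 ≤ q.2 ∧ q.2 ≤ b + h + 1) ∨
    ((q.2 = b - 3 ∨ q.2 = b + h + 1) ∧ a - 2 < q.1 ∧ q.1 ≤ a + w + 1) ∨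
    (q.2 = Y - 1 ∧ a - 1 ≤ q.1 ∧ q.1 ≤ X - 1) ∨
    (q.2 = Y ∧ X ≤ q.1 ∧ q.1 ≤ a + w) ∨
    (q ∈ P ∧ (Y < q.2 ∨ q.2 = Y ∧ q.1 < X))}

theorem mem_field {P : Set Cell} {a b w h X Y x y : ℤ} : (x, y) ∈ field P a b w h X Y ↔
    (x = a + w + 1 ∧ b - 3 ≤ y ∧ y ≤ b + h + 1) ∨
    ((y = b - 3 ∨ y = b + h + 1) ∧ a - 2 < x ∧ x ≤ a + w + 1) ∨
    (y = Y - 1 ∧ a - 1 ≤ x ∧ x ≤ X - 1) ∨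
    (y = Y ∧ X ≤ x ∧ x ≤ a + w) ∨
    ((x, y) ∈ P ∧ (Y < y ∨ y = Y ∧ x < X)) := Iff.rfl

/-- Walk from the west side of the frame to the west end of the row below the current one. -/
def home : Prog :=
  .whl true (go .south) ;; go .north ;; go .north ;; go .east ;; .whl false (go .north)

/-- Having read a vertex, mark it as read and deliver the result. -/
def cellRest (first full : Bool) (c : ℕ) : Prog :=
  put .south ;; del .west ;; go .south ;; .whl false (go .west) ;; .whl true (go .south) ;;
    go .north ;; go .north ;; deliver first full c ;; home ;; go .east

/-- Read the next vertex and deliver the result. -/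
def cell (first : Bool) (c : ℕ) : Prog :=
  .whl true (go .east) ;; go .west ;; go .north ;;
    .ite (cellRest first true c) (cellRest first false c)

/-- Treat one row. -/
def row (c : ℕ) : Prog :=
  .whl true (go .east) ;; go .west ;; go .west ;; go .north ;; put .south ;; del .west ;;
    cell true c ;; .whl true (cell false c) ;; go .north ;; go .west ;; put .south ;; del .north

/-- Treat all rows. -/
def rows (c : ℕ) : Prog :=
  go .north ;; go .north ;; .whl false (go .south ;; go .south ;; row c ;; go .north ;; go .north)

/-- Bounds for the polyomino. -/
def InBox (P : Set Cell) (a b w h : ℤ) : Prop :=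
  ∀ x y, (x, y) ∈ P → (a ≤ x ∧ x ≤ a + w - 1) ∧ b ≤ y ∧ y ≤ b + h - 1

/-- The set lies to the left of the west side of the frame. -/
def IsLeft (D : Set Cell) (a b : ℤ) : Prop := ∀ x y, (x, y) ∈ D → x < a - 2 ∧ b - 2 ≤ y

theorem isLeft_dest {P : Set Cell} {a b w c X Y : ℤ} (hc : 0 ≤ c) :
    IsLeft (dest P a b w c X Y) a b := fun _ _ h => dest_left hc h

theorem field_right {P : Set Cell} {a b w h X Y : ℤ} (hP : InBox P a b w h) (hX : a ≤ X)
    (hw : 1 ≤ w) : ∀ q ∈ field P a b w h X Y, a - 2 < q.1 := by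
  rintro ⟨x, y⟩ hq
  rw [mem_field] at hq
  have := hP x y
  simp only
  grind

/-! ### Returning to the bar and lifting it at one vertex -/

namespace Exec

variable {P D : Set Cell} {a b w h H X Y y : ℤ} {c : ℕ}

/-- The current row need not be remembered: in the column `a - 1`, the bar is the first tile above
the south side. -/
theorem home (hP : InBox P a b w h) (hD : IsLeft D a b) (hw : 1 ≤ w) (hX : a ≤ X)
    (hY : b ≤ Y) (hY' : Y ≤ b + h) (hH : b + h + 1 ≤ H) (hy : b - 3 ≤ y) (hyH : y ≤ H) :
    Exec home (world a b H (field P a b w h X Y) D) (a - 2, y)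
      (world a b H (field P a b w h X Y) D) (a - 1, Y - 1) (2 * (y - b) + 2 * (Y - b) + 15) := by
  have hP' := hP
  have hD' := hD
  unfold InBox at hP'
  unfold IsLeft at hD'
  refine ((tiles_south (y' := b - 4) (by omega) ?_ ?_).seq ((north_att (y' := b - 3) (by ring)
    (.inl ?_)).seq ((go_north (y' := b - 2) (by ring) ?_).seq ((go_east (x' := a - 1) (by ring) ?_).seq
    (empty_north (y' := Y - 1) (by omega) ?_ ?_ ?_))))).mono (by linarith)
  · intro z h1 h2; rw [mem_world]; grind
  · rw [mem_world, mem_field]; grind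
  · rw [mem_world]; grind
  · rw [mem_world]; grind
  · rw [mem_world]; grind
  · intro z h1 h2; rw [mem_world, mem_field]; grind
  · intro z h1 h2; refine .west ?_; rw [mem_world]; grind
  · rw [mem_world, mem_field]; grind

/-- Reading never touches the east and the north side. The eastern piece of the bar therefore
reaches the north-west corner around them, and the western piece reaches it along the west side;
this corner is the common target for `Conn.erase`. -/
theorem link_hub {S : Set Cell} (hE : ∀ z, b - 3 ≤ z → z ≤ b + h + 1 → (a + w + 1, z) ∈ S)
    (hN : ∀ z, a - 2 ≤ z → z ≤ a + w + 1 → (z, b + h + 1) ∈ S) (hw : 1 ≤ w) {y : ℤ}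
    (hy : b - 3 ≤ y) (hy' : y ≤ b + h + 1) : Link S (a + w + 1, y) (a - 2, b + h + 1) :=
  (Link.ver hy' fun z h1 h2 => hE z (by omega) (by omega)).trans
    (Link.hor (by omega) fun z h1 h2 => hN z (by omega) (by omega)).symm

/-- With `(X - 1, Y)` just filled, the tile below it has no neighbour in the east, where the bar has
already been lifted, and none in the south, where the corridor is. The one in the north is on the
eastern piece of the bar, the one in the west on the western piece or the frame. -/
theorem mark (hP : InBox P a b w h) (hD : IsLeft D a b) (hw : 1 ≤ w) (hX : a < X)
    (hX' : X ≤ a + w) (hY : b ≤ Y) (hY' : Y < b + h) (hH : b + h + 1 ≤ H) :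
    Exec (del .west) (insert (X - 1, Y) (world a b H (field P a b w h X Y) D)) (X - 1, Y - 1)
      (world a b H (field P a b w h (X - 1) Y) D) (X - 2, Y - 1) 1 := by
  unfold InBox at hP
  unfold IsLeft at hD
  refine del_eq .west (by simp [Dir.vec]; ring) (by simp [Dir.vec]) (fun hc => ?_) ?_ ?_
  · have hm : ∀ x y, (x, y) ∈ (insert (X - 1, Y) (world a b H (field P a b w h X Y) D)) \
        {(X - 1, Y - 1)} ↔ (x, y) ≠ (X - 1, Y - 1) ∧ ((x, y) = (X - 1, Y) ∨
          (x, y) ∈ world a b H (field P a b w h X Y) D) := by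
      intro x y; simp [and_comm]
    simp only [ne_eq, Prod.mk.injEq, mem_world, mem_field] at hm
    refine hc.erase (z := (a - 2, b + h + 1)) ?_ ?_
    · rw [hm]; grind
    · have hub := fun y => link_hub (S := (insert (X - 1, Y) (world a b H (field P a b w h X Y) D)) \
        {(X - 1, Y - 1)}) (a := a) (b := b) (w := w) (h := h) (by intro z _ _; rw [hm]; grind)
        (by intro z _ _; rw [hm]; grind) hw (y := y)
      intro d hd
      cases d <;> simp only [Dir.vec, Prod.mk_add_mk, add_zero] at hd ⊢
      · rw [sub_add_cancel]
        exact (Link.hor (x' := a + w + 1) (by omega) (by intro z _ _; rw [hm]; grind)).trans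
          (hub Y (by omega) (by omega))
      · exfalso
        simp only [Set.mem_insert_iff, Prod.mk.injEq, mem_world, mem_field] at hd
        grind
      · exfalso
        simp only [Set.mem_insert_iff, Prod.mk.injEq, mem_world, mem_field] at hd
        grind
      · refine (Link.hor (x := a - 2) (by omega) ?_).symm.trans (Link.ver (by omega) ?_)
        · intro z _ _; rw [hm]; grind
        · intro z _ _; rw [hm]; grind
  · simp only [Set.mem_insert_iff, Prod.mk.injEq, mem_world, mem_field]; grind
  · ext ⟨x, y⟩
    simp only [Set.mem_sdiff, Set.mem_singleton_iff, Set.mem_insert_iff, Prod.mk.injEq, mem_world, mem_field]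
    have := hP x y
    have := hD x y
    grind

end Exec

/-! ### Reading one vertex, one row and all rows -/

namespace Exec

variable {P D : Set Cell} {a b w h H X Y y : ℤ} {c : ℕ}

/-- The robot leaves through the corridor in row `Y - 2`, attached to the bar above it; for `Y = b`
this is the former south side of the frame. The bit read is nothing but the choice of `full`. -/
theorem cellRest {H' : ℤ} (first full : Bool) (hP : InBox P a b w h) (hc : 2 ≤ c)
    (hX : a < X) (hX' : X ≤ a + w) (hY : b ≤ Y) (hY' : Y < b + h) (hH : b + h + 1 ≤ H)
    (hf : first = true ↔ X = a + w) (hf' : first = false → rowY b c Y + 2 * c - 1 ≤ H)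
    (hfull : full = true ↔ (X - 1, Y) ∈ P) (hH' : H' = max H (rowY b c Y + 2 * c - 1)) :
    Exec (cellRest first full c) (world a b H (field P a b w h X Y) (dest P a b w c X Y)) (X - 1, Y)
      (world a b H' (field P a b w h (X - 1) Y) (dest P a b w c (X - 1) Y)) (a, Y - 1)
      (60 * (c * c + c * w + c * h)) := by
  have hw : 1 ≤ w := by omega
  have hc0 : (0 : ℤ) ≤ c := by omega
  have hD := isLeft_dest (P := P) (a := a) (b := b) (w := w) (X := X) (Y := Y) hc0
  have hD1 := isLeft_dest (P := P) (a := a) (b := b) (w := w) (X := X - 1) (Y := Y) hc0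
  have hr0 : b - 2 ≤ rowY b c Y := by
    have := rowY_mono (b := b) (c := c) (by omega) hY
    rwa [rowY_start] at this
  have hdel := deliver (P := P) (A := field P a b w h (X - 1) Y) first full hc
    (show b - 3 ≤ H by omega) (field_right hP (by omega) hw) hX hX' hY hf hf' hfull hH'
  have hhome := home (H := H') (y := rowY b c Y + c) hP hD1 hw (show a ≤ X - 1 by omega) hY hY'.le
    (by omega) (by omega) (by omega)
  refine ((put_insert (x' := X - 1) (y' := Y - 1) .south (by simp [Dir.vec]) (by simp [Dir.vec]; ring)).seq
    ((mark hP hD hw hX hX' hY hY' hH).seq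
    ((go_south (y' := Y - 2) (by ring) ?_).seq ((empty_west (x' := a - 2) (by omega) ?_ ?_ ?_).seq
    ((tiles_south (y' := b - 4) (by omega) ?_ ?_).seq ((north_att (y' := b - 3) (by ring)
    (.inl ?_)).seq ((go_north (y' := b - 2) (by ring) ?_).seq (hdel.seq (hhome.seq
    (go_east (by ring) ?_)))))))))).mono ?_
  any_goals unfold InBox at hP
  any_goals unfold IsLeft at hD hD1
  · rw [mem_world, mem_field]; grind
  · intro z h1 h2; rw [mem_world, mem_field]; grind
  · intro z h1 h2; refine .north ?_; rw [mem_world, mem_field]; grind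
  · rw [mem_world, mem_field]; grind
  · intro z h1 h2; rw [mem_world]; grind
  · rw [mem_world, mem_field]; grind
  · rw [mem_world]; grind
  · rw [mem_world]; grind
  · rw [mem_world, mem_field]; grind
  · have e : rowY b c Y = b - 2 + c * (Y - b) := rfl
    -- Since `2 ≤ c`, the products bound all linear terms; treated as atoms, they leave a linear
    -- inequality.
    have h1 : c * (Y - b) ≤ c * h := mul_le_mul_of_nonneg_left (by omega) hc0
    have h2 : 2 * w ≤ c * w := mul_le_mul_of_nonneg_right (by omega) (by omega)
    have h3 : 2 * h ≤ c * h := mul_le_mul_of_nonneg_right (by omega) (by omega)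
    have h4 : 2 * c ≤ (c * c : ℤ) := mul_le_mul_of_nonneg_right (by omega) (by omega)
    have e' : (Y - b + 1) * (c + 4 : ℤ) = c * (Y - b) + 4 * (Y - b) + c + 4 := by ring
    rw [e, e']
    generalize (c : ℤ) * (Y - b) = v1 at *
    generalize (c : ℤ) * w = v2 at *
    generalize (c : ℤ) * h = v3 at *
    generalize (c : ℤ) * c = v4 at *
    omega

/-- In row `Y - 1` the bar ends in the column `X - 1`, right beneath the next vertex to read, so
walking along it to its end finds this vertex. -/
theorem cell {H' s : ℤ} (first : Bool) (hP : InBox P a b w h) (hc : 2 ≤ c)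
    (hX : a < X) (hX' : X ≤ a + w) (hY : b ≤ Y) (hY' : Y < b + h) (hH : b + h + 1 ≤ H)
    (hs : a ≤ s) (hs' : s < X)
    (hf : first = true ↔ X = a + w) (hf' : first = false → rowY b c Y + 2 * c - 1 ≤ H)
    (hH' : H' = max H (rowY b c Y + 2 * c - 1)) :
    Exec (cell first c) (world a b H (field P a b w h X Y) (dest P a b w c X Y)) (s, Y - 1)
      (world a b H' (field P a b w h (X - 1) Y) (dest P a b w c (X - 1) Y)) (a, Y - 1)
      (70 * (c * c + c * w + c * h)) := by
  have hD := isLeft_dest (P := P) (a := a) (b := b) (w := w) (c := c) (X := X) (Y := Y) (by omega)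
  have h1 := fun full => cellRest (P := P) first full hP hc hX hX' hY hY' hH hf hf'
    (hH' := hH')
  have hite : Exec (.ite (RobotsOnTiles.cellRest first true c) (RobotsOnTiles.cellRest first false c))
      (world a b H (field P a b w h X Y) (dest P a b w c X Y)) (X - 1, Y)
      (world a b H' (field P a b w h (X - 1) Y) (dest P a b w c (X - 1) Y)) (a, Y - 1)
      (60 * (c * c + c * w + c * h) + 1) := by
    -- A tile seen here can only belong to `P`.
    have hiff : (X - 1, Y) ∈ world a b H (field P a b w h X Y) (dest P a b w c X Y) ↔
        (X - 1, Y) ∈ P := by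
      unfold IsLeft at hD
      rw [mem_world, mem_field]; grind
    by_cases hmem : (X - 1, Y) ∈ P
    · exact ite_true (hiff.2 hmem) (h1 true (by simpa using hmem))
    · exact ite_false (fun h => hmem (hiff.1 h)) (h1 false (by simpa using hmem))
  refine ((tiles_east (x' := X) (by omega) ?_ ?_).seq ((west_att (x' := X - 1) (by ring) (.inl ?_)).seq
    ((go_north (y' := Y) (by ring) ?_).seq hite))).mono ?_
  any_goals unfold InBox at hP
  any_goals unfold IsLeft at hD
  · intro z h1 h2; rw [mem_world, mem_field]; grind
  · rw [mem_world, mem_field]; grind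
  · rw [mem_world, mem_field]; grind
  · rw [mem_world, mem_field]; grind
  · have h2 : 2 * w ≤ c * w := mul_le_mul_of_nonneg_right (by omega) (by omega)
    have h3 : 2 * h ≤ c * h := mul_le_mul_of_nonneg_right (by omega) (by omega)
    have h4 : 2 * c ≤ (c * c : ℤ) := mul_le_mul_of_nonneg_right (by omega) (by omega)
    generalize (c : ℤ) * w = v2 at *
    generalize (c : ℤ) * h = v3 at *
    generalize (c : ℤ) * c = v4 at *
    omega

theorem cells (hP : InBox P a b w h) (hc : 2 ≤ c)
    (hX : a ≤ X) (hX' : X < a + w) (hY : b ≤ Y) (hY' : Y < b + h) (hH : b + h + 1 ≤ H)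
    (hH' : rowY b c Y + 2 * c - 1 ≤ H) :
    Exec (.whl true (RobotsOnTiles.cell false c))
      (world a b H (field P a b w h X Y) (dest P a b w c X Y)) (a, Y - 1)
      (world a b H (field P a b w h a Y) (dest P a b w c a Y)) (a, Y - 1)
      ((X - a) * (71 * (c * c + c * w + c * h)) + 1) := by
  obtain ⟨n, hn⟩ : ∃ n : ℕ, X = a + n := ⟨(X - a).toNat, by omega⟩
  have hD := fun X => isLeft_dest (P := P) (a := a) (b := b) (w := w) (c := c) (X := X) (Y := Y)
    (by omega)
  -- Pays for the test in each round, whence 71 instead of 70.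
  have hM : (1 : ℤ) ≤ c * c + c * w + c * h := by
    have h2 : 0 ≤ c * w := mul_nonneg (by omega) (by omega)
    have h3 : 0 ≤ c * h := mul_nonneg (by omega) (by omega)
    have h4 : (1 : ℤ) ≤ c * c := by nlinarith
    omega
  induction n generalizing X with
  | zero =>
    obtain rfl : X = a := by simpa using hn
    -- For `X = a` the lower piece of the bar consists of the column `a - 1` only, so the test in
    -- the column `a` fails.
    refine (whl_done ?_).mono (by simp)
    unfold InBox at hP
    unfold IsLeft at hD
    rw [mem_world, mem_field]; grind
  | succ n ih =>
    push_cast at hn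
    have h1 := cell (H' := H) (P := P) (X := X) (s := a) false hP hc (by omega) hX'.le hY hY' hH le_rfl
      (by omega) (by simp; omega) (fun _ => hH') (by omega)
    refine (whl_step ?_ h1 (ih (X := X - 1) (by omega) (by omega) (by omega))).mono ?_
    · rw [mem_world, mem_field]; grind
    · linear_combination hM

/-- The column `a + w` lies outside `P` and is lifted without a delivery. Unlike in `mark`, the
eastern neighbour exists, but it belongs to the frame. -/
theorem row_begin (hP : InBox P a b w h) (hD : IsLeft D a b) (hw : 1 ≤ w) (hY : b ≤ Y)
    (hY' : Y < b + h) (hH : b + h + 1 ≤ H) :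
    Exec (del .west) (insert (a + w, Y) (world a b H (field P a b w h (a + w + 1) Y) D))
      (a + w, Y - 1) (world a b H (field P a b w h (a + w) Y) D) (a + w - 1, Y - 1) 1 := by
  unfold InBox at hP
  unfold IsLeft at hD
  have hm : ∀ x y, (x, y) ∈ (insert (a + w, Y) (world a b H (field P a b w h (a + w + 1) Y) D)) \
      {(a + w, Y - 1)} ↔ (x, y) ≠ (a + w, Y - 1) ∧ ((x, y) = (a + w, Y) ∨
        (x, y) ∈ world a b H (field P a b w h (a + w + 1) Y) D) := by
    intro x y; simp [and_comm]
  simp only [ne_eq, Prod.mk.injEq, mem_world, mem_field] at hm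
  refine del_eq .west (by simp [Dir.vec]; ring) (by simp [Dir.vec]) (fun hc => ?_) ?_ ?_
  · refine hc.erase (z := (a - 2, b + h + 1)) ?_ ?_
    · rw [hm]; grind
    · have hub := fun y => link_hub (S := (insert (a + w, Y)
        (world a b H (field P a b w h (a + w + 1) Y) D)) \
        {(a + w, Y - 1)}) (a := a) (b := b) (w := w) (h := h) (by intro z _ _; rw [hm]; grind)
        (by intro z _ _; rw [hm]; grind) hw (y := y)
      intro d hd
      cases d <;> simp only [Dir.vec, Prod.mk_add_mk, add_zero] at hd ⊢
      · rw [sub_add_cancel]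
        exact (Link.hor (x' := a + w + 1) (by omega) (by intro z _ _; rw [hm]; grind)).trans
          (hub Y (by omega) (by omega))
      · exact hub (Y - 1) (by omega) (by omega)
      · exfalso
        simp only [Set.mem_insert_iff, Prod.mk.injEq, mem_world, mem_field] at hd
        grind
      · refine (Link.hor (x := a - 2) (by omega) ?_).symm.trans (Link.ver (by omega) ?_)
        · intro z _ _; rw [hm]; grind
        · intro z _ _; rw [hm]; grind
  · simp only [Set.mem_insert_iff, Prod.mk.injEq, mem_world, mem_field]; grind
  · ext ⟨x, y⟩
    rw [hm]
    simp only [mem_world, mem_field]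
    have := hP x y
    have := hD x y
    grind

/-- The counterpart in the western margin column. After it the whole bar lies in row `Y`, which is
the initial state of the next row. -/
theorem row_end (hP : InBox P a b w h) (hD : IsLeft D a b) (hw : 1 ≤ w) (hY : b ≤ Y)
    (hY' : Y < b + h) (hH : b + h + 1 ≤ H) :
    Exec (del .north) (insert (a - 1, Y) (world a b H (field P a b w h a Y) D))
      (a - 1, Y - 1) (world a b H (field P a b w h (a + w + 1) (Y + 1)) D) (a - 1, Y) 1 := by
  unfold InBox at hP
  unfold IsLeft at hD
  have hm : ∀ x y, (x, y) ∈ (insert (a - 1, Y) (world a b H (field P a b w h a Y) D)) \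
      {(a - 1, Y - 1)} ↔ (x, y) ≠ (a - 1, Y - 1) ∧ ((x, y) = (a - 1, Y) ∨
        (x, y) ∈ world a b H (field P a b w h a Y) D) := by
    intro x y; simp [and_comm]
  simp only [ne_eq, Prod.mk.injEq, mem_world, mem_field] at hm
  refine del_eq .north (by simp [Dir.vec]) (by simp [Dir.vec]) (fun hc => ?_) ?_ ?_
  · refine hc.erase (z := (a - 2, b + h + 1)) ?_ ?_
    · rw [hm]; grind
    · intro d hd
      cases d <;> simp only [Dir.vec, Prod.mk_add_mk, add_zero] at hd ⊢
      · rw [sub_add_cancel]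
        refine (Link.hor (x := a - 2) (by omega) ?_).symm.trans (Link.ver (by omega) ?_)
        · intro z _ _; rw [hm]; grind
        · intro z _ _; rw [hm]; grind
      · exfalso
        simp only [Set.mem_insert_iff, Prod.mk.injEq, mem_world, mem_field] at hd
        grind
      · exfalso
        simp only [Set.mem_insert_iff, Prod.mk.injEq, mem_world, mem_field] at hd
        grind
      · rw [show a - 1 + -1 = a - 2 by ring]
        refine Link.ver (by omega) ?_
        intro z _ _; rw [hm]; grind
  · simp
  · ext ⟨x, y⟩
    rw [hm]
    simp only [mem_world, mem_field]
    have := hP x y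
    have := hD x y
    grind

theorem row {H' : ℤ} (hP : InBox P a b w h) (hc : 2 ≤ c) (hw : 1 ≤ w) (hY : b ≤ Y)
    (hY' : Y < b + h) (hH : b + h + 1 ≤ H) (hH' : H' = max H (rowY b c Y + 2 * c - 1)) :
    Exec (row c) (world a b H (field P a b w h (a + w + 1) Y) (dest P a b w c (a + w + 1) Y))
      (a - 1, Y - 1) (world a b H' (field P a b w h (a + w + 1) (Y + 1))
        (dest P a b w c (a + w + 1) (Y + 1))) (a - 1, Y)
      (w * (90 * (c * c + c * w + c * h))) := by
  have hc0 : (0 : ℤ) ≤ c := by omega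
  have hD := fun X => isLeft_dest (P := P) (a := a) (b := b) (w := w) (X := X) (Y := Y) hc0
  have h1 := row_begin hP (hD (a + w)) hw hY hY' hH
  have h2 := cell (H' := H') (P := P) (X := a + w) (s := a + w - 1) true hP hc (by omega) le_rfl
    hY hY' hH (by omega) (by omega) (by simp) (by simp) hH'
  have h3 := cells (X := a + w - 1) (H := H') hP hc (by omega) (by omega) hY hY' (by omega) (by omega)
  have h4 := row_end (H := H') hP (hD a) hw hY hY' (by omega)
  rw [dest_row_start, dest_next_row]
  refine ((tiles_east (x' := a + w + 2) (by omega) ?_ ?_).seq ((west_att (x' := a + w + 1) (by ring)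
    (.inl ?_)).seq ((go_west (x' := a + w) (by ring) ?_).seq ((go_north (y' := Y) (by ring) ?_).seq
    ((put_insert (x' := a + w) (y' := Y - 1) .south (by simp [Dir.vec]) (by simp [Dir.vec]; ring)).seq
    (h1.seq (h2.seq (h3.seq ((north_att (y' := Y) (by ring) (.inl ?_)).seq ((go_west (x' := a - 1)
    (by ring) ?_).seq ((put_insert (x' := a - 1) (y' := Y - 1) .south (by simp [Dir.vec])
    (by simp [Dir.vec]; ring)).seq h4))))))))))).mono ?_
  any_goals unfold InBox at hP
  any_goals unfold IsLeft at hD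
  · intro z h1 h2; rw [mem_world, mem_field]; grind
  · rw [mem_world, mem_field]; grind
  · rw [mem_world, mem_field]; grind
  · rw [mem_world, mem_field]; grind
  · rw [mem_world, mem_field]; grind
  · rw [mem_world, mem_field]; grind
  · rw [mem_world, mem_field]; grind
  · have h2 : 2 * w ≤ c * w := mul_le_mul_of_nonneg_right (by omega) (by omega)
    have h3 : 2 * h ≤ c * h := mul_le_mul_of_nonneg_right (by omega) (by omega)
    have h4 : 2 * c ≤ (c * c : ℤ) := mul_le_mul_of_nonneg_right (by omega) (by omega)
    have h5 : (c : ℤ) * c + c * w + c * h ≤ w * (c * c + c * w + c * h) :=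
      le_mul_of_one_le_left (by omega) hw
    generalize (c : ℤ) * w = v2 at *
    generalize (c : ℤ) * h = v3 at *
    generalize (c : ℤ) * c = v4 at *
    nlinarith

/-- The vertex tested is two above the bar in the column `a - 1`; it is empty until it lies on the
north side, that is, until all `h` rows are done. The lower bounds on the top `H` of the spine serve
the removal of the frame and the carving, the upper bound serves the running time. -/
theorem rows (hP : InBox P a b w h) (hc : 2 ≤ c) (hw : 1 ≤ w) (hh : 1 ≤ h) :
    ∃ H, b + h + 1 ≤ H ∧ rowY b c (b + h) + c - 1 ≤ H ∧
      H ≤ max (b + h + 1) (rowY b c (b + h) + c - 1) ∧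
    Exec (rows c) (world a b (b + h + 1) (field P a b w h (a + w + 1) b) (dest P a b w c (a + w + 1) b))
      (a - 1, b - 1) (world a b H (field P a b w h (a + w + 1) (b + h))
        (dest P a b w c (a + w + 1) (b + h))) (a - 1, b + h + 1)
      (h * (w * (100 * (c * c + c * w + c * h)))) := by
  have key : ∀ (n : ℕ) (Y H : ℤ), b ≤ Y → Y + n = b + h → b + h + 1 ≤ H →
      ∃ H', H ≤ H' ∧ (0 < n → rowY b c (b + h) + c - 1 ≤ H') ∧
        H' ≤ max H (rowY b c (b + h) + c - 1) ∧
      Exec (.whl false (go .south ;; go .south ;; RobotsOnTiles.row c ;; go .north ;; go .north))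
        (world a b H (field P a b w h (a + w + 1) Y) (dest P a b w c (a + w + 1) Y)) (a - 1, Y + 1)
        (world a b H' (field P a b w h (a + w + 1) (b + h)) (dest P a b w c (a + w + 1) (b + h)))
        (a - 1, b + h + 1) (n * (w * (95 * (c * c + c * w + c * h))) + 1) := by
    have hM : (1 : ℤ) ≤ w * (c * c + c * w + c * h) := by
      have h2 : 0 ≤ c * w := mul_nonneg (by omega) (by omega)
      have h3 : 0 ≤ c * h := mul_nonneg (by omega) (by omega)
      have h4 : (1 : ℤ) ≤ c * c := by nlinarith
      nlinarith
    intro n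
    induction n with
    | zero =>
      intro Y H hY hn hH
      obtain rfl : Y = b + h := by simpa using hn
      refine ⟨H, le_rfl, by simp, by simp, (whl_done ?_).mono (by simp)⟩
      rw [mem_world, mem_field]; grind
    | succ n ih =>
      intro Y H hY hn hH
      push_cast at hn
      have hD := fun X Y => isLeft_dest (P := P) (a := a) (b := b) (w := w) (c := c) (X := X)
        (Y := Y) (by omega)
      have hr1 := rowY_mono (b := b) (c := c) (by omega) (show Y + 1 ≤ b + h by omega)
      rw [rowY_add_one] at hr1
      have h1 := row (H := H) hP hc hw hY (by omega) hH rfl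
      obtain ⟨H', h2, h3, h4, h5⟩ := ih (Y + 1) (max H (rowY b c Y + 2 * c - 1)) (by omega)
        (by omega) (by omega)
      refine ⟨H', by omega, fun _ => ?_, by omega, ?_⟩
      · rcases Nat.eq_zero_or_pos n with rfl | hn0
        -- The last row has raised the spine to `rowY b c Y + 2 * c - 1`, which is the required
        -- height.
        · obtain rfl : Y = b + h - 1 := by simp at hn; omega
          have := rowY_add_one b c (b + h - 1)
          rw [sub_add_cancel] at this
          omega
        · exact h3 hn0
      · refine (whl_step ?_ ((south_att (y' := Y) (by ring) (.west ?_)).seq ((south_att (y' := Y - 1)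
          (by ring) (.inl ?_)).seq (h1.seq ((north_att (y' := Y + 1) (by ring) (.west ?_)).seq
          (north_att (y' := Y + 1 + 1) (by ring) (.west ?_)))))) h5).mono ?_
        any_goals unfold InBox at hP
        any_goals unfold IsLeft at hD
        · rw [mem_world, mem_field]; grind
        · rw [mem_world]; grind
        · rw [mem_world, mem_field]; grind
        · rw [mem_world]; grind
        · rw [mem_world]; grind
        · push_cast; linear_combination 5 * hM
  obtain ⟨H, h1, h2, h3, h4⟩ := key h.toNat b (b + h + 1) le_rfl (by omega) le_rfl
  refine ⟨H, h1, h2 (by omega), h3, ?_⟩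
  refine ((go_north (y' := b) (by ring) ?_).seq ((north_att (y' := b + 1) (by ring)
    (.west ?_)).seq h4)).mono ?_
  · rw [mem_world, mem_field]; grind
  · rw [mem_world]; grind
  · have hM : (1 : ℤ) ≤ w * (c * c + c * w + c * h) := by
      have h2 : 0 ≤ c * w := mul_nonneg (by omega) (by omega)
      have h3 : 0 ≤ c * h := mul_nonneg (by omega) (by omega)
      have h4 : (1 : ℤ) ≤ c * c := by nlinarith
      nlinarith
    rw [show (h.toNat : ℤ) = h by omega]
    have : (1 : ℤ) ≤ h * (w * (c * c + c * w + c * h)) := by nlinarith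
    linear_combination 5 * this

end Exec

/-! ### Preparing the frame -/

/-- The tiles at the beginning: the polyomino, its bounding box, and a tile that joins them. -/
def startSet (P : Set Cell) (a b w h x₀ : ℤ) : Set Cell :=
  {q | ((q.1 = a - 2 ∨ q.1 = a + w + 1) ∧ b - 2 ≤ q.2 ∧ q.2 ≤ b + h + 1) ∨
    ((q.2 = b - 2 ∨ q.2 = b + h + 1) ∧ a - 2 ≤ q.1 ∧ q.1 ≤ a + w + 1) ∨
    (q.1 = x₀ ∧ q.2 = b - 1) ∨ q ∈ P}

/-- The tiles while the south side of the frame is moved to the south and the row above it is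
filled; `z` is the current column. -/
def prepSet (P : Set Cell) (a b w h x₀ z : ℤ) : Set Cell :=
  {q | (q.1 = a - 2 ∧ b - 3 ≤ q.2 ∧ q.2 ≤ b + h + 1) ∨
    (q.1 = a + w + 1 ∧ b - 2 ≤ q.2 ∧ q.2 ≤ b + h + 1) ∨
    (q.2 = b + h + 1 ∧ a - 2 ≤ q.1 ∧ q.1 ≤ a + w + 1) ∨
    (q.2 = b - 2 ∧ z ≤ q.1 ∧ q.1 ≤ a + w + 1) ∨
    (q.2 = b - 3 ∧ a - 2 ≤ q.1 ∧ q.1 < z) ∨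
    (q.2 = b - 1 ∧ (a - 1 ≤ q.1 ∧ q.1 < z ∨ q.1 = x₀)) ∨ q ∈ P}

theorem mem_startSet {P : Set Cell} {a b w h x₀ x y : ℤ} : (x, y) ∈ startSet P a b w h x₀ ↔
    ((x = a - 2 ∨ x = a + w + 1) ∧ b - 2 ≤ y ∧ y ≤ b + h + 1) ∨
    ((y = b - 2 ∨ y = b + h + 1) ∧ a - 2 ≤ x ∧ x ≤ a + w + 1) ∨
    (x = x₀ ∧ y = b - 1) ∨ (x, y) ∈ P := Iff.rfl

theorem mem_prepSet {P : Set Cell} {a b w h x₀ z x y : ℤ} : (x, y) ∈ prepSet P a b w h x₀ z ↔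
    (x = a - 2 ∧ b - 3 ≤ y ∧ y ≤ b + h + 1) ∨
    (x = a + w + 1 ∧ b - 2 ≤ y ∧ y ≤ b + h + 1) ∨
    (y = b + h + 1 ∧ a - 2 ≤ x ∧ x ≤ a + w + 1) ∨
    (y = b - 2 ∧ z ≤ x ∧ x ≤ a + w + 1) ∨
    (y = b - 3 ∧ a - 2 ≤ x ∧ x < z) ∨
    (y = b - 1 ∧ (a - 1 ≤ x ∧ x < z ∨ x = x₀)) ∨ (x, y) ∈ P := Iff.rfl

theorem conn_startSet {P : Set Cell} {a b w h x₀ : ℤ} (hPc : Conn P) (hh : 1 ≤ h)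
    (hx₀ : (x₀, b) ∈ P) (hP : InBox P a b w h) : Conn (startSet P a b w h x₀) := by
  have hx₀' := hP _ _ hx₀
  have hs : ∀ x, a - 2 ≤ x → x ≤ a + w + 1 →
      Link (startSet P a b w h x₀) (x, b - 2) (a - 2, b - 2) := fun x h1 h2 =>
    (Link.hor h1 fun z _ _ => by rw [mem_startSet]; grind).symm
  have hw' : ∀ y, b - 2 ≤ y → y ≤ b + h + 1 →
      Link (startSet P a b w h x₀) (a - 2, y) (a - 2, b - 2) := fun y h1 h2 =>
    (Link.ver h1 fun z _ _ => by rw [mem_startSet]; grind).symm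
  have hj : Link (startSet P a b w h x₀) (x₀, b - 1) (a - 2, b - 2) :=
    (Link.ver (y := b - 2) (by omega) fun z _ _ => by rw [mem_startSet]; grind).symm.trans
      (hs x₀ (by omega) (by omega))
  refine Conn.of_hub (z := (a - 2, b - 2)) (by rw [mem_startSet]; grind) ?_
  rintro ⟨x, y⟩ hq
  rw [mem_startSet] at hq
  rcases hq with ⟨rfl | rfl, h1, h2⟩ | ⟨rfl | rfl, h1, h2⟩ | ⟨rfl, rfl⟩ | hq
  · exact hw' y h1 h2
  · refine (Link.ver h1 fun z _ _ => ?_).symm.trans (hs _ (by omega) le_rfl)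
    rw [mem_startSet]; grind
  · exact hs x h1 h2
  · refine (Link.hor h1 fun z _ _ => ?_).symm.trans (hw' _ (by omega) le_rfl)
    rw [mem_startSet]; grind
  · exact hj
  · have h1 : Link (startSet P a b w h x₀) (x, y) (x₀, b) :=
      (hPc.2 _ hq _ hx₀).mono fun q hq => .inr (.inr (.inr hq))
    refine h1.trans (Link.trans (Link.ver (y := b - 1) (by omega) fun z _ _ => ?_).symm hj)
    rw [mem_startSet]; grind

/-- Move the south side of the frame and fill the row below the polyomino. -/
def prep : Prog :=
  .whl true (go .west) ;; go .east ;; go .south ;; put .north ;; go .east ;; go .east ;;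
    .whl true (go .west ;; go .north ;; put .south ;; go .south ;; put .north ;; del .east ;;
      go .east) ;;
    go .west ;; go .south ;; put .west ;; .whl true (go .west) ;; go .east ;; home

namespace Exec

variable {P : Set Cell} {a b w h x₀ z : ℤ}

/-- In each column the new tiles above and below are placed before the old one between them goes.
The upper one hangs on the west side by the bar, the lower one by the new south side; the rest of
the old south side hangs on the east side. -/
theorem prep_del (hP : InBox P a b w h) (hw : 1 ≤ w) (hh : 1 ≤ h) (hx : a ≤ x₀)
    (hx' : x₀ ≤ a + w - 1) (hz : a - 1 ≤ z) (hz' : z ≤ a + w) :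
    Exec (del .east) (insert (z, b - 3) (insert (z, b - 1) (prepSet P a b w h x₀ z))) (z, b - 2)
      (prepSet P a b w h x₀ (z + 1)) (z + 1, b - 2) 1 := by
  unfold InBox at hP
  have hm : ∀ x y, (x, y) ∈ (insert (z, b - 3) (insert (z, b - 1) (prepSet P a b w h x₀ z))) \
      {(z, b - 2)} ↔ (x, y) ≠ (z, b - 2) ∧ ((x, y) = (z, b - 3) ∨ (x, y) = (z, b - 1) ∨
        (x, y) ∈ prepSet P a b w h x₀ z) := by
    intro x y; simp [and_comm]
  simp only [ne_eq, Prod.mk.injEq, mem_prepSet] at hm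
  refine del_eq .east (by simp [Dir.vec]) (by simp [Dir.vec]) (fun hc => ?_) ?_ ?_
  · refine hc.erase (z := (a - 2, b + h + 1)) ?_ ?_
    · rw [hm]; grind
    · intro d hd
      cases d <;> simp only [Dir.vec, Prod.mk_add_mk, add_zero] at hd ⊢
      · rw [show b - 2 + 1 = b - 1 by ring]
        refine (Link.hor (x := a - 2) (by omega) ?_).symm.trans (Link.ver (by omega) ?_)
        · intro z _ _; rw [hm]; grind
        · intro z _ _; rw [hm]; grind
      · refine (Link.hor (x' := a + w + 1) (by omega) ?_).trans ((Link.ver (y' := b + h + 1)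
          (by omega) ?_).trans (Link.hor (x := a - 2) (by omega) ?_).symm)
        · intro z _ _; rw [hm]; grind
        · intro z _ _; rw [hm]; grind
        · intro z _ _; rw [hm]; grind
      · rw [show b - 2 + -1 = b - 3 by ring]
        refine (Link.hor (x := a - 2) (by omega) ?_).symm.trans (Link.ver (by omega) ?_)
        · intro z _ _; rw [hm]; grind
        · intro z _ _; rw [hm]; grind
      · by_cases hza : z = a - 1
        · rw [show z + -1 = a - 2 by omega]
          refine Link.ver (by omega) ?_
          intro z _ _; rw [hm]; grind
        · exfalso
          simp only [Set.mem_insert_iff, Prod.mk.injEq, mem_prepSet] at hd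
          grind
  · simp only [Set.mem_insert_iff, Prod.mk.injEq, mem_prepSet]; grind
  · ext ⟨x, y⟩
    rw [hm]
    simp only [mem_prepSet]
    have := hP x y
    grind

theorem prep_loop (hP : InBox P a b w h) (hw : 1 ≤ w) (hh : 1 ≤ h) (hx : a ≤ x₀)
    (hx' : x₀ ≤ a + w - 1) (n : ℕ) (hz : a - 1 ≤ z) (hz' : z + n = a + w + 1) :
    Exec (.whl true (go .west ;; go .north ;; put .south ;; go .south ;; put .north ;; del .east ;;
      go .east)) (prepSet P a b w h x₀ z) (z + 1, b - 2) (prepSet P a b w h x₀ (a + w + 1))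
      (a + w + 2, b - 2) (8 * n + 1) := by
  have hP' := hP
  unfold InBox at hP'
  induction n generalizing z with
  | zero =>
    obtain rfl : z = a + w + 1 := by simpa using hz'
    rw [show a + w + 1 + 1 = a + w + 2 by ring]
    refine (whl_done ?_).mono (by simp)
    rw [mem_prepSet]; grind
  | succ n ih =>
    push_cast at hz'
    have h1 := ih (z := z + 1) (by omega) (by omega)
    refine (whl_step ?_ ((go_west (x' := z) (by ring) ?_).seq ((go_north (y' := b - 1) (by ring)
      ?_).seq ((put_insert (x' := z) (y' := b - 2) .south (by simp [Dir.vec])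
      (by simp [Dir.vec]; ring)).seq ((go_south (y' := b - 3) (by ring) ?_).seq
      ((put_insert (x' := z) (y' := b - 2) .north (by simp [Dir.vec]) (by simp [Dir.vec]; ring)).seq
      ((prep_del hP hw hh hx hx' hz (by omega)).seq (go_east (x' := z + 1 + 1) (by ring) ?_)))))))
      h1).mono ?_
    · rw [mem_prepSet]; grind
    · rw [mem_prepSet]; grind
    · rw [mem_prepSet]; grind
    · rw [Set.mem_insert_iff, mem_prepSet]; grind
    · rw [mem_prepSet]; grind
    · push_cast; linarith

theorem prep {c : ℤ} (hP : InBox P a b w h) (hw : 1 ≤ w) (hh : 1 ≤ h) (hx : a ≤ x₀)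
    (hx' : x₀ ≤ a + w - 1) :
    Exec prep (startSet P a b w h x₀) (x₀, b - 2)
      (world a b (b + h + 1) (field P a b w h (a + w + 1) b) (dest P a b w c (a + w + 1) b))
      (a - 1, b - 1) (30 * (w + h)) := by
  have hP' := hP
  unfold InBox at hP'
  have hdest : dest P a b w c (a + w + 1) b = ∅ := by
    refine Set.eq_empty_of_forall_notMem fun q ⟨s, h1, h2, h3, h4, _⟩ => ?_
    omega
  rw [hdest]
  -- The columns from `a - 1` to `a + w`, both margins included.
  have hloop := prep_loop hP hw hh hx hx' (z := a - 1) (w + 2).toNat le_rfl (by omega)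
  rw [sub_add_cancel] at hloop
  have hhome := home (D := ∅) (X := a + w + 1) (Y := b) (H := b + h + 1) (y := b - 3) hP
    (fun _ _ h => h.elim) hw (by omega) le_rfl (by omega) le_rfl le_rfl (by omega)
  refine ((tiles_west (x' := a - 3) (by omega) ?_ ?_).seq ((east_att (x' := a - 2) (by ring)
    (.inl ?_)).seq ((go_south (y' := b - 3) (by ring) ?_).seq ((put_eq (x' := a - 2) (y' := b - 2)
    (S' := prepSet P a b w h x₀ (a - 1)) .north (by simp [Dir.vec]) (by simp [Dir.vec]; ring)
    ?_).seq ((go_east (x' := a - 1) (by ring) ?_).seq ((go_east (x' := a) (by ring) ?_).seq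
    (hloop.seq ((west_att (x' := a + w + 1) (by ring) (.inl ?_)).seq ((go_south (y' := b - 3)
    (by ring) ?_).seq ((put_eq (x' := a + w) (y' := b - 3) (S' := world a b (b + h + 1)
    (field P a b w h (a + w + 1) b) ∅) .west (by simp [Dir.vec]) (by simp [Dir.vec]) ?_).seq
    ((tiles_west (x' := a - 3) (by omega) ?_ ?_).seq
    ((east_att (x' := a - 2) (by ring) (.inl ?_)).seq hhome)))))))))))).mono ?_
  · intro z _ _; rw [mem_startSet]; grind
  · rw [mem_startSet]; grind
  · rw [mem_startSet]; grind
  · rw [mem_startSet]; grind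
  · ext ⟨x, y⟩
    rw [Set.mem_insert_iff, mem_startSet, mem_prepSet, Prod.mk.injEq]
    have := hP x y
    grind
  · rw [mem_prepSet]; grind
  · rw [mem_prepSet]; grind
  · rw [mem_prepSet]; grind
  · rw [mem_prepSet]; grind
  · ext ⟨x, y⟩
    rw [Set.mem_insert_iff, mem_world, mem_field, mem_prepSet, Prod.mk.injEq]
    have := hP x y
    have : (x, y) ∉ (∅ : Set Cell) := id
    grind
  · intro z _ _; rw [mem_world, mem_field]; grind
  · have : (a - 3, b - 3) ∉ (∅ : Set Cell) := id
    rw [mem_world, mem_field]; grind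
  · rw [mem_world]; grind
  · have : ((w + 2).toNat : ℤ) = w + 2 := by omega
    rw [this]; linarith

end Exec

/-! ### Removing the frame -/

namespace Exec

variable {x x' y y' : ℤ}

theorem eat_east (S : ℤ → Set Cell) (hx : x ≤ x')
    (h : ∀ z, x ≤ z → z < x' → S (z + 1) = S z \ {(z, y)} ∧ (z, y) ∈ S z ∧ (z + 1, y) ∈ S z ∧
      (Conn (S z) → Conn (S z \ {(z, y)})))
    (h0 : (x', y) ∈ S x') (h1 : (x' + 1, y) ∉ S x') :
    Exec (RobotsOnTiles.eat .east) (S x) (x, y) (S x') (x' + 1, y) (4 * (x' - x) + 2) := by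
  obtain ⟨n, rfl⟩ : ∃ n : ℕ, x' = x + n := ⟨(x' - x).toNat, by omega⟩
  have h' := fun k : ℕ => h (x + k)
  have := eat (x := x) (y := y) .east n (fun k => S (x + k)) (fun k hk => by
    simpa [Dir.vec, ← add_assoc] using (h' k (by omega) (by omega)).1)
    (by simpa [Dir.vec] using h0) (by simpa [Dir.vec, ← add_assoc] using h1) (fun k hk => by
      obtain ⟨e1, e2, e3, e4⟩ := h' k (by omega) (by omega)
      refine ⟨by simpa [Dir.vec] using e2, by simpa [Dir.vec, ← add_assoc] using e3, ?_⟩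
      rw [← e1] at e4
      simpa [← add_assoc] using e4) rfl rfl
  simpa [Dir.vec, ← add_assoc] using this

theorem eat_west (S : ℤ → Set Cell) (hx : x' ≤ x)
    (h : ∀ z, x' < z → z ≤ x → S (z - 1) = S z \ {(z, y)} ∧ (z, y) ∈ S z ∧ (z - 1, y) ∈ S z ∧
      (Conn (S z) → Conn (S z \ {(z, y)})))
    (h0 : (x', y) ∈ S x') (h1 : (x' - 1, y) ∉ S x') :
    Exec (RobotsOnTiles.eat .west) (S x) (x, y) (S x') (x' - 1, y) (4 * (x - x') + 2) := by
  obtain ⟨n, rfl⟩ : ∃ n : ℕ, x = x' + n := ⟨(x - x').toNat, by omega⟩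
  have h' := fun k : ℕ => h (x' + n - k)
  have e : ∀ k : ℕ, x' + n - (k + 1 : ℕ) = x' + n - k - 1 := by intro k; push_cast; ring
  have e' : ∀ k : ℕ, x' + n + (k + 1) * (-1) = x' + n - k - 1 := by intro k; ring
  have e'' : ∀ k : ℕ, x' + n + k * (-1) = x' + n - k := by intro k; ring
  have := eat (x := x' + n) (y := y) (x' := x' - 1) (y' := y) .west n (fun k => S (x' + n - k))
    (fun k hk => by
      simp only [Dir.vec, mul_zero, add_zero, e, e'']
      exact (h' k (by omega) (by omega)).1)
    (by simpa [Dir.vec] using h0) (by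
      simp only [Dir.vec, mul_zero, add_zero, e', add_sub_cancel_right]; exact h1) (fun k hk => by
      obtain ⟨e1, e2, e3, e4⟩ := h' k (by omega) (by omega)
      rw [← e1] at e4
      simp only [Dir.vec, mul_zero, add_zero, e, e', e'']
      exact ⟨e2, e3, e4⟩) (by simp only [Dir.vec]; ring) (by simp [Dir.vec])
  simpa using this

theorem eat_north (S : ℤ → Set Cell) (hy : y ≤ y')
    (h : ∀ z, y ≤ z → z < y' → S (z + 1) = S z \ {(x, z)} ∧ (x, z) ∈ S z ∧ (x, z + 1) ∈ S z ∧
      (Conn (S z) → Conn (S z \ {(x, z)})))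
    (h0 : (x, y') ∈ S y') (h1 : (x, y' + 1) ∉ S y') :
    Exec (RobotsOnTiles.eat .north) (S y) (x, y) (S y') (x, y' + 1) (4 * (y' - y) + 2) := by
  obtain ⟨n, rfl⟩ : ∃ n : ℕ, y' = y + n := ⟨(y' - y).toNat, by omega⟩
  have h' := fun k : ℕ => h (y + k)
  have := eat (x := x) (y := y) .north n (fun k => S (y + k)) (fun k hk => by
    simpa [Dir.vec, ← add_assoc] using (h' k (by omega) (by omega)).1)
    (by simpa [Dir.vec] using h0) (by simpa [Dir.vec, ← add_assoc] using h1) (fun k hk => by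
      obtain ⟨e1, e2, e3, e4⟩ := h' k (by omega) (by omega)
      refine ⟨by simpa [Dir.vec] using e2, by simpa [Dir.vec, ← add_assoc] using e3, ?_⟩
      rw [← e1] at e4
      simpa [← add_assoc] using e4) rfl rfl
  simpa [Dir.vec, ← add_assoc] using this

theorem eat_south (S : ℤ → Set Cell) (hy : y' ≤ y)
    (h : ∀ z, y' < z → z ≤ y → S (z - 1) = S z \ {(x, z)} ∧ (x, z) ∈ S z ∧ (x, z - 1) ∈ S z ∧
      (Conn (S z) → Conn (S z \ {(x, z)})))
    (h0 : (x, y') ∈ S y') (h1 : (x, y' - 1) ∉ S y') :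
    Exec (RobotsOnTiles.eat .south) (S y) (x, y) (S y') (x, y' - 1) (4 * (y - y') + 2) := by
  obtain ⟨n, rfl⟩ : ∃ n : ℕ, y = y' + n := ⟨(y - y').toNat, by omega⟩
  have h' := fun k : ℕ => h (y' + n - k)
  have e : ∀ k : ℕ, y' + n - (k + 1 : ℕ) = y' + n - k - 1 := by intro k; push_cast; ring
  have e' : ∀ k : ℕ, y' + n + (k + 1) * (-1) = y' + n - k - 1 := by intro k; ring
  have e'' : ∀ k : ℕ, y' + n + k * (-1) = y' + n - k := by intro k; ring
  have := eat (x := x) (y := y' + n) (x' := x) (y' := y' - 1) .south n (fun k => S (y' + n - k))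
    (fun k hk => by
      simp only [Dir.vec, mul_zero, add_zero, e, e'']
      exact (h' k (by omega) (by omega)).1)
    (by simpa [Dir.vec] using h0) (by
      simp only [Dir.vec, mul_zero, add_zero, e', add_sub_cancel_right]; exact h1) (fun k hk => by
      obtain ⟨e1, e2, e3, e4⟩ := h' k (by omega) (by omega)
      rw [← e1] at e4
      simp only [Dir.vec, mul_zero, add_zero, e, e', e'']
      exact ⟨e2, e3, e4⟩) (by simp [Dir.vec]) (by simp only [Dir.vec]; ring)
  simpa using this

end Exec

/-- What remains of the frame and the row of tiles inside: the tiles of this row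
from column `p` on, of the north side from column `n` on, of the east side up to row `e`,
and of the south side up to column `s`. -/
def frameSet (a b w h p n e s : ℤ) : Set Cell :=
  {q | (q.2 = b + h - 1 ∧ p ≤ q.1 ∧ q.1 ≤ a + w) ∨ (q.2 = b + h + 1 ∧ n ≤ q.1 ∧ q.1 ≤ a + w + 1) ∨
    (q.1 = a + w + 1 ∧ b - 3 ≤ q.2 ∧ q.2 ≤ e) ∨ (q.2 = b - 3 ∧ a - 2 < q.1 ∧ q.1 ≤ s)}

theorem mem_frameSet {a b w h p n e s x y : ℤ} : (x, y) ∈ frameSet a b w h p n e s ↔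
    (y = b + h - 1 ∧ p ≤ x ∧ x ≤ a + w) ∨ (y = b + h + 1 ∧ n ≤ x ∧ x ≤ a + w + 1) ∨
    (x = a + w + 1 ∧ b - 3 ≤ y ∧ y ≤ e) ∨ (y = b - 3 ∧ a - 2 < x ∧ x ≤ s) := Iff.rfl

/-- Remove the frame except for its west side. -/
def removeFrame : Prog :=
  go .south ;; go .south ;; eat .east ;; go .west ;; .whl true (go .north) ;; go .south ;;
    go .west ;; go .south ;; .whl false (go .west) ;; go .east ;; go .north ;; eat .east ;;
    go .west ;; eat .south ;; go .north ;; eat .west ;; go .east ;; go .north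

namespace Exec

variable {P D : Set Cell} {a b w h H : ℤ}

/-- The tile that `eat` leaves over is the one where the bar meets the east side, so the bar
vanishes and the frame stays whole. -/
theorem eat_bar (hD : IsLeft D a b) (hw : 1 ≤ w) (hh : 1 ≤ h) (hH : b + h + 1 ≤ H) :
    Exec (RobotsOnTiles.eat .east)
      (world a b H (frameSet a b w h (a - 1) (a - 1) (b + h + 1) (a + w + 1)) D)
      (a - 1, b + h - 1)
      (world a b H (frameSet a b w h (a + w + 1) (a - 1) (b + h + 1) (a + w + 1)) D)
      (a + w + 2, b + h - 1) (4 * (w + 2) + 2) := by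
  unfold IsLeft at hD
  refine (eat_east (fun z => world a b H (frameSet a b w h z (a - 1) (b + h + 1) (a + w + 1)) D)
    (x := a - 1) (x' := a + w + 1) (y := b + h - 1) (by omega) (fun z h1 h2 => ⟨?_, ?_, ?_, ?_⟩)
    ?_ ?_).congr rfl (by ext <;> simp; ring) (by linarith)
  · ext ⟨x, y⟩
    simp only [Set.mem_sdiff, Set.mem_singleton_iff, mem_world, mem_frameSet, Prod.mk.injEq]
    have := hD x y
    grind
  · rw [mem_world, mem_frameSet]; grind
  · rw [mem_world, mem_frameSet]; grind
  · intro hc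
    refine hc.erase (z := (a - 2, b + h + 1)) ?_ ?_
    · simp only [Set.mem_sdiff, Set.mem_singleton_iff, mem_world, mem_frameSet, Prod.mk.injEq]; grind
    intro d hd
    have hm : ∀ x y, (x, y) ∈ world a b H (frameSet a b w h z (a - 1) (b + h + 1) (a + w + 1)) D \
        {(z, b + h - 1)} ↔ _ ∧ _ := fun x y => Iff.rfl
    simp only [Set.mem_singleton_iff, mem_world, mem_frameSet, Prod.mk.injEq] at hm
    cases d <;> simp only [Dir.vec, Prod.mk_add_mk, add_zero, mem_world, mem_frameSet] at hd ⊢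
    · exfalso; grind
    · refine (Link.hor (x' := a + w + 1) (by omega) ?_).trans
        ((Link.ver (y' := b + h + 1) (by omega) ?_).trans (Link.hor (x := a - 2) (by omega) ?_).symm)
      · intro z _ _; rw [hm]; grind
      · intro z _ _; rw [hm]; grind
      · intro z _ _; rw [hm]; grind
    · exfalso; grind
    · by_cases hz : z = a - 1
      · rw [show z + -1 = a - 2 by omega]
        refine Link.ver (by omega) ?_
        intro z _ _; rw [hm]; grind
      · exfalso; grind
  · rw [mem_world, mem_frameSet]; grind
  · rw [mem_world, mem_frameSet]; grind

/-- As the north side is being opened, its rest is now joined to the spine around the south; hence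
the target is the south-west corner. -/
theorem eat_northSide (hD : IsLeft D a b) (hw : 1 ≤ w) (hh : 1 ≤ h) (hH : b + h + 1 ≤ H) :
    Exec (RobotsOnTiles.eat .east)
      (world a b H (frameSet a b w h (a + w + 1) (a - 1) (b + h + 1) (a + w + 1)) D)
      (a - 1, b + h + 1)
      (world a b H (frameSet a b w h (a + w + 1) (a + w + 1) (b + h + 1) (a + w + 1)) D)
      (a + w + 2, b + h + 1) (4 * (w + 2) + 2) := by
  unfold IsLeft at hD
  refine (eat_east (fun z => world a b H (frameSet a b w h (a + w + 1) z (b + h + 1) (a + w + 1)) D)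
    (x := a - 1) (x' := a + w + 1) (y := b + h + 1) (by omega) (fun z h1 h2 => ⟨?_, ?_, ?_, ?_⟩)
    ?_ ?_).congr rfl (by ext <;> simp; ring) (by linarith)
  · ext ⟨x, y⟩
    simp only [Set.mem_sdiff, Set.mem_singleton_iff, mem_world, mem_frameSet, Prod.mk.injEq]
    have := hD x y
    grind
  · rw [mem_world, mem_frameSet]; grind
  · rw [mem_world, mem_frameSet]; grind
  · intro hc
    refine hc.erase (z := (a - 2, b - 3)) ?_ ?_
    · simp only [Set.mem_sdiff, Set.mem_singleton_iff, mem_world, mem_frameSet, Prod.mk.injEq]; grind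
    intro d hd
    have hm : ∀ x y, (x, y) ∈ world a b H (frameSet a b w h (a + w + 1) z (b + h + 1) (a + w + 1)) D \
        {(z, b + h + 1)} ↔ _ ∧ _ := fun x y => Iff.rfl
    simp only [Set.mem_singleton_iff, mem_world, mem_frameSet, Prod.mk.injEq] at hm
    cases d <;> simp only [Dir.vec, Prod.mk_add_mk, add_zero, mem_world, mem_frameSet] at hd ⊢
    · exfalso; grind
    · refine (Link.hor (x' := a + w + 1) (by omega) ?_).trans
        ((Link.ver (y := b - 3) (by omega) ?_).symm.trans (Link.hor (x := a - 2) (by omega) ?_).symm)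
      · intro z _ _; rw [hm]; grind
      · intro z _ _; rw [hm]; grind
      · intro z _ _; rw [hm]; grind
    · exfalso; grind
    · by_cases hz : z = a - 1
      · rw [show z + -1 = a - 2 by omega]
        refine (Link.ver (by omega) ?_).symm
        intro z _ _; rw [hm]; grind
      · exfalso; grind
  · rw [mem_world, mem_frameSet]; grind
  · rw [mem_world, mem_frameSet]; grind

theorem eat_eastSide (hD : IsLeft D a b) (hw : 1 ≤ w) (hh : 1 ≤ h) (hH : b + h + 1 ≤ H) :
    Exec (RobotsOnTiles.eat .south)
      (world a b H (frameSet a b w h (a + w + 1) (a + w + 2) (b + h + 1) (a + w + 1)) D)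
      (a + w + 1, b + h + 1)
      (world a b H (frameSet a b w h (a + w + 1) (a + w + 2) (b - 3) (a + w + 1)) D)
      (a + w + 1, b - 4) (4 * (h + 4) + 2) := by
  unfold IsLeft at hD
  refine (eat_south (fun z => world a b H (frameSet a b w h (a + w + 1) (a + w + 2) z (a + w + 1)) D)
    (y := b + h + 1) (y' := b - 3) (x := a + w + 1) (by omega) (fun z h1 h2 => ⟨?_, ?_, ?_, ?_⟩)
    ?_ ?_).congr rfl (by ext <;> simp; ring) (by linarith)
  · ext ⟨x, y⟩
    simp only [Set.mem_sdiff, Set.mem_singleton_iff, mem_world, mem_frameSet, Prod.mk.injEq]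
    have := hD x y
    grind
  · rw [mem_world, mem_frameSet]; grind
  · rw [mem_world, mem_frameSet]; grind
  · intro hc
    refine hc.erase (z := (a - 2, b - 3)) ?_ ?_
    · simp only [Set.mem_sdiff, Set.mem_singleton_iff, mem_world, mem_frameSet, Prod.mk.injEq]; grind
    intro d hd
    have hm : ∀ x y, (x, y) ∈ world a b H (frameSet a b w h (a + w + 1) (a + w + 2) z (a + w + 1)) D \
        {(a + w + 1, z)} ↔ _ ∧ _ := fun x y => Iff.rfl
    simp only [Set.mem_singleton_iff, mem_world, mem_frameSet, Prod.mk.injEq] at hm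
    cases d <;> simp only [Dir.vec, Prod.mk_add_mk, add_zero, mem_world, mem_frameSet] at hd ⊢
    · exfalso; grind
    · exfalso; grind
    · refine (Link.ver (y := b - 3) (by omega) ?_).symm.trans (Link.hor (x := a - 2) (by omega) ?_).symm
      · intro z _ _; rw [hm]; grind
      · intro z _ _; rw [hm]; grind
    · exfalso; grind
  · rw [mem_world, mem_frameSet]; grind
  · rw [mem_world, mem_frameSet]; grind

/-- The tile left over is the foot of the spine. The copy begins one row higher, so the vertex west
of the foot is empty and `eat` stops there. -/
theorem eat_southSide (hD : IsLeft D a b) (hw : 1 ≤ w) (hh : 1 ≤ h) (hH : b + h + 1 ≤ H) :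
    Exec (RobotsOnTiles.eat .west)
      (world a b H (frameSet a b w h (a + w + 1) (a + w + 2) (b - 4) (a + w + 1)) D)
      (a + w + 1, b - 3) (world a b H ∅ D) (a - 3, b - 3) (4 * (w + 3) + 2) := by
  unfold IsLeft at hD
  refine (eat_west (fun z => world a b H (frameSet a b w h (a + w + 1) (a + w + 2) (b - 4) z) D)
    (x := a + w + 1) (x' := a - 2) (y := b - 3) (by omega) (fun z h1 h2 => ⟨?_, ?_, ?_, ?_⟩)
    ?_ ?_).congr ?_ (by ext <;> simp; ring) (by linarith)
  · ext ⟨x, y⟩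
    simp only [Set.mem_sdiff, Set.mem_singleton_iff, mem_world, mem_frameSet, Prod.mk.injEq]
    have := hD x y
    grind
  · rw [mem_world, mem_frameSet]; grind
  · rw [mem_world, mem_frameSet]; grind
  · intro hc
    refine hc.erase (z := (a - 2, b - 3)) ?_ ?_
    · simp only [Set.mem_sdiff, Set.mem_singleton_iff, mem_world, mem_frameSet, Prod.mk.injEq]; grind
    intro d hd
    have hm : ∀ x y, (x, y) ∈ world a b H (frameSet a b w h (a + w + 1) (a + w + 2) (b - 4) z) D \
        {(z, b - 3)} ↔ _ ∧ _ := fun x y => Iff.rfl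
    simp only [Set.mem_singleton_iff, mem_world, mem_frameSet, Prod.mk.injEq] at hm
    cases d <;> simp only [Dir.vec, Prod.mk_add_mk, add_zero, mem_world, mem_frameSet] at hd ⊢
    · exfalso; grind
    · exfalso; grind
    · exfalso; grind
    · refine (Link.hor (x := a - 2) (by omega) ?_).symm
      intro z _ _; rw [hm]; grind
  · rw [mem_world, mem_frameSet]; grind
  · rw [mem_world, mem_frameSet]; grind
  · congr 1
    refine Set.eq_empty_of_forall_notMem ?_
    rintro ⟨x, y⟩ hq
    rw [mem_frameSet] at hq
    omega

theorem removeFrame (hP : InBox P a b w h) (hD : IsLeft D a b) (hw : 1 ≤ w) (hh : 1 ≤ h)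
    (hH : b + h + 1 ≤ H) :
    Exec removeFrame (world a b H (field P a b w h (a + w + 1) (b + h)) D) (a - 1, b + h + 1)
      (world a b H ∅ D) (a - 2, b - 2) (60 * (w + h)) := by
  have h1 := eat_bar hD hw hh hH
  have h2 := eat_northSide hD hw hh hH
  have h3 := eat_eastSide hD hw hh hH
  have h4 := eat_southSide hD hw hh hH
  have e1 : field P a b w h (a + w + 1) (b + h) =
      frameSet a b w h (a - 1) (a - 1) (b + h + 1) (a + w + 1) := by
    ext ⟨x, y⟩
    rw [mem_field, mem_frameSet]
    have := hP x y
    grind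
  -- A corner lies on two sides; from now on it is counted with the side that is removed next.
  have e2 : frameSet a b w h (a + w + 1) (a + w + 1) (b + h + 1) (a + w + 1) =
      frameSet a b w h (a + w + 1) (a + w + 2) (b + h + 1) (a + w + 1) := by
    ext ⟨x, y⟩
    rw [mem_frameSet, mem_frameSet]; grind
  have e3 : frameSet a b w h (a + w + 1) (a + w + 2) (b - 3) (a + w + 1) =
      frameSet a b w h (a + w + 1) (a + w + 2) (b - 4) (a + w + 1) := by
    ext ⟨x, y⟩
    rw [mem_frameSet, mem_frameSet]; grind
  rw [e2] at h2
  rw [e3] at h3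
  rw [e1]
  unfold IsLeft at hD
  refine ((go_south (y' := b + h) (by ring) ?_).seq ((south_att (y' := b + h - 1) (by ring) (.inl ?_)).seq
    (h1.seq ((west_att (x' := a + w + 1) (by ring) (.inl ?_)).seq ((tiles_north (y' := b + h + 2)
    (by omega) ?_ ?_).seq ((south_att (y' := b + h + 1) (by ring) (.inl ?_)).seq
    ((go_west (x' := a + w) (by ring) ?_).seq ((go_south (y' := b + h) (by ring) ?_).seq
    ((empty_west (x' := a - 2) (by omega) ?_ ?_ ?_).seq ((go_east (x' := a - 1) (by ring) ?_).seq
    ((north_att (y' := b + h + 1) (by ring) (.inl ?_)).seq (h2.seq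
    ((west_att (x' := a + w + 1) (by ring) (.inl ?_)).seq (h3.seq
    ((north_att (y' := b - 3) (by ring) (.inl ?_)).seq (h4.seq
    ((east_att (x' := a - 2) (by ring) (.inl ?_)).seq
    (go_north (by ring) ?_)))))))))))))))))).mono ?_
  · rw [mem_world, mem_frameSet]; grind
  · rw [mem_world, mem_frameSet]; grind
  · rw [mem_world, mem_frameSet]; grind
  · intro z _ _; rw [mem_world, mem_frameSet]; grind
  · rw [mem_world, mem_frameSet]; grind
  · rw [mem_world, mem_frameSet]; grind
  · rw [mem_world, mem_frameSet]; grind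
  · rw [mem_world, mem_frameSet]; grind
  · intro z _ _; rw [mem_world, mem_frameSet]; grind
  · intro z _ _; refine .north ?_; rw [mem_world, mem_frameSet]; grind
  · rw [mem_world]; grind
  · rw [mem_world]; grind
  · rw [mem_world, mem_frameSet]; grind
  · rw [mem_world, mem_frameSet]; grind
  · rw [mem_world, mem_frameSet]; grind
  · rw [mem_world]; grind
  · rw [mem_world]; grind
  · linarith

end Exec

/-! ### Carving the copy out -/

/-- The copy of `P`, scaled by `c`, to the left of the frame. -/
def copySet (P : Set Cell) (a b w c : ℤ) : Set Cell :=
  {q | ∃ s ∈ P, (colX a w c s.1 ≤ q.1 ∧ q.1 < colX a w c s.1 + c) ∧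
    rowY b c s.2 ≤ q.2 ∧ q.2 < rowY b c s.2 + c}

/-- The highest rows of the rows of squares from row `Y` on, in row `Y` only from column `X` on. -/
def teeth (a b w h c X Y : ℤ) : Set Cell :=
  {q | q.1 < a - 2 ∧ ∃ y, b ≤ y ∧ y < b + h ∧ q.2 = rowY b c y + c - 1 ∧
    (Y < y ∧ colX a w c a ≤ q.1 ∨ y = Y ∧ X ≤ q.1)}

section copySet

variable {P : Set Cell} {a b w h c X Y : ℤ}

theorem mem_teeth {p q : ℤ} : (p, q) ∈ teeth a b w h c X Y ↔
    p < a - 2 ∧ ∃ y, b ≤ y ∧ y < b + h ∧ q = rowY b c y + c - 1 ∧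
      (Y < y ∧ colX a w c a ≤ p ∨ y = Y ∧ X ≤ p) := Iff.rfl

theorem copySet_bounds (hP : InBox P a b w h) (hc : 0 ≤ c) {p q : ℤ}
    (hq : (p, q) ∈ copySet P a b w c) :
    (colX a w c a ≤ p ∧ p < a - 2) ∧ b - 2 ≤ q ∧ q < rowY b c (b + h) := by
  obtain ⟨⟨s1, s2⟩, hs, ⟨h1, h2⟩, h3, h4⟩ := hq
  simp only at h1 h2 h3 h4
  have hb := hP _ _ hs
  have e1 := colX_mono (a := a) (w := w) hc (show a ≤ s1 by omega)
  have e2 := colX_add_le (a := a) (w := w) hc (show s1 < a + w by omega)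
  have e3 := rowY_mono (b := b) hc (show b ≤ s2 by omega)
  have e4 := rowY_add_le (b := b) hc (show s2 < b + h by omega)
  rw [colX_end] at e2
  rw [rowY_start] at e3
  omega

theorem rowY_injective (hc : 0 < c) {y y' : ℤ} (h : rowY b c y = rowY b c y') : y = y' := by
  rcases lt_trichotomy y y' with h' | h' | h'
  · have := rowY_add_le (b := b) hc.le h'; omega
  · exact h'
  · have := rowY_add_le (b := b) hc.le h'; omega

/-- For `2 ≤ c` both vertices lie in the same square. Together with `notMem_teeth_below` this lets
the robot recognise a full square by looking just below the tooth. -/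
theorem mem_copySet_below (hc : 2 ≤ c) {p : ℤ} :
    (p, rowY b c Y + c - 2) ∈ copySet P a b w c ↔ (p, rowY b c Y + c - 1) ∈ copySet P a b w c := by
  constructor
  all_goals
    rintro ⟨s, hs, h1, h2, h3⟩
    refine ⟨s, hs, h1, ?_⟩
    simp only at h2 h3 ⊢
    rcases lt_trichotomy s.2 Y with h' | h' | h'
    · have := rowY_add_le (b := b) (c := c) (by omega) h'; omega
    · rw [h'] at h2 h3 ⊢; omega
    · have := rowY_add_le (b := b) (c := c) (by omega) h'; omega

theorem notMem_teeth_below (hc : 2 ≤ c) {p : ℤ} :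
    (p, rowY b c Y + c - 2) ∉ teeth a b w h c X Y := by
  rintro ⟨_, y, _, _, h1, h2⟩
  simp only at h1
  rcases h2 with h2 | h2
  · have := rowY_add_le (b := b) (c := c) (by omega) h2.1; omega
  · rw [h2.1] at h1; omega

theorem dest_eq (hP : InBox P a b w h) (hc : 0 < c) (hw : 0 ≤ w) :
    dest P a b w c (a + w + 1) (b + h) = copySet P a b w c ∪ teeth a b w h c (colX a w c a) b := by
  ext ⟨p, q⟩
  constructor
  · intro hq
    have h0 := (dest_left hc.le hq).1
    obtain ⟨s, h1, h2, h3, h4, h5, h6, h7, h8, h9⟩ := hq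
    rcases h9 with h9 | h9
    · exact .inl ⟨s, h9, ⟨h5, h6⟩, h7, h8⟩
    · have := colX_mono (a := a) (w := w) hc.le h1
      refine .inr ⟨h0, s.2, h3, by omega, h9, ?_⟩
      simp only at h5 ⊢
      omega
  · rintro (⟨s, hs, ⟨h1, h2⟩, h3, h4⟩ | ⟨h1, y, h2, h3, rfl, h4⟩)
    · have := hP _ _ hs
      exact ⟨s, by omega, by omega, by omega, .inl (by omega), h1, h2, h3, h4, .inl hs⟩
    · simp only at h1 h4
      exact (mem_dest_tooth hc (by omega) y p).2 (by omega)

theorem teeth_next :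
    teeth a b w h c (a - 2) Y = teeth a b w h c (colX a w c a) (Y + 1) := by
  ext ⟨p, q⟩
  rw [mem_teeth, mem_teeth]
  refine and_congr_right fun hp => exists_congr fun y => ?_
  omega

/-- Every tile is joined to the lower left corner of its square, and the corners for adjacent
vertices are joined along an edge; so walks in `P` lift to the copy. -/
theorem conn_copySet (hP : Conn P) (hc : 0 < c) : Conn (copySet P a b w c) := by
  have hm : ∀ s ∈ P, ∀ p q, colX a w c s.1 ≤ p → p < colX a w c s.1 + c → rowY b c s.2 ≤ q →
      q < rowY b c s.2 + c → (p, q) ∈ copySet P a b w c :=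
    fun s hs p q h1 h2 h3 h4 => ⟨s, hs, ⟨h1, h2⟩, h3, h4⟩
  have hstep : ∀ s ∈ P, ∀ d : Dir, s + d.vec ∈ P → Link (copySet P a b w c)
      (colX a w c s.1, rowY b c s.2) (colX a w c (s + d.vec).1, rowY b c (s + d.vec).2) := by
    have hor : ∀ x y, (x, y) ∈ P → (x + 1, y) ∈ P → Link (copySet P a b w c)
        (colX a w c x, rowY b c y) (colX a w c (x + 1), rowY b c y) := by
      intro x y h h'
      have e := colX_add_one a w c x
      refine Link.hor (by omega) fun z h1 h2 => ?_
      rcases h2.lt_or_eq with h2 | h2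
      · exact hm _ h _ _ h1 (by simp only; omega) (by simp) (by simp only; omega)
      · exact hm _ h' _ _ h2.ge (by simp only; omega) (by simp) (by simp only; omega)
    have ver : ∀ x y, (x, y) ∈ P → (x, y + 1) ∈ P → Link (copySet P a b w c)
        (colX a w c x, rowY b c y) (colX a w c x, rowY b c (y + 1)) := by
      intro x y h h'
      have e := rowY_add_one b c y
      refine Link.ver (by omega) fun z h1 h2 => ?_
      rcases h2.lt_or_eq with h2 | h2
      · exact hm _ h _ _ (by simp) (by simp only; omega) h1 (by simp only; omega)
      · exact hm _ h' _ _ (by simp) (by simp only; omega) h2.ge (by simp only; omega)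
    rintro ⟨x, y⟩ hs d hd
    cases d <;> simp only [Dir.vec, Prod.mk_add_mk, add_zero] at hd ⊢
    · exact ver x y hs hd
    · exact hor x y hs hd
    · have := ver x (y + -1) hd
      rw [neg_add_cancel_right] at this
      exact (this hs).symm
    · have := hor (x + -1) y hd
      rw [neg_add_cancel_right] at this
      exact (this hs).symm
  obtain ⟨s₀, hs₀⟩ := hP.1
  refine Conn.of_hub (z := (colX a w c s₀.1, rowY b c s₀.2))
    (hm _ hs₀ _ _ le_rfl (by omega) le_rfl (by omega)) ?_
  rintro ⟨p, q⟩ ⟨s, hs, ⟨h1, h2⟩, h3, h4⟩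
  simp only at h1 h2 h3 h4
  have k1 : Link (copySet P a b w c) (colX a w c s.1, q) (p, q) :=
    Link.hor h1 fun z h5 h6 => hm s hs _ _ h5 (by omega) h3 h4
  have k2 : Link (copySet P a b w c) (colX a w c s.1, rowY b c s.2) (colX a w c s.1, q) :=
    Link.ver h3 fun z h5 h6 => hm s hs _ _ le_rfl (by omega) h5 (by omega)
  refine (k2.trans k1).symm.trans ?_
  have := hP.2 _ hs _ hs₀
  clear k1 k2 h1 h2 h3 h4
  induction this using Relation.ReflTransGen.head_induction_on with
  | refl => exact .refl _
  | head h _ ih =>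
    obtain ⟨d, rfl⟩ := exists_dir_of_adj h.1
    exact (hstep _ h.2.1 d h.2.2).trans (ih h.2.2)

/-- The copy together with a part of the west side of the frame and the remaining teeth is
connected. -/
theorem conn_carved {H y₀ : ℤ} (hP : InBox P a b w h) (hF : Conn (copySet P a b w c)) (hc : 0 < c)
    (hy₀ : (a - 3, y₀) ∈ copySet P a b w c) (hH : rowY b c (b + h) ≤ H) :
    Conn (world a b H ∅ (copySet P a b w c ∪ teeth a b w h c X Y)) := by
  have h0 := (copySet_bounds hP hc.le hy₀).2
  have hs : ∀ y, b - 3 ≤ y → y ≤ H → Link (world a b H ∅ (copySet P a b w c ∪ teeth a b w h c X Y))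
      (a - 2, y) (a - 2, b - 3) := fun y h1 h2 =>
    (Link.ver h1 fun z _ _ => by rw [mem_world]; exact .inr (.inl ⟨rfl, by omega, by omega⟩)).symm
  refine Conn.of_hub (z := (a - 2, b - 3)) (by rw [mem_world]; exact .inr (.inl ⟨rfl, by omega⟩)) ?_
  rintro ⟨p, q⟩ hq
  rcases mem_world.1 hq with hq | ⟨rfl, h1, h2⟩ | hq | hq
  · exact hq.elim
  · exact hs _ h1 h2
  · refine ((hF.2 _ hq _ hy₀).mono fun z hz => .inr (.inl hz)).trans ?_
    refine Link.trans (Link.single ?_ ?_ ?_) (hs y₀ (by omega) (by omega))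
    · rw [adj_pair]; grind
    · exact .inr (.inl hy₀)
    · rw [mem_world]; exact .inr (.inl ⟨rfl, by omega⟩)
  · obtain ⟨h1, y, h2, h3, rfl, h4⟩ := hq
    simp only at h1 h4
    have e1 := rowY_mono (b := b) hc.le h2
    have e2 := rowY_add_le (b := b) hc.le h3
    rw [rowY_start] at e1
    refine (Link.hor (x' := a - 2) (by omega) fun z h5 h6 => ?_).trans (hs _ (by omega) (by omega))
    rw [mem_world]
    rcases h6.lt_or_eq with h6 | h6
    · exact .inr (.inr (.inr (mem_teeth.2 ⟨h6, y, h2, h3, rfl, by omega⟩)))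
    · exact .inr (.inl ⟨h6, by omega, by omega⟩)

end copySet

/-- Remove the tiles of one row, from the west to the east, that are not part of the copy. -/
def carveRow : Prog :=
  .whl true (go .south ;; .ite (go .north ;; go .east) (go .north ;; del .east))

/-- Remove the tiles to the west of the frame that are not part of the copy. -/
def carve (c : ℕ) : Prog :=
  rep (c - 1) (put .north) ;; put .west ;;
    .whl true (.whl true (go .west) ;; go .east ;; carveRow ;; go .west ;; rep c (put .north) ;;
      put .west)

namespace Exec

variable {P : Set Cell} {a b w h H : ℤ}

/-- Going from west to east, what is left of the tooth always reaches the spine, so `conn_carved`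
applies at any moment, whatever has been removed. The spine tile at the end has a tile below it and
is kept; the loop stops on the empty vertex behind it. -/
theorem carveRow {c y₀ Y : ℤ} (hP : InBox P a b w h) (hF : Conn (copySet P a b w c)) (hc : 2 ≤ c)
    (hw : 1 ≤ w) (hy₀ : (a - 3, y₀) ∈ copySet P a b w c) (hH : rowY b c (b + h) ≤ H)
    (hY : b ≤ Y) (hY' : Y < b + h) :
    Exec carveRow (world a b H ∅ (copySet P a b w c ∪ teeth a b w h c (colX a w c a) Y))
      (colX a w c a, rowY b c Y + c - 1)
      (world a b H ∅ (copySet P a b w c ∪ teeth a b w h c (a - 2) Y))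
      (a - 1, rowY b c Y + c - 1) (6 * (c * w) + 7) := by
  have e1 := rowY_mono (b := b) (c := c) (by omega) hY
  have e2 := rowY_add_le (b := b) (c := c) (by omega) hY'
  rw [rowY_start] at e1
  have e3 : colX a w c a = a - 2 - c * w := by unfold colX; ring
  have e4 : 0 ≤ c * w := mul_nonneg (by omega) (by omega)
  have e5 : rowY b c Y + c - 1 - 1 = rowY b c Y + c - 2 := by ring
  have hinj : ∀ y, rowY b c y = rowY b c Y → y = Y := fun y => rowY_injective (by omega)
  have key : ∀ (n : ℕ) (X : ℤ), X + n = a - 2 → colX a w c a ≤ X →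
      Exec RobotsOnTiles.carveRow
        (world a b H ∅ (copySet P a b w c ∪ teeth a b w h c X Y)) (X, rowY b c Y + c - 1)
        (world a b H ∅ (copySet P a b w c ∪ teeth a b w h c (a - 2) Y))
        (a - 1, rowY b c Y + c - 1) (6 * n + 7) := by
    intro n
    induction n with
    | zero =>
      intro X hn hX
      obtain rfl : X = a - 2 := by simpa using hn
      have hmem : ∀ y, b - 3 ≤ y → y ≤ H →
          (a - 2, y) ∈ world a b H ∅ (copySet P a b w c ∪ teeth a b w h c (a - 2) Y) :=
        fun y h1 h2 => mem_world.2 (.inr (.inl ⟨rfl, h1, h2⟩))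
      have h1 := hmem (rowY b c Y + c - 1) (by omega) (by omega)
      have h2 := hmem (rowY b c Y + c - 2) (by omega) (by omega)
      refine (whl_step (m := 5) (by simpa using h1) (((go_south (by ring) h1).seq
        (ite_true h2 ((north_att (by ring) (.inl h1)).seq
        (go_east (x' := a - 1) (by ring) h1)))).mono (by norm_num)) (whl_done ?_)).mono (by norm_num)
      rw [eq_self_iff_true, true_iff, mem_world]
      rintro (h1 | h1 | h1 | h1)
      · exact h1
      · omega
      · have := copySet_bounds hP (by omega) h1; omega
      · have := h1.1; simp only at this; omega
    | succ n ih =>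
      intro X hn hX
      push_cast at hn
      have hmem : (X, rowY b c Y + c - 1) ∈
          world a b H ∅ (copySet P a b w c ∪ teeth a b w h c X Y) :=
        .inr (.inr (mem_teeth.2 ⟨by omega, Y, hY, hY', rfl, .inr ⟨rfl, le_rfl⟩⟩))
      have hnext : (X + 1, rowY b c Y + c - 1) ∈
          world a b H ∅ (copySet P a b w c ∪ teeth a b w h c X Y) := by
        rw [mem_world]
        by_cases hX' : X + 1 = a - 2
        · exact .inr (.inl ⟨hX', by omega, by omega⟩)
        · exact .inr (.inr (.inr (mem_teeth.2 ⟨by omega, Y, hY, hY', rfl, .inr ⟨rfl, by omega⟩⟩)))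
      have hsouth : Exec (go .south) (world a b H ∅ (copySet P a b w c ∪ teeth a b w h c X Y))
          (X, rowY b c Y + c - 1) (world a b H ∅ (copySet P a b w c ∪ teeth a b w h c X Y))
          (X, rowY b c Y + c - 2) 1 := go_south (by ring) hmem
      have hbelow : (X, rowY b c Y + c - 2) ∈
          world a b H ∅ (copySet P a b w c ∪ teeth a b w h c X Y) ↔
          (X, rowY b c Y + c - 1) ∈ copySet P a b w c := by
        rw [mem_world, ← mem_copySet_below (by omega)]
        constructor
        · rintro (h1 | h1 | h1 | h1)
          · exact h1.elim
          · omega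
          · exact h1
          · exact (notMem_teeth_below (by omega) h1).elim
        · exact fun h1 => .inr (.inr (.inl h1))
      by_cases hfull : (X, rowY b c Y + c - 1) ∈ copySet P a b w c
      · have hS : copySet P a b w c ∪ teeth a b w h c X Y =
            copySet P a b w c ∪ teeth a b w h c (X + 1) Y := by
          ext ⟨p, q⟩
          simp only [Set.mem_union, mem_teeth]
          constructor
          · rintro (h1 | ⟨h1, y, h2, h3, rfl, h4⟩)
            · exact .inl h1
            · by_cases h5 : y = Y ∧ p = X
              · obtain ⟨rfl, rfl⟩ := h5
                exact .inl hfull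
              · exact .inr ⟨h1, y, h2, h3, rfl, by omega⟩
          · rintro (h1 | ⟨h1, y, h2, h3, h4, h5⟩)
            · exact .inl h1
            · exact .inr ⟨h1, y, h2, h3, h4, by omega⟩
        refine (whl_step (by simpa using hmem) (m := 4) ((hsouth.seq (ite_true (hbelow.2 hfull)
          ((north_att (by ring) (.inl hmem)).seq (go_east rfl hmem)))).mono (by norm_num))
          (hS ▸ ih (X + 1) (by omega) (by omega))).mono ?_
        push_cast; linarith
      · have hS : world a b H ∅ (copySet P a b w c ∪ teeth a b w h c X Y) \
            {(X, rowY b c Y + c - 1)} =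
            world a b H ∅ (copySet P a b w c ∪ teeth a b w h c (X + 1) Y) := by
          ext ⟨p, q⟩
          simp only [Set.mem_sdiff, Set.mem_singleton_iff, mem_world, Set.mem_union, mem_teeth,
            Set.mem_empty_iff_false, false_or, Prod.mk.injEq]
          constructor
          · rintro ⟨h1 | h1 | ⟨h1, y, h2, h3, rfl, h4⟩, h5⟩
            · exact .inl h1
            · exact .inr (.inl h1)
            · refine .inr (.inr ⟨h1, y, h2, h3, rfl, ?_⟩)
              by_cases h6 : y = Y
              · subst h6; omega
              · omega
          · rintro (h1 | h1 | ⟨h1, y, h2, h3, rfl, h4⟩)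
            · exact ⟨.inl h1, by omega⟩
            · refine ⟨.inr (.inl h1), ?_⟩
              rintro ⟨rfl, rfl⟩
              exact hfull h1
            · refine ⟨.inr (.inr ⟨h1, y, h2, h3, rfl, by omega⟩), fun h5 => ?_⟩
              have := hinj y (by omega)
              omega
        refine (whl_step (by simpa using hmem) (m := 4) ((hsouth.seq (ite_false
          (fun h1 => hfull (hbelow.1 h1)) ((north_att (by ring) (.inl hmem)).seq
          (del_eq .east rfl (by simp [Dir.vec]) (fun _ => ?_) hnext hS)))).mono (by norm_num))
          (ih (X + 1) (by omega) (by omega))).mono ?_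
        · rw [hS]; exact conn_carved hP hF (by omega) hy₀ hH
        · push_cast; linarith
  refine (key (c * w).toNat _ (by omega) le_rfl).mono ?_
  rw [Int.toNat_of_nonneg e4]

/-- As in `climb`, the column `a - 3` is probed at the heights of the teeth: teeth not yet carved
are complete, and above the last of them there is nothing. By `hH` the spine is long enough not to
be extended here. -/
theorem carve {c : ℕ} {y₀ : ℤ} (hP : InBox P a b w h) (hF : Conn (copySet P a b w c)) (hc : 2 ≤ c)
    (hw : 1 ≤ w) (hh : 1 ≤ h) (hy₀ : (a - 3, y₀) ∈ copySet P a b w c)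
    (hH : rowY b c (b + h) + c - 1 ≤ H) :
    Exec (carve c) (world a b H ∅ (dest P a b w c (a + w + 1) (b + h))) (a - 2, b - 2)
      (world a b H ∅ (copySet P a b w c)) (a - 3, rowY b c (b + h) + c - 1)
      (h * (20 * (c * w)) + 2 * c + 5) := by
  have e3 : colX a w c a = a - 2 - c * w := by unfold colX; ring
  have e4 : (c : ℤ) ≤ c * w := by nlinarith
  have hH' : rowY b c (b + h) ≤ H := by omega
  have key : ∀ (n : ℕ) (Y : ℤ), b ≤ Y → Y + n = b + h →
      Exec (.whl true (.whl true (go .west) ;; go .east ;; RobotsOnTiles.carveRow ;; go .west ;;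
        rep c (put .north) ;; put .west))
        (world a b H ∅ (copySet P a b w c ∪ teeth a b w h c (colX a w c a) Y))
        (a - 3, rowY b c Y + c - 1)
        (world a b H ∅ (copySet P a b w c)) (a - 3, rowY b c (b + h) + c - 1)
        (n * (20 * (c * w)) + 1) := by
    intro n
    induction n with
    | zero =>
      intro Y hY hn
      obtain rfl : Y = b + h := by simpa using hn
      have hS : copySet P a b w c ∪ teeth a b w h c (colX a w c a) (b + h) =
          copySet P a b w c := by
        refine Set.union_eq_left.2 ?_
        rintro ⟨p, q⟩ ⟨_, y, _, h1, _, h2⟩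
        omega
      rw [hS]
      refine (whl_done ?_).mono (by simp)
      rw [eq_self_iff_true, true_iff, mem_world]
      rintro (h1 | h1 | h1)
      · exact h1
      · omega
      · have := copySet_bounds hP (by omega) h1; omega
    | succ n ih =>
      intro Y hY hn
      push_cast at hn
      have e1 := rowY_mono (b := b) (c := c) (by omega) hY
      have e2 := rowY_add_le (b := b) (c := c) (by omega) (show Y < b + h by omega)
      have e5 := rowY_add_one b c Y
      rw [rowY_start] at e1
      have hmem : ∀ z, colX a w c a ≤ z → z < a - 2 → (z, rowY b c Y + c - 1) ∈
          world a b H ∅ (copySet P a b w c ∪ teeth a b w h c (colX a w c a) Y) := fun z h1 h2 =>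
        .inr (.inr (mem_teeth.2 ⟨by omega, Y, hY, by omega, rfl, .inr ⟨rfl, h1⟩⟩))
      have h1 := carveRow (H := H) hP hF (by omega) hw hy₀ hH' hY (by omega)
      have h2 := ih (Y + 1) (by omega) (by omega)
      rw [teeth_next] at h1
      have h3 := spine_north (a := a) (b := b) (H := H) (H' := H) (A := ∅)
        (D := copySet P a b w c ∪ teeth a b w h c (colX a w c a) (Y + 1)) (x := a - 2)
        (y := rowY b c Y + c - 1) (y' := rowY b c (Y + 1) + c - 1) c rfl (by omega) (by omega)
        (by omega) (by omega)
      refine (whl_step (by simpa using hmem (a - 3) (by omega) (by omega))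
        ((tiles_west (x' := colX a w c a - 1) (by omega) (fun z h4 h5 =>
          hmem z (by omega) (by omega)) ?_).seq ((east_att (x' := colX a w c a) (by ring)
          (.inl (hmem _ le_rfl (by omega)))).seq (h1.seq ((west_att (x' := a - 2) (by ring)
          (.inl ?_)).seq (h3.seq (spine_put_west rfl rfl (by omega) (by omega) (by omega)))))))
          h2).mono ?_
      · rw [mem_world]
        rintro (h1 | h1 | h1 | ⟨_, y, h1⟩)
        · exact h1
        · omega
        · have := copySet_bounds hP (by omega) h1; omega
        · omega
      · rw [mem_world]; exact .inr (.inl ⟨rfl, by omega, by omega⟩)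
      · have : (2 : ℤ) ≤ c := by exact_mod_cast hc
        push_cast; rw [e3]; linarith
  have e1 := rowY_mono (b := b) (c := c) (by omega) (show b ≤ b + h by omega)
  rw [rowY_start] at e1
  rw [dest_eq hP (by omega) (by omega)]
  have h1 := key h.toNat b le_rfl (by omega)
  rw [Int.toNat_of_nonneg (by omega), rowY_start] at h1
  refine ((spine_north (a := a) (b := b) (H := H) (H' := H) (y' := b - 2 + c - 1) (c - 1) rfl
    (by omega) (by omega) (by omega) (by omega)).seq ((spine_put_west rfl rfl (by omega) (by omega)
    (by omega)).seq h1)).mono ?_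
  have : ((c - 1 : ℕ) : ℤ) = c - 1 := by omega
  rw [this]; linarith

end Exec

/-! ### Removing the west side of the frame -/

/-- The tiles of the copy `F`, and those of the west side of the frame from row `l` to row `m`. -/
def stem (F : Set Cell) (a l m : ℤ) : Set Cell := F ∪ {q | q.1 = a - 2 ∧ l ≤ q.2 ∧ q.2 ≤ m}

theorem mem_stem {F : Set Cell} {a l m x y : ℤ} :
    (x, y) ∈ stem F a l m ↔ (x, y) ∈ F ∨ x = a - 2 ∧ l ≤ y ∧ y ≤ m := Iff.rfl

theorem conn_stem {F : Set Cell} {a l m y₀ : ℤ} (hF : Conn F) (hy₀ : (a - 3, y₀) ∈ F)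
    (hl : l ≤ y₀) (hm : y₀ ≤ m) : Conn (stem F a l m) := by
  have hs : ∀ y, l ≤ y → y ≤ m → (a - 2, y) ∈ stem F a l m := fun y h1 h2 => .inr ⟨rfl, h1, h2⟩
  have hlink : Link (stem F a l m) (a - 2, y₀) (a - 3, y₀) :=
    Link.single (by rw [adj_pair]; grind) (hs _ hl hm) (.inl hy₀)
  refine Conn.of_hub (z := (a - 3, y₀)) (.inl hy₀) ?_
  rintro ⟨x, y⟩ (hq | ⟨rfl, h1, h2⟩)
  · exact (hF.2 _ hq _ hy₀).mono fun z hz => .inl hz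
  · refine Link.trans ?_ hlink
    rcases le_total y y₀ with h | h
    · exact Link.ver h fun z _ _ => hs z (by simp only at h1; omega) (by omega)
    · exact (Link.ver h fun z _ _ => hs z (by omega) (by simp only at h2; omega)).symm

/-- Remove the west side of the frame, first down to the highest row where it touches the copy,
then from its lower end on. -/
def removeStem : Prog :=
  go .east ;; .whl true (go .north) ;; go .south ;; go .west ;;
    .whl false (go .east ;; del .south ;; go .west) ;; go .east ;; .whl true (go .south) ;;
    go .north ;; eat .north ;; go .south ;; .act (some false) none

namespace Exec

variable {F : Set Cell} {a b H y₀ : ℤ}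

/-- The robot descends in the column `a - 3`, deleting the spine tile beside it, until it meets the
copy; so `y₀` is the highest row of contact. The spine stays attached there. -/
theorem trim (hF : Conn F) (hFl : IsLeft F a b) (hy₀ : (a - 3, y₀) ∈ F)
    (htop : ∀ y, y₀ < y → (a - 3, y) ∉ F) (hH : y₀ ≤ H) :
    Exec (.whl false (go .east ;; del .south ;; go .west)) (stem F a (b - 3) H) (a - 3, H)
      (stem F a (b - 3) y₀) (a - 3, y₀) (4 * (H - y₀) + 1) := by
  obtain ⟨n, rfl⟩ : ∃ n : ℕ, H = y₀ + n := ⟨(H - y₀).toNat, by omega⟩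
  have hb := hFl _ _ hy₀
  clear hH
  induction n with
  | zero => exact (whl_done (by simp [mem_stem, hy₀])).congr (by simp) (by simp) (by simp)
  | succ n ih =>
    have hS : stem F a (b - 3) (y₀ + (n + 1 : ℕ)) \ {(a - 2, y₀ + (n + 1 : ℕ))} =
        stem F a (b - 3) (y₀ + n) := by
      ext ⟨x, y⟩
      simp only [Set.mem_sdiff, Set.mem_singleton_iff, mem_stem, Prod.mk.injEq]
      have := hFl x y
      grind
    refine (whl_step ?_ ((east_att (x' := a - 2) (by ring) (.inl ?_)).seq ((del_eq .south
      (x' := a - 2) (y' := y₀ + n) (by simp [Dir.vec]) (by simp [Dir.vec]; ring) (fun _ => ?_) ?_ hS).seq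
      (go_west (x' := a - 3) (by ring) ?_))) ih).mono ?_
    · have := htop (y₀ + (n + 1 : ℕ)) (by push_cast; omega)
      rw [mem_stem]; grind
    · rw [mem_stem]; exact .inr (by omega)
    · rw [hS]; exact conn_stem hF hy₀ (by omega) (by omega)
    · rw [mem_stem]; exact .inr (by push_cast; omega)
    · rw [mem_stem]; exact .inr (by omega)
    · push_cast; linarith

theorem removeStem {y : ℤ} (hF : Conn F) (hFl : IsLeft F a b) (hy₀ : (a - 3, y₀) ∈ F)
    (htop : ∀ y, y₀ < y → (a - 3, y) ∉ F) (hH : y₀ ≤ H) (hy : b - 3 ≤ y) (hyH : y ≤ H) :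
    Exec removeStem (world a b H ∅ F) (a - 3, y) F (a - 2, y₀) (10 * (H - b + 5)) := by
  have hb := hFl _ _ hy₀
  have hout : ∀ x y, a - 2 ≤ x → (x, y) ∉ F := fun x y h1 h2 => by have := hFl x y h2; omega
  have e1 : world a b H ∅ F = stem F a (b - 3) H := by
    ext ⟨x, y⟩
    rw [mem_world, mem_stem, Set.mem_empty_iff_false, false_or, or_comm]
  have e2 : stem F a y₀ y₀ \ {(a - 2, y₀)} = F := by
    ext ⟨x, y⟩
    simp only [Set.mem_sdiff, Set.mem_singleton_iff, mem_stem, Prod.mk.injEq]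
    have := hFl x y
    grind
  -- The robot deletes the last tile beneath itself and remains attached to the copy in the west.
  have hlast : Exec (.act (some false) none) (stem F a y₀ y₀) (a - 2, y₀) F (a - 2, y₀) 1 := by
    have := del_stay (S := stem F a y₀ y₀) (u := (a - 2, y₀)) (fun _ => by rwa [e2])
      (by rw [e2]; exact .west (by rwa [show a - 2 - 1 = a - 3 by ring]))
    rwa [e2] at this
  have heat : Exec (RobotsOnTiles.eat .north) (stem F a (b - 3) y₀) (a - 2, b - 3)
      (stem F a y₀ y₀) (a - 2, y₀ + 1) (4 * (y₀ - (b - 3)) + 2) := by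
    refine eat_north (fun z => stem F a z y₀) (by omega) (fun z h1 h2 => ?_) ?_ ?_
    · have hS : stem F a (z + 1) y₀ = stem F a z y₀ \ {(a - 2, z)} := by
        ext ⟨x, y⟩
        simp only [Set.mem_sdiff, Set.mem_singleton_iff, mem_stem, Prod.mk.injEq]
        have := hFl x y
        grind
      refine ⟨hS, ?_, ?_, fun _ => ?_⟩
      · rw [mem_stem]; exact .inr (by omega)
      · rw [mem_stem]; exact .inr (by omega)
      · rw [← hS]; exact conn_stem hF hy₀ (by omega) le_rfl
    · rw [mem_stem]; exact .inr (by omega)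
    · have := hout (a - 2) (y₀ + 1) le_rfl
      rw [mem_stem]; grind
  rw [e1]
  refine ((east_att (x' := a - 2) (by ring) (.inl ?_)).seq ((tiles_north (y' := H + 1) (by omega)
    ?_ ?_).seq ((south_att (y' := H) (by ring) (.inl ?_)).seq ((go_west (x' := a - 3) (by ring)
    ?_).seq ((trim hF hFl hy₀ htop hH).seq ((go_east (x' := a - 2) (by ring) ?_).seq
    ((tiles_south (y' := b - 4) (by omega) ?_ ?_).seq ((north_att (y' := b - 3) (by ring)
    (.inl ?_)).seq (heat.seq ((south_att (y' := y₀) (by ring) (.inl ?_)).seq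
    hlast)))))))))).mono ?_
  · rw [mem_stem]; exact .inr (by omega)
  · intro z _ _; rw [mem_stem]; exact .inr (by omega)
  · have := hout (a - 2) (H + 1) le_rfl
    rw [mem_stem]; grind
  · rw [mem_stem]; exact .inr (by omega)
  · rw [mem_stem]; exact .inr (by omega)
  · rw [mem_stem]; exact .inl hy₀
  · intro z _ _; rw [mem_stem]; exact .inr (by omega)
  · have := hout (a - 2) (b - 4) le_rfl
    rw [mem_stem]; grind
  · rw [mem_stem]; exact .inr (by omega)
  · rw [mem_stem]; exact .inr (by omega)
  · linarith

end Exec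

/-! ### The whole algorithm -/

/-- Scale a polyomino by the factor `c`. -/
def scaling (c : ℕ) : Prog := prep ;; rows c ;; removeFrame ;; carve c ;; removeStem

theorem Exec.scaling {P : Set Cell} {a b w h x₀ : ℤ} {c : ℕ} (hPc : Conn P) (hP : InBox P a b w h)
    (hx₀ : (x₀, b) ∈ P) (heast : ∃ y, (a + w - 1, y) ∈ P) (hc : 2 ≤ c) :
    ∃ u, Exec (scaling c) (startSet P a b w h x₀) (x₀, b - 2) (copySet P a b w c) u
      (499 * (w * h * (c ^ 2 + c * w + c * h))) := by
  have hb := hP _ _ hx₀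
  have hw : 1 ≤ w := by omega
  have hh : 1 ≤ h := by omega
  have hc' : (2 : ℤ) ≤ c := by exact_mod_cast hc
  have hF := conn_copySet (a := a) (b := b) (w := w) (c := c) hPc (by omega)
  -- `P` reaches its easternmost column, so the copy touches the spine; the highest contact is the
  -- one that `trim` finds.
  obtain ⟨y₀, hy₀, htop⟩ : ∃ y₀, (a - 3, y₀) ∈ copySet P a b w c ∧
      ∀ y, (a - 3, y) ∈ copySet P a b w c → y ≤ y₀ := by
    obtain ⟨y, hy⟩ := heast
    have e := colX_add_one a w c (a + w - 1)
    rw [sub_add_cancel, colX_end] at e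
    exact Int.exists_greatest_of_bdd ⟨rowY b c (b + h), fun y hy =>
      (copySet_bounds hP (by omega) hy).2.2.le⟩ ⟨rowY b c y, (a + w - 1, y), hy,
      ⟨by simp only; omega, by simp only; omega⟩, le_rfl, by simp only; omega⟩
  have hy₀b := copySet_bounds hP (by omega) hy₀
  obtain ⟨H, h1, h2, h3, hrows⟩ := Exec.rows (c := c) hP hc hw hh
  refine ⟨_, ((Exec.prep (c := c) hP hw hh hb.1.1 hb.1.2).seq (hrows.seq ((Exec.removeFrame hP
    (isLeft_dest (by omega)) hw hh h1).seq ((Exec.carve hP hF hc hw hh hy₀ h2).seq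
    (Exec.removeStem (y₀ := y₀) hF (fun x y hq => ?_) hy₀ (fun y hy hq => ?_) (by omega) (by omega)
    h2))))).mono ?_⟩
  · have := copySet_bounds hP (by omega) hq; omega
  · have := htop y hq; omega
  · have e : rowY b c (b + h) = b - 2 + c * h := by unfold rowY; ring
    rw [e] at h3
    have k1 : (0 : ℤ) ≤ c * w := by positivity
    have k2 : (0 : ℤ) ≤ c * h := by positivity
    have k3 : (1 : ℤ) ≤ w * h := by nlinarith
    have hH : H - b ≤ h + 1 + c * h + c := by omega
    have k4 : (c : ℤ) ≤ c ^ 2 := by nlinarith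
    have k5 : w ≤ c * w := by nlinarith
    have k6 : h ≤ c * h := by nlinarith
    have k7 : (c : ℤ) ^ 2 + c * w + c * h ≤ w * h * (c ^ 2 + c * w + c * h) :=
      le_mul_of_one_le_left (by positivity) k3
    have k8 : h * (c * w) ≤ w * h * (c ^ 2 + c * w + c * h) := by
      have : (c : ℤ) ≤ c ^ 2 + c * w + c * h := by linarith
      nlinarith
    have k9 : h * (w * (100 * ((c : ℤ) * c + c * w + c * h))) =
        100 * (w * h * (c ^ 2 + c * w + c * h)) := by ring
    rw [k9]
    linarith

theorem coe_scaledCopy (c : ℕ) (P : Finset Cell) (a b : ℤ) (w : ℕ) :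
    (scaledCopy c P a b w : Set Cell) = copySet P a b w c := by
  ext ⟨x, y⟩
  simp only [scaledCopy, translate, scale, Finset.coe_image, Finset.coe_biUnion, Set.mem_image,
    Set.mem_iUnion, Finset.coe_product, Finset.coe_Ico, Set.mem_prod, Set.mem_Ico, copySet,
    Set.mem_ofPred_eq, Finset.mem_coe, exists_prop, Prod.exists, Prod.mk_add_mk, Prod.mk.injEq,
    colX, rowY]
  constructor
  · rintro ⟨p, q, ⟨s, t, hs, h1, h2⟩, rfl, rfl⟩
    refine ⟨s, t, hs, ⟨?_, ?_⟩, ?_, ?_⟩ <;> linarith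
  · rintro ⟨s, t, hs, h1, h2⟩
    refine ⟨x - (a - 2 - c * w - c * a), y - (b - 2 - c * b), ⟨s, t, hs, ⟨?_, ?_⟩, ?_, ?_⟩,
      by ring, by ring⟩ <;> linarith

theorem coe_startSet (P : Finset Cell) (a b : ℤ) (w h : ℕ) (x₀ : ℤ) :
    ((P ∪ boundingBox a b w h ∪ {(x₀, b - 1)} : Finset Cell) : Set Cell) =
      startSet P a b w h x₀ := by
  ext ⟨x, y⟩
  simp only [Finset.mem_coe, Finset.mem_union, boundingBox, Finset.mem_filter, Finset.mem_product,
    Finset.mem_Icc, Finset.mem_singleton, Prod.mk.injEq, mem_startSet]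
  by_cases hP : (x, y) ∈ P
  · simp [hP]
  · simp only [hP, false_or, or_false]; omega

theorem scaling_performs {c : ℕ} (hc : 2 ≤ c) {P : Finset Cell} {a b : ℤ} {w h : ℕ} {x : ℤ}
    (hP : IsPolyomino P) (hE : HasExtent P a b w h) (hx : (x, b) ∈ P) :
    ∃ u, Exec (scaling c) (P ∪ boundingBox a b w h ∪ {(x, b - 1)} : Finset Cell) (x, b - 2)
        (scaledCopy c P a b w) u ((499 * (w * h * (c ^ 2 + c * w + c * h)) : ℕ) : ℤ) ∧
      Conn ((P ∪ boundingBox a b w h ∪ {(x, b - 1)} : Finset Cell) : Set Cell) ∧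
      Att ((P ∪ boundingBox a b w h ∪ {(x, b - 1)} : Finset Cell) : Set Cell) (x, b - 2) := by
  have hP' : InBox P a b w h := fun x y hq => hE.inside _ hq
  have hPc : Conn (P : Set Cell) := conn_coe_iff.2 hP
  have hb := hP' _ _ hx
  rw [coe_startSet, coe_scaledCopy]
  obtain ⟨⟨p, q⟩, hp, rfl⟩ := hE.east
  obtain ⟨u, hu⟩ := Exec.scaling hPc hP' hx ⟨q, hp⟩ hc
  refine ⟨u, hu.mono (by push_cast; exact le_rfl),
    conn_startSet hPc (by omega) hx hP', .inl ?_⟩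
  rw [mem_startSet]; omega

end RobotsOnTiles

/-- Part one: a single robot, the polyomino and its bounding box being joined by one tile.
Part two: two robots, the second of which holds the polyomino and its bounding box together,
with or without a tile on its own vertex. -/
theorem theorem2 :
    ∃ C : ℕ, ∀ c : ℕ, 2 ≤ c →
      (∃ A : Program 1, ∀ (P : Finset Cell) (a b : ℤ) (w h : ℕ) (x : ℤ),
        IsPolyomino P → HasExtent P a b w h → (x, b) ∈ P →
          A.Performs (P ∪ boundingBox a b w h ∪ {(x, b - 1)}) ![(x, b - 2)]
            (scaledCopy c P a b w) (C * (w * h * (c ^ 2 + c * w + c * h)))) ∧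
      (∃ A : Program 2, ∀ (P : Finset Cell) (a b : ℤ) (w h : ℕ) (x : ℤ) (S : Finset Cell),
        IsPolyomino P → HasExtent P a b w h → (x, b) ∈ P →
        (S = P ∪ boundingBox a b w h ∨ S = P ∪ boundingBox a b w h ∪ {(x, b - 1)}) →
          A.Performs S ![(x, b - 2), (x, b - 1)]
            (scaledCopy c P a b w) (C * (w * h * (c ^ 2 + c * w + c * h)))) := by
  have hmono : ∀ {k : ℕ} {A : Program k} {S goal : Finset Cell} {pos : Fin k → Cell} {m n : ℕ},
      A.Performs S pos goal m → m ≤ n → A.Performs S pos goal n := by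
    rintro k A S goal pos m n ⟨t, ht, h⟩ hmn
    exact ⟨t, ht.trans hmn, h⟩
  -- Two robots need `2 * n + 2` steps with `n` equal to 499 times the product; as the product is
  -- positive, 1000 times it suffices.
  refine ⟨1000, fun c hc => ⟨⟨single (scaling c), fun P a b w h x hP hE hx => ?_⟩,
    ⟨twin (scaling c), fun P a b w h x S hP hE hx hS => ?_⟩⟩⟩
  · obtain ⟨u, h1, h2, h3⟩ := scaling_performs hc hP hE hx
    exact hmono (h1.single_performs h2 h3) (by omega)
  · obtain ⟨u, h1, h2, h3⟩ := scaling_performs hc hP hE hx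
    refine hmono (h1.twin_performs (S := S) h2 h3 (by rw [adj_pair]; grind) ?_) ?_
    · rcases hS with rfl | rfl
      · rw [Finset.union_comm _ {(x, b - 1)}, Finset.insert_eq]
      · exact Finset.insert_eq_of_mem (by simp)
    · have hb := hE.inside _ hx
      have h4 : 0 < w * h := Nat.mul_pos (by simp only at hb; omega) (by simp only at hb; omega)
      have : 0 < w * h * (c ^ 2 + c * w + c * h) := by positivity
      omega
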